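/- An $n$-periodic network $N$ of degree $d$ ($n\ge 2$, $d\ge 3$) is a connected simple graph, all of whose vertices have degree $d$, together with an immersion into $\mathbb R^n$ with straight edges of positive length such that distinct edges at a common vertex $v$ meet only in $v$, and with a lattice $\Lambda\subset\mathbb R^n$ of rank $n$ that acts on the graph by automorphisms which the immersion turns into translations, such that the quotient $N/\Lambda$ is a finite graph (loops and multiple edges being allowed). Its length $L$ is the sum of the lengths of the edges of $N/\Lambda$, its volume is $V=\operatorname{vol}(\mathbb R^n/\Lambda)$, and its length quotient is $L^n/V$. The network is balanced if $\sum_{i=1}^d \frac{p-q_i}{|p-q_i|}=0$ at each vertex $p$ with neighbours $q_1,\dots,q_d$. It is irreducible if $N/\Lambda$ has the least number of vertices possible for a balanced $n$-periodic network of degree $d$ in $\mathbb R^n$. A minimizer is an irreducible network whose length quotient is least among all irreducible $n$-periodic networks of the same degree whose quotient graph is isomorphic to its own; in particular, a network with least length quotient among all irreducible networks of its degree is a minimizer. A triply periodic network is a $3$-periodic network. **Corollary.** Let $N$ be an irreducible triply periodic network of degree $d\ge 7$. Then $$\frac{L^3}{V}>\frac{405}{8}.$$ Moreover, the length quotient of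 $N$ is strictly larger than the length quotient of every triply periodic minimizer of degree $d'\in\{3,4,5,6\}$. -/

import Mathlib

/-- An `n`-periodic network of degree `d`: a connected simple graph, immersed with straight edges
of positive length into `ℝⁿ`, all of whose vertices have degree `d`, invariant under a lattice of
rank `n` acting by translations, with finite quotient. The graph is only immersed, so that
`pos` need not be injective; the lattice need not be the full translation group of the network. -/
structure PeriodicNetwork (n d : ℕ) where
  two_le : 2 ≤ n
  three_le : 3 ≤ d
  /-- the vertices of the (infinite) graph; they form a countable set -/
  Vert : Type
  graph : SimpleGraph Vert
  connected : graph.Connected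
  degree_eq : ∀ v, (graph.neighborSet v).encard = d
  /-- the immersion, given by the positions of the vertices -/
  pos : Vert → EuclideanSpace ℝ (Fin n)
  pos_ne : ∀ u v, graph.Adj u v → pos u ≠ pos v
  /-- the star of each vertex is embedded: distinct edges at `v` meet only in `v` -/
  star_embedded : ∀ v u w, graph.Adj v u → graph.Adj v w → u ≠ w →
    segment ℝ (pos v) (pos u) ∩ segment ℝ (pos v) (pos w) = {pos v}
  lattice : Submodule ℤ (EuclideanSpace ℝ (Fin n))
  discrete : DiscreteTopology lattice
  /-- the lattice has full rank -/
  isZLattice : IsZLattice ℝ lattice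
  /-- the lattice acts on the abstract graph by automorphisms, and by translations on `ℝⁿ` -/
  [action : AddAction lattice Vert]
  vadd_adj : ∀ (g : lattice) (u v : Vert), graph.Adj u v → graph.Adj (g +ᵥ u) (g +ᵥ v)
  pos_vadd : ∀ (g : lattice) (v : Vert), pos (g +ᵥ v) = (g : EuclideanSpace ℝ (Fin n)) + pos v
  /-- the quotient has finitely many vertices (hence, as degrees are finite, finitely many edges) -/
  finite_quotient : Finite (AddAction.orbitRel.Quotient lattice Vert)

namespace PeriodicNetwork

attribute [instance] PeriodicNetwork.action PeriodicNetwork.discrete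
  PeriodicNetwork.isZLattice PeriodicNetwork.finite_quotient

variable {n d : ℕ} (N : PeriodicNetwork n d)

/-! ### The quotient multigraph -/

/-- The vertices of the quotient graph `N/Λ`. -/
abbrev QuotVert : Type := AddAction.orbitRel.Quotient N.lattice N.Vert

/-- Two edges of `N` are equivalent when a lattice translation carries one to the other. -/
def edgeSetoid : Setoid N.graph.edgeSet where
  r e f := ∃ g : N.lattice, Sym2.map (fun v => g +ᵥ v) e.1 = f.1
  iseqv :=
    { refl := fun e => ⟨0, by simp⟩
      symm := by
        rintro e f ⟨g, h⟩
        exact ⟨-g, by simp [← h, Sym2.map_map]⟩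
      trans := by
        rintro e f k ⟨g, h⟩ ⟨g', h'⟩
        exact ⟨g' + g, by simp [← h', ← h, Sym2.map_map, add_vadd]⟩ }

/-- The edges of the quotient graph `N/Λ`; loops and multiple edges are allowed. -/
def QuotEdge : Type := Quotient N.edgeSetoid

/-- The unordered pair of end points of an edge of `N/Λ`. -/
def ends : N.QuotEdge → Sym2 N.QuotVert :=
  Quotient.lift
    (fun e : N.graph.edgeSet => Sym2.map (Quotient.mk (AddAction.orbitRel N.lattice N.Vert)) e.1)
    (by
      rintro e f ⟨g, h⟩
      rw [← h, Sym2.map_map]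
      congr 1
      funext v
      exact Quotient.sound ((AddAction.orbitRel N.lattice N.Vert).symm ⟨g, rfl⟩))

/-- The length of a straight segment, as a function of its unordered pair of end points. -/
noncomputable def segLength : Sym2 N.Vert → ℝ :=
  Sym2.lift ⟨fun u v => dist (N.pos u) (N.pos v), fun _ _ => dist_comm _ _⟩

/-- The length of an edge of `N/Λ`. -/
noncomputable def edgeLength : N.QuotEdge → ℝ :=
  Quotient.lift (fun e : N.graph.edgeSet => N.segLength e.1)
    (by
      rintro ⟨e, he⟩ ⟨f, hf⟩ ⟨g, h⟩
      change N.segLength e = N.segLength f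
      have h : Sym2.map (fun v => g +ᵥ v) e = f := h
      rw [← h]
      induction e using Sym2.ind with
      | _ u v => simp [segLength, N.pos_vadd])

theorem finite_neighborSet (v : N.Vert) : (N.graph.neighborSet v).Finite :=
  Set.finite_of_encard_eq_coe (N.degree_eq v)

instance finite_quotEdge : Finite N.QuotEdge := by
  have hfin : ∀ q : N.QuotVert, Finite (N.graph.neighborSet q.out) :=
    fun q => N.finite_neighborSet q.out
  let F : (Σ q : N.QuotVert, N.graph.neighborSet q.out) → N.QuotEdge := fun x =>
    Quotient.mk N.edgeSetoid ⟨s(x.1.out, x.2.1), x.2.2⟩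
  refine Finite.of_surjective F ?_
  intro e
  induction e using Quotient.inductionOn with
  | _ e =>
    obtain ⟨e, he⟩ := e
    induction e using Sym2.ind with
    | _ u v =>
      have hu : (AddAction.orbitRel N.lattice N.Vert).r
          (Quotient.mk (AddAction.orbitRel N.lattice N.Vert) u).out u := Quotient.mk_out u
      obtain ⟨g, hg⟩ := hu
      have hg : g +ᵥ u = (Quotient.mk (AddAction.orbitRel N.lattice N.Vert) u).out := hg
      have hadj : N.graph.Adj (Quotient.mk (AddAction.orbitRel N.lattice N.Vert) u).out (g +ᵥ v) := by
        rw [← hg]; exact N.vadd_adj g u v he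
      refine ⟨⟨Quotient.mk _ u, ⟨g +ᵥ v, hadj⟩⟩, ?_⟩
      refine Quotient.sound (N.edgeSetoid.symm ⟨g, ?_⟩)
      change s(g +ᵥ u, g +ᵥ v) = s(_, g +ᵥ v)
      rw [hg]

/-- The number of vertices of `N/Λ`. -/
noncomputable def vertexCount : ℕ := Nat.card N.QuotVert

/-- The length `L = L(N/Λ)`: the sum of the lengths of the finitely many edges of `N/Λ`. -/
noncomputable def length : ℝ := ∑ᶠ e : N.QuotEdge, N.edgeLength e

/-- The spanned volume `V = V(ℝⁿ/Λ)`. -/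
noncomputable def spannedVolume : ℝ := ZLattice.covolume N.lattice

/-- The length quotient `Lⁿ/V`. -/
noncomputable def lengthQuotient : ℝ := N.length ^ n / N.spannedVolume

/-! ### Balancing, irreducibility, minimizers -/

/-- The total force exerted at `p` by the (finitely many) edges incident to `p`. -/
noncomputable def force (p : N.Vert) : EuclideanSpace ℝ (Fin n) :=
  ∑ᶠ q ∈ N.graph.neighborSet p, ‖N.pos p - N.pos q‖⁻¹ • (N.pos p - N.pos q)

/-- A network is balanced if the total force vanishes at each vertex. -/
def IsBalanced : Prop := ∀ p, N.force p = 0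

/-- A network of degree `d` in `ℝⁿ` is irreducible if its quotient has the least number of vertices
possible for a balanced network of degree `d` in `ℝⁿ`. -/
def IsIrreducible : Prop :=
  IsLeast {k : ℕ | ∃ M : PeriodicNetwork n d, M.IsBalanced ∧ M.vertexCount = k} N.vertexCount

/-- The quotient graphs of two networks are isomorphic as multigraphs. -/
def SameQuotient {d' : ℕ} (M : PeriodicNetwork n d) (M' : PeriodicNetwork n d') : Prop :=
  ∃ (φ : M.QuotVert ≃ M'.QuotVert) (ψ : M.QuotEdge ≃ M'.QuotEdge),
    ∀ e, M'.ends (ψ e) = Sym2.map φ (M.ends e)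

/-- `M` is a minimizer: it is irreducible and has the least length quotient among the
irreducible networks of the same degree with the same quotient graph. (In particular, a network
with the least length quotient among all irreducible networks of its degree is a minimizer.) -/
def IsMinimizer (M : PeriodicNetwork n d) : Prop :=
  M.IsIrreducible ∧ ∀ M' : PeriodicNetwork n d, M'.IsIrreducible → M.SameQuotient M' →
    M.lengthQuotient ≤ M'.lengthQuotient

end PeriodicNetwork

/-! The number 54 separates the two classes: irreducible networks of degree at least 7 satisfy
$L^3\ge 54V$, while minimizers of degree at most 6 satisfy $L^3<54V$; and $405/8<54$.

Lower bound. Explicit balanced networks (`exists_isBalanced_of_even`, `exists_layered_network`) show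
that for $d\ge5$ an irreducible network has at most two vertices in its quotient. Loops of the
quotient, and differences of two parallel edges, are lattice vectors whose total length is
controlled by $L$. For $d\ge7$ there is usually room for four nonzero lattice vectors of rank three
with total length at most $L$. If $x,y,z$ are independent, the fourth vector can replace one of
them, so $V$ is bounded by two products of norms sharing two factors, and AM-GM gives $54V\le L^3$
(`covolume_le_of_four`). The exception is two vertices without loops, joined by at least seven
edges. There $V$ is bounded by the third elementary symmetric function of four edge lengths, and a
direct inequality (`e3_bound`) uses the remaining edges.

Upper bound. Irreducibility depends only on the number of vertices of the quotient, so a minimizer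
may be compared with any network on the same quotient graph, balanced or not. In degrees 3, 4 and 6
the quotient has 4, 2 and 1 vertices, hence first Betti number three. Contracting a spanning tree,
with the three other edges along the coordinate axes, brings the length quotient close to 27
(`exists_sameQuotient_of_card_quotEdge`). In degree 5 the quotient has two vertices with zero, one
or two loops at each. The first two graphs are realized explicitly below 54; the third contains a
bridge, which can always be shortened, so it carries no minimizer (`exists_length_lt_of_bridge`).

Throughout, a network is encoded by voltages: after choosing one vertex per orbit, each directed
quotient edge becomes a lattice vector. -/

/-- Three-dimensional Euclidean space. -/
abbrev Space : Type := EuclideanSpace ℝ (Fin 3)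

/-! ### Determinants of triples of vectors. -/

/-- The determinant of three vectors of `ℝ³`. -/
def det₃ (x y z : Space) : ℝ :=
  x 0 * (y 1 * z 2 - y 2 * z 1) - x 1 * (y 0 * z 2 - y 2 * z 0) + x 2 * (y 0 * z 1 - y 1 * z 0)

theorem det₃_eq_basis_det (x y z : Space) :
    (EuclideanSpace.basisFun (Fin 3) ℝ).toBasis.det ![x, y, z] = det₃ x y z := by
  rw [Module.Basis.det_apply, Matrix.det_fin_three]
  simp [Module.Basis.toMatrix_apply, det₃]
  ring

theorem abs_det₃_le (x y z : Space) : |det₃ x y z| ≤ ‖x‖ * ‖y‖ * ‖z‖ := by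
  have : Fact (Module.finrank ℝ Space = 3) := ⟨by simp⟩
  let b := EuclideanSpace.basisFun (Fin 3) ℝ
  have h := (b.toBasis.orientation).abs_volumeForm_apply_le ![x, y, z]
  rw [Orientation.volumeForm_robust _ b rfl, det₃_eq_basis_det] at h
  simpa [Fin.prod_univ_three] using h

/-- Cramer's rule with the denominator cleared; it drives the exchange step in
`covolume_le_of_four`. -/
theorem det₃_cramer (x y z g : Space) :
    det₃ x y z • g = det₃ g y z • x + det₃ x g z • y + det₃ x y g • z := by
  ext i
  fin_cases i <;> simp [det₃] <;> ring

theorem det₃_add_right (x y z z' : Space) : det₃ x y (z + z') = det₃ x y z + det₃ x y z' := by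
  simp [det₃]; ring

theorem det₃_neg_right (x y z : Space) : det₃ x y (-z) = -det₃ x y z := by
  simp [det₃]; ring

theorem det₃_self_right (x y : Space) : det₃ x y y = 0 := by
  simp [det₃]; ring

theorem det₃_self_left (x y : Space) : det₃ x y x = 0 := by
  simp [det₃]; ring

theorem det₃_swap (x y z : Space) : det₃ x z y = -det₃ x y z := by
  simp [det₃]; ring

theorem det₃_zero_mid (y z : Space) : det₃ y 0 z = 0 := by simp [det₃]

theorem det₃_zero_right (y z : Space) : det₃ y z 0 = 0 := by simp [det₃]

/-- The determinant of differences is bounded by the third elementary symmetric function. -/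
theorem abs_det₃_sub_le (a b c e : Space) :
    |det₃ (b - a) (c - a) (e - a)| ≤
      ‖a‖ * ‖b‖ * ‖c‖ + ‖a‖ * ‖b‖ * ‖e‖ + ‖a‖ * ‖c‖ * ‖e‖ + ‖b‖ * ‖c‖ * ‖e‖ := by
  have h : det₃ (b - a) (c - a) (e - a) =
      det₃ b c e - det₃ a c e + det₃ a b e - det₃ a b c := by
    simp [det₃]; ring
  have h1 := abs_le.1 (abs_det₃_le b c e)
  have h2 := abs_le.1 (abs_det₃_le a c e)
  have h3 := abs_le.1 (abs_det₃_le a b e)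
  have h4 := abs_le.1 (abs_det₃_le a b c)
  rw [h, abs_le]
  constructor <;> linarith [h1.1, h1.2, h2.1, h2.2, h3.1, h3.2, h4.1, h4.2]

theorem exists_det₃_ne_zero_of_ne_zero {x : Space} (hx : x ≠ 0) : ∃ y z, det₃ x y z ≠ 0 := by
  by_contra! h
  apply hx
  have h0 := h (EuclideanSpace.single 1 1) (EuclideanSpace.single 2 1)
  have h1 := h (EuclideanSpace.single 2 1) (EuclideanSpace.single 0 1)
  have h2 := h (EuclideanSpace.single 0 1) (EuclideanSpace.single 1 1)
  simp [det₃] at h0 h1 h2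
  ext i
  fin_cases i <;> simp [h0, h1, h2]

/-- Vectors whose determinants with all third vectors vanish lie on a common line. -/
theorem smul_eq_of_det₃_eq_zero {x y : Space} (h : ∀ z, det₃ x y z = 0) (i : Fin 3) :
    x i • y = y i • x := by
  have h0 := h (EuclideanSpace.single 0 1)
  have h1 := h (EuclideanSpace.single 1 1)
  have h2 := h (EuclideanSpace.single 2 1)
  simp [det₃] at h0 h1 h2
  ext j
  fin_cases i <;> fin_cases j <;> simp <;> linarith

theorem exists_smul_of_det₃_eq_zero {x y : Space} (hx : x ≠ 0) (h : ∀ z, det₃ x y z = 0) :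
    ∃ c : ℝ, y = c • x := by
  obtain ⟨i, hi⟩ : ∃ i, x i ≠ 0 := by
    by_contra! h'
    exact hx (by ext i; simp [h' i])
  refine ⟨(x i)⁻¹ * y i, ?_⟩
  rw [mul_smul, ← smul_eq_of_det₃_eq_zero h i, smul_smul, inv_mul_cancel₀ hi, one_smul]

/-- Linear independence of two vectors is expressed throughout as the existence of a third one with
nonzero determinant. Dependent vectors lie on a common ray up to sign. -/
theorem exists_det₃_ne_zero_of_not_sameRay {x y : Space} (h : ¬ SameRay ℝ x y)
    (h' : ¬ SameRay ℝ x (-y)) : ∃ z, det₃ x y z ≠ 0 := by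
  by_contra! hd
  have hx : x ≠ 0 := by rintro rfl; exact h (SameRay.zero_left _)
  obtain ⟨c, rfl⟩ := exists_smul_of_det₃_eq_zero hx hd
  rcases le_total 0 c with hc | hc
  · exact h (SameRay.sameRay_nonneg_smul_right x hc)
  · apply h'
    rw [← neg_smul]
    exact SameRay.sameRay_nonneg_smul_right x (neg_nonneg.2 hc)

/-! ### Covolume and short lattice vectors. -/

section Lattice

variable (Λ : Submodule ℤ Space) [DiscreteTopology Λ] [IsZLattice ℝ Λ]

theorem covolume_eq_abs_det₃ (b : Module.Basis (Fin 3) ℤ Λ) :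
    ZLattice.covolume Λ = |det₃ (b 0) (b 1) (b 2)| := by
  have h := ZLattice.covolume_eq_det_mul_measureReal Λ MeasureTheory.volume b
    (EuclideanSpace.basisFun (Fin 3) ℝ).toBasis
  have h1 : MeasureTheory.volume.real
      (ZSpan.fundamentalDomain (EuclideanSpace.basisFun (Fin 3) ℝ).toBasis) = 1 := by
    rw [MeasureTheory.measureReal_def, MeasureTheory.measure_congr (ZSpan.fundamentalDomain_ae_parallelepiped _ _)]
    rw [OrthonormalBasis.coe_toBasis, OrthonormalBasis.volume_parallelepiped]
    simp
  have h2 : ((↑) ∘ b : Fin 3 → Space) = ![(b 0 : Space), b 1, b 2] := by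
    ext i; fin_cases i <;> rfl
  rw [h1, h2, det₃_eq_basis_det, mul_one] at h
  exact h

/-- In a lattice basis the three vectors have an integer coordinate matrix. Its determinant is a
nonzero integer, the index of the sublattice up to sign, hence at least 1 in absolute value. -/
theorem covolume_le_abs_det₃ {x y z : Space} (hx : x ∈ Λ) (hy : y ∈ Λ) (hz : z ∈ Λ)
    (h : det₃ x y z ≠ 0) : ZLattice.covolume Λ ≤ |det₃ x y z| := by
  have hr : Module.finrank ℤ Λ = 3 := by rw [ZLattice.rank ℝ Λ]; simp
  have : Module.Finite ℤ Λ := ZLattice.module_finite ℝ Λ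
  have : Module.Free ℤ Λ := ZLattice.module_free ℝ Λ
  let b : Module.Basis (Fin 3) ℤ Λ := Module.finBasisOfFinrankEq ℤ Λ hr
  have key : ∀ w : Λ, ∀ i, (w : Space) i =
      (b.repr w 0 : ℝ) * (b 0 : Space) i + (b.repr w 1 : ℝ) * (b 1 : Space) i
        + (b.repr w 2 : ℝ) * (b 2 : Space) i := by
    intro w i
    have := congrArg (fun v : Λ => (v : Space) i) (b.sum_repr w)
    rw [← this, Fin.sum_univ_three]
    simp [← Int.cast_smul_eq_zsmul ℝ, -Module.Basis.sum_repr]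
  have kx := key ⟨x, hx⟩
  have ky := key ⟨y, hy⟩
  have kz := key ⟨z, hz⟩
  simp only at kx ky kz
  generalize b.repr ⟨x, hx⟩ = X at kx
  generalize b.repr ⟨y, hy⟩ = Y at ky
  generalize b.repr ⟨z, hz⟩ = Z at kz
  have hd : det₃ x y z = ((X 0 * (Y 1 * Z 2 - Y 2 * Z 1) - X 1 * (Y 0 * Z 2 - Y 2 * Z 0)
      + X 2 * (Y 0 * Z 1 - Y 1 * Z 0) : ℤ) : ℝ) * det₃ (b 0) (b 1) (b 2) := by
    simp only [det₃, kx, ky, kz]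
    push_cast
    ring
  rw [hd] at h
  rw [covolume_eq_abs_det₃ Λ b, hd, abs_mul]
  have : (1 : ℝ) ≤ |((X 0 * (Y 1 * Z 2 - Y 2 * Z 1) - X 1 * (Y 0 * Z 2 - Y 2 * Z 0)
      + X 2 * (Y 0 * Z 1 - Y 1 * Z 0) : ℤ) : ℝ)| := by
    rw [← Int.cast_abs]
    exact_mod_cast Int.one_le_abs (by rintro h0; rw [h0] at h; simp at h)
  exact le_mul_of_one_le_left (abs_nonneg _) this

theorem covolume_le_mul_norm {x y z : Space} (hx : x ∈ Λ) (hy : y ∈ Λ) (hz : z ∈ Λ)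
    (h : det₃ x y z ≠ 0) : ZLattice.covolume Λ ≤ ‖x‖ * ‖y‖ * ‖z‖ :=
  (covolume_le_abs_det₃ Λ hx hy hz h).trans (abs_det₃_le x y z)

theorem mul_le_add_cube {a b c : ℝ} (ha : 0 ≤ a) (hb : 0 ≤ b) (hc : 0 ≤ c) :
    27 * (a * b * c) ≤ (a + b + c) ^ 3 := by
  nlinarith [mul_nonneg ha (sq_nonneg (b - c)), mul_nonneg hb (sq_nonneg (a - c)),
    mul_nonneg hc (sq_nonneg (a - b)), mul_nonneg (add_nonneg (add_nonneg ha hb) hc)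
    (add_nonneg (add_nonneg (sq_nonneg (a - b)) (sq_nonneg (b - c))) (sq_nonneg (a - c)))]

/-- Adding the two bounds gives $2V\le ab(c+e)$; AM-GM for $a$, $b$, $c+e$ then gives the constant
$54=2\cdot27$. -/
theorem amgm_pair {V a b c e : ℝ} (ha : 0 ≤ a) (hb : 0 ≤ b) (hc : 0 ≤ c)
    (he : 0 ≤ e) (h : V ≤ a * b * c) (h' : V ≤ a * b * e) : 54 * V ≤ (a + b + c + e) ^ 3 := by
  have h1 := mul_le_add_cube ha hb (add_nonneg hc he)
  nlinarith

/-- Four nonzero lattice vectors of rank three have a total length of at least `(54 V)^(1/3)`. -/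
theorem covolume_le_of_four {x y z w : Space} (hx : x ∈ Λ) (hy : y ∈ Λ) (hz : z ∈ Λ) (hw : w ∈ Λ)
    (h : det₃ x y z ≠ 0) (hw0 : w ≠ 0) {s : ℝ} (hs : ‖x‖ + ‖y‖ + ‖z‖ + ‖w‖ ≤ s) :
    54 * ZLattice.covolume Λ ≤ s ^ 3 := by
  have hle : (‖x‖ + ‖y‖ + ‖z‖ + ‖w‖) ^ 3 ≤ s ^ 3 := by gcongr
  refine le_trans ?_ hle
  have h0 := covolume_le_mul_norm Λ hx hy hz h
  -- Exchange: if `w` could replace none of `x`, `y`, `z`, all its Cramer coefficients would vanish,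
  -- forcing `w = 0`.
  have hne : det₃ w y z ≠ 0 ∨ det₃ x w z ≠ 0 ∨ det₃ x y w ≠ 0 := by
    by_contra! hc
    have := det₃_cramer x y z w
    rw [hc.1, hc.2.1, hc.2.2] at this
    simp [h, hw0] at this
  rcases hne with h1 | h1 | h1
  · have := amgm_pair (norm_nonneg y) (norm_nonneg z) (norm_nonneg x) (norm_nonneg w)
      (by linarith) (by linarith [covolume_le_mul_norm Λ hw hy hz h1])
    exact this.trans (le_of_eq (by ring))
  · have := amgm_pair (norm_nonneg x) (norm_nonneg z) (norm_nonneg y) (norm_nonneg w)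
      (by linarith) (by linarith [covolume_le_mul_norm Λ hx hw hz h1])
    exact this.trans (le_of_eq (by ring))
  · exact amgm_pair (norm_nonneg x) (norm_nonneg y) (norm_nonneg z) (norm_nonneg w)
      h0 (covolume_le_mul_norm Λ hx hy hw h1)

end Lattice

/-! ### The inequality for seven parallel edges. -/

/-- The case $a=b$, $c=e=s/2$ of `e3_bound`, to which the general one is reduced. The factor
$(s-7b)^2$ makes the difference visibly nonnegative. -/
theorem e3_bound_of_eq {b s : ℝ} (hb : 0 ≤ b) (hs : 0 ≤ s) :
    54 * (b ^ 2 * s + b * s ^ 2 / 2) ≤ (5 * b + s) ^ 3 := by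
  have : (5 * b + s) ^ 3 - 54 * (b ^ 2 * s + b * s ^ 2 / 2)
      = (s - 7 * b) ^ 2 * (s + 2 * b) + 27 * b ^ 3 := by ring
  have h1 : 0 ≤ (s - 7 * b) ^ 2 * (s + 2 * b) + 27 * b ^ 3 := by positivity
  linarith

/-- For fixed $s=c+e$ the left side is largest when $c=e$, and lowering $a=b-\delta$ from $b$ only
enlarges the gap. The right side contains $4b$ because three further edges, each of length at least
$b$, accompany the four edges $a,b,c,e$. -/
theorem e3_bound {a b c e : ℝ} (ha : 0 ≤ a) (hab : a ≤ b) (hbc : b ≤ c) (hbe : b ≤ e) :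
    54 * (a * b * c + a * b * e + a * c * e + b * c * e) ≤ (a + 4 * b + c + e) ^ 3 := by
  obtain ⟨s, hs⟩ : ∃ s, s = c + e := ⟨_, rfl⟩
  obtain ⟨δ, hδ⟩ : ∃ δ, δ = b - a := ⟨_, rfl⟩
  have hδ0 : 0 ≤ δ := by linarith
  have hδb : δ ≤ b := by linarith
  have hb : 0 ≤ b := by linarith
  have hsb : 2 * b ≤ s := by linarith
  have h1 : c * e ≤ s ^ 2 / 4 := by rw [hs]; nlinarith [sq_nonneg (c - e)]
  have h2 : (a + b) * (c * e) ≤ (a + b) * (s ^ 2 / 4) := by gcongr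
  have h3 := e3_bound_of_eq hb (by linarith : 0 ≤ s)
  have h4 : 54 * (a * b * s + (a + b) * (s ^ 2 / 4)) ≤ (a + 4 * b + s) ^ 3 := by
    have ha' : a = b - δ := by linarith
    subst ha'
    have : (b - δ + 4 * b + s) ^ 3 - 54 * ((b - δ) * b * s + (b - δ + b) * (s ^ 2 / 4))
        = ((5 * b + s) ^ 3 - 54 * (b ^ 2 * s + b * s ^ 2 / 2))
          + δ * (54 * b * s + 54 / 4 * s ^ 2 - 3 * (5 * b + s) ^ 2 + 3 * (5 * b + s) * δ - δ ^ 2) := by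
      ring
    have h5 : 0 ≤ 54 * b * s + 54 / 4 * s ^ 2 - 3 * (5 * b + s) ^ 2 + 3 * (5 * b + s) * δ - δ ^ 2 := by
      nlinarith [mul_nonneg hb hδ0, mul_nonneg hδ0 (by linarith : 0 ≤ s - 2 * b), mul_nonneg hb (by linarith : 0 ≤ s - 2 * b), mul_nonneg hδ0 (by linarith : 0 ≤ b - δ)]
    have := mul_nonneg hδ0 h5
    linarith
  have h6 : a + 4 * b + c + e = a + 4 * b + s := by rw [hs]; ring
  rw [h6]
  have : a * b * s = a * b * c + a * b * e := by rw [hs]; ring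
  nlinarith

/-! ### Embedded stars in terms of rays. -/

/-- Two nondegenerate segments from `p` overlap beyond `p` exactly when they leave it in the same
direction. The ray condition ignores edge lengths and is stable under perturbation, so it replaces
the segment condition from here on. -/
theorem segment_inter_segment_eq_singleton_iff {E : Type*} [NormedAddCommGroup E] [NormedSpace ℝ E]
    {p q r : E} (hq : q ≠ p) (hr : r ≠ p) :
    segment ℝ p q ∩ segment ℝ p r = {p} ↔ ¬ SameRay ℝ (q - p) (r - p) := by
  have hq' : q - p ≠ 0 := sub_ne_zero.2 hq
  have hr' : r - p ≠ 0 := sub_ne_zero.2 hr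
  simp only [segment_eq_image']
  constructor
  · intro h hs
    obtain ⟨a, b, ha, hb, hab⟩ := hs.exists_pos hq' hr'
    have hm : (a / (a + b)) • (q - p) = (b / (a + b)) • (r - p) := by
      rw [div_eq_inv_mul, div_eq_inv_mul, mul_smul, mul_smul, hab]
    have h1 : p + (a / (a + b)) • (q - p) ∈ ({p} : Set E) := by
      rw [← h]
      refine ⟨⟨_, ⟨by positivity, by rw [div_le_one (by positivity)]; linarith⟩, rfl⟩,
        ⟨b / (a + b), ⟨by positivity, by rw [div_le_one (by positivity)]; linarith⟩, ?_⟩⟩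
      simp only [hm]
    have h2 : (a / (a + b)) • (q - p) = 0 := by simpa using h1
    rcases smul_eq_zero.1 h2 with h3 | h3
    · have : 0 < a / (a + b) := by positivity
      exact this.ne' h3
    · exact hq' h3
  · intro h
    ext x
    simp only [Set.mem_inter_iff, Set.mem_image, Set.mem_singleton_iff]
    constructor
    · rintro ⟨⟨a, ha, rfl⟩, b, hb, hab⟩
      have hab' : a • (q - p) = b • (r - p) := (add_left_cancel hab).symm
      rcases ha.1.eq_or_lt with h0 | h0
      · simp [← h0]
      · exfalso
        apply h
        rcases hb.1.eq_or_lt with h1 | h1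
        · rw [← h1, zero_smul] at hab'
          rcases smul_eq_zero.1 hab' with h2 | h2
          · exact absurd h2 h0.ne'
          · exact absurd h2 hq'
        · exact Or.inr (Or.inr ⟨a, b, h0, h1, hab'⟩)
    · rintro rfl
      exact ⟨⟨0, by simp, by simp⟩, ⟨0, by simp, by simp⟩⟩

/-! ### Voltages, transversals and counting in the quotient graph. -/

namespace PeriodicNetwork

variable {n d : ℕ} (N : PeriodicNetwork n d)

theorem vadd_right_injective' {g h : N.lattice} {v : N.Vert} (e : g +ᵥ v = h +ᵥ v) : g = h := by
  have := congrArg N.pos e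
  rw [N.pos_vadd, N.pos_vadd] at this
  exact Subtype.ext (add_right_cancel this)

theorem adj_vadd_iff (g : N.lattice) (u v : N.Vert) :
    N.graph.Adj (g +ᵥ u) (g +ᵥ v) ↔ N.graph.Adj u v :=
  ⟨fun h => by simpa using N.vadd_adj (-g) _ _ h, N.vadd_adj g u v⟩

theorem adj_vadd_vadd_iff (g h : N.lattice) (u v : N.Vert) :
    N.graph.Adj (g +ᵥ u) (h +ᵥ v) ↔ N.graph.Adj u ((h - g) +ᵥ v) := by
  rw [← N.adj_vadd_iff g u, vadd_vadd, add_sub_cancel]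

theorem finite_setOf_adj_vadd (u v : N.Vert) : {g : N.lattice | N.graph.Adj u (g +ᵥ v)}.Finite :=
  (N.finite_neighborSet u).preimage (f := fun g : N.lattice => g +ᵥ v)
    (fun _ _ _ _ h => N.vadd_right_injective' h)

/-- The lattice vectors carrying `v` to a neighbour of `u`. -/
noncomputable def volt (u v : N.Vert) : Finset N.lattice := (N.finite_setOf_adj_vadd u v).toFinset

@[simp] theorem mem_volt {u v : N.Vert} {g : N.lattice} :
    g ∈ N.volt u v ↔ N.graph.Adj u (g +ᵥ v) := by simp [volt]

theorem neg_mem_volt {u v : N.Vert} {g : N.lattice} : -g ∈ N.volt v u ↔ g ∈ N.volt u v := by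
  rw [mem_volt, mem_volt, ← N.adj_vadd_iff g v, vadd_vadd, add_neg_cancel, zero_vadd,
    N.graph.adj_comm]

theorem card_volt_comm (u v : N.Vert) : (N.volt u v).card = (N.volt v u).card := by
  refine Finset.card_bij (fun g _ => -g) (fun g hg => N.neg_mem_volt.2 hg)
    (fun _ _ _ _ h => neg_injective h) (fun g hg => ⟨-g, ?_, neg_neg g⟩)
  exact N.neg_mem_volt.2 hg

/-- The vector from `u` to its neighbour `g + v`. -/
def vec (u v : N.Vert) (g : N.lattice) : EuclideanSpace ℝ (Fin n) := N.pos (g +ᵥ v) - N.pos u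

theorem vec_eq (u v : N.Vert) (g : N.lattice) :
    N.vec u v g = (g : EuclideanSpace ℝ (Fin n)) + N.pos v - N.pos u := by
  rw [vec, N.pos_vadd]

theorem vec_self (u : N.Vert) (g : N.lattice) : N.vec u u g = g := by
  rw [vec_eq, add_sub_cancel_right]

theorem vec_ne_zero {u v : N.Vert} {g : N.lattice} (h : g ∈ N.volt u v) : N.vec u v g ≠ 0 :=
  sub_ne_zero.2 (N.pos_ne _ _ (N.mem_volt.1 h)).symm

theorem norm_vec_neg (u v : N.Vert) (g : N.lattice) : ‖N.vec v u (-g)‖ = ‖N.vec u v g‖ := by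
  rw [← norm_neg, vec_eq, vec_eq]
  congr 1
  push_cast
  abel

theorem ne_zero_of_mem_volt_self {u : N.Vert} {g : N.lattice} (h : g ∈ N.volt u u) :
    (g : EuclideanSpace ℝ (Fin n)) ≠ 0 := by
  simpa [vec_self] using N.vec_ne_zero h

theorem not_sameRay_vec {u v w : N.Vert} {g h : N.lattice} (hg : g ∈ N.volt u v)
    (hh : h ∈ N.volt u w) (hne : g +ᵥ v ≠ h +ᵥ w) :
    ¬ SameRay ℝ (N.vec u v g) (N.vec u w h) := by
  rw [mem_volt] at hg hh
  exact (segment_inter_segment_eq_singleton_iff (N.pos_ne _ _ hg).symm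
    (N.pos_ne _ _ hh).symm).1 (N.star_embedded _ _ _ hg hh hne)

/-- A transversal of the lattice action: it meets every orbit exactly once. -/
def IsTransversal {ι : Type*} (σ : ι → N.Vert) : Prop :=
  Function.Bijective fun i => (Quotient.mk _ (σ i) : N.QuotVert)

theorem quot_mk_eq_iff {u v : N.Vert} :
    (Quotient.mk _ u : N.QuotVert) = Quotient.mk _ v ↔ ∃ g : N.lattice, g +ᵥ v = u := by
  rw [Quotient.eq]
  rfl

@[simp] theorem quot_mk_vadd (g : N.lattice) (v : N.Vert) :
    (Quotient.mk _ (g +ᵥ v) : N.QuotVert) = Quotient.mk _ v :=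
  N.quot_mk_eq_iff.2 ⟨g, rfl⟩

theorem exists_isTransversal {ι : Type*} (e : ι ≃ N.QuotVert) :
    ∃ σ : ι → N.Vert, N.IsTransversal σ := by
  refine ⟨fun i => (e i).out, ?_⟩
  have : (fun i => (Quotient.mk _ (e i).out : N.QuotVert)) = e := by
    ext i; exact Quotient.out_eq _
  unfold IsTransversal
  rw [this]
  exact e.bijective

variable {N} {ι : Type} {σ : ι → N.Vert} 

theorem IsTransversal.exists_vadd (hσ : N.IsTransversal σ) (v : N.Vert) :
    ∃ (g : N.lattice) (i : ι), g +ᵥ σ i = v := by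
  obtain ⟨i, hi⟩ := hσ.2 (Quotient.mk _ v)
  obtain ⟨g, hg⟩ := N.quot_mk_eq_iff.1 hi.symm
  exact ⟨g, i, hg⟩

theorem IsTransversal.vadd_inj (hσ : N.IsTransversal σ) {g h : N.lattice} {i j : ι}
    (e : g +ᵥ σ i = h +ᵥ σ j) : i = j ∧ g = h := by
  have hij : i = j := hσ.1 (by
    have := congrArg (Quotient.mk _ : N.Vert → N.QuotVert) e
    simpa using this)
  subst hij
  exact ⟨rfl, N.vadd_right_injective' e⟩

theorem IsTransversal.card_eq [Fintype ι] (hσ : N.IsTransversal σ) :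
    N.vertexCount = Fintype.card ι := by
  rw [vertexCount, ← Nat.card_eq_fintype_card]
  exact (Nat.card_congr (Equiv.ofBijective _ hσ)).symm

variable (σ) in
/-- The directed edges of the quotient graph, relative to a transversal. -/
abbrev Dart : Type := Σ i : ι, Σ j : ι, N.volt (σ i) (σ j)

/-- The quotient edge underlying a directed edge. -/
def Dart.edge (x : Dart σ) : N.QuotEdge :=
  Quotient.mk N.edgeSetoid ⟨s(σ x.1, x.2.2.1 +ᵥ σ x.2.1), N.mem_volt.1 x.2.2.2⟩

/-- The reversed directed edge. -/
def Dart.rev (x : Dart σ) : Dart σ := ⟨x.2.1, x.1, -x.2.2.1, N.neg_mem_volt.2 x.2.2.2⟩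

theorem Dart.ext_iff' {x y : Dart σ} : x = y ↔ x.1 = y.1 ∧ x.2.1 = y.2.1 ∧ x.2.2.1 = y.2.2.1 := by
  constructor
  · rintro rfl; simp
  · obtain ⟨i, j, g, hg⟩ := x
    obtain ⟨i', j', g', hg'⟩ := y
    rintro ⟨h1, h2, h3⟩
    dsimp only at h1 h2 h3
    subst h1; subst h2; subst h3; rfl

/-- A directed edge equal to its reverse would be a loop with voltage $g=-g$, so $g=0$, and the edge
would have length zero. Hence no edge of `N` is inverted by the lattice, and every quotient edge
carries exactly two darts. -/
theorem Dart.rev_ne (x : Dart σ) : x.rev ≠ x := by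
  intro h
  obtain ⟨i, j, g, hg⟩ := x
  obtain ⟨h1, h2, h3⟩ := Dart.ext_iff'.1 h
  simp only [rev] at h1 h2 h3
  subst h1
  apply N.ne_zero_of_mem_volt_self hg
  have : (-g : EuclideanSpace ℝ (Fin n)) = g := by
    have := congrArg (Subtype.val) h3
    simpa using this
  have h2 : (2 : ℝ) • (g : EuclideanSpace ℝ (Fin n)) = 0 := by
    rw [two_smul]
    nth_rewrite 1 [← this]
    exact neg_add_cancel _
  simpa using h2

theorem IsTransversal.edge_eq_iff (hσ : N.IsTransversal σ) (x y : Dart σ) :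
    y.edge = x.edge ↔ y = x ∨ y = x.rev := by
  obtain ⟨i, j, g, hg⟩ := x
  obtain ⟨i', j', g', hg'⟩ := y
  constructor
  · intro h
    obtain ⟨a, ha⟩ : ∃ a : N.lattice,
      Sym2.map (fun v => a +ᵥ v) s(σ i', g' +ᵥ σ j') = s(σ i, g +ᵥ σ j) := Quotient.exact h
    rw [Sym2.map_mk, Sym2.eq_iff] at ha
    simp only [vadd_vadd] at ha
    rw [Dart.ext_iff', Dart.ext_iff']
    simp only [Dart.rev]
    rcases ha with ⟨h1, h2⟩ | ⟨h1, h2⟩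
    · left
      obtain ⟨h3, h4⟩ := hσ.vadd_inj (h1.trans (zero_vadd N.lattice _).symm)
      obtain ⟨h5, h6⟩ := hσ.vadd_inj h2
      rw [h4, zero_add] at h6
      exact ⟨h3, h5, h6⟩
    · right
      obtain ⟨h3, h4⟩ := hσ.vadd_inj h1
      obtain ⟨h5, h6⟩ := hσ.vadd_inj (h2.trans (zero_vadd N.lattice _).symm)
      refine ⟨h3, h5, ?_⟩
      rw [← h4]
      exact eq_neg_of_add_eq_zero_right h6
  · rintro (h | h)
    · rw [h]
    · rw [h]
      refine Quotient.sound ⟨g, ?_⟩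
      simp [Dart.rev, vadd_vadd, Sym2.eq_swap]

theorem IsTransversal.edge_surjective (hσ : N.IsTransversal σ) :
    Function.Surjective (Dart.edge : Dart σ → N.QuotEdge) := by
  intro e
  induction e using Quotient.inductionOn with
  | _ e =>
    obtain ⟨e, he⟩ := e
    induction e using Sym2.ind with
    | _ u v =>
      obtain ⟨g, i, rfl⟩ := hσ.exists_vadd u
      obtain ⟨h, j, rfl⟩ := hσ.exists_vadd v
      have he' : N.graph.Adj (g +ᵥ σ i) (h +ᵥ σ j) := he
      refine ⟨⟨i, j, h - g, N.mem_volt.2 ((N.adj_vadd_vadd_iff _ _ _ _).1 he')⟩,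
        Quotient.sound ⟨g, ?_⟩⟩
      simp [vadd_vadd]

theorem Dart.ends_edge (x : Dart σ) :
    N.ends x.edge = s((Quotient.mk _ (σ x.1) : N.QuotVert), Quotient.mk _ (σ x.2.1)) := by
  change Sym2.map _ s(_, _) = _
  rw [Sym2.map_mk]
  exact congrArg (fun z => s(Quotient.mk _ (σ x.1), z)) (N.quot_mk_vadd _ _)

theorem Dart.edgeLength_edge (x : Dart σ) :
    N.edgeLength x.edge = ‖N.vec (σ x.1) (σ x.2.1) x.2.2.1‖ := by
  change dist (N.pos _) (N.pos _) = _
  rw [dist_comm, dist_eq_norm, vec]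

noncomputable instance : Fintype N.QuotEdge := Fintype.ofFinite _

/-- The fibre of the map from darts to edges is a dart and its reverse. This single double count
yields the length formula, the handshake identity and the parity of loop voltages. -/
theorem IsTransversal.sum_dart [Fintype ι] (hσ : N.IsTransversal σ) {R : Type*} [Semiring R]
    (f : N.QuotEdge → R) : ∑ x : Dart σ, f x.edge = 2 * ∑ e, f e := by
  classical
  rw [← Finset.sum_fiberwise (s := Finset.univ) (g := (Dart.edge : Dart σ → N.QuotEdge)),
    Finset.mul_sum]
  refine Finset.sum_congr rfl fun e _ => ?_
  obtain ⟨x, rfl⟩ := hσ.edge_surjective e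
  have : Finset.univ.filter (fun y : Dart σ => y.edge = x.edge) = {x, x.rev} := by
    ext y
    simp [hσ.edge_eq_iff]
  rw [this, Finset.sum_pair x.rev_ne.symm, (hσ.edge_eq_iff x x.rev).2 (Or.inr rfl), two_mul]

theorem IsTransversal.two_mul_length [Fintype ι] (hσ : N.IsTransversal σ) :
    2 * N.length = ∑ i, ∑ j, ∑ g ∈ N.volt (σ i) (σ j), ‖N.vec (σ i) (σ j) g‖ := by
  rw [length, finsum_eq_sum_of_fintype, ← hσ.sum_dart]
  simp only [Dart.edgeLength_edge]
  rw [Fintype.sum_sigma]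
  refine Finset.sum_congr rfl fun i _ => ?_
  rw [Fintype.sum_sigma]
  refine Finset.sum_congr rfl fun j _ => ?_
  exact Finset.sum_coe_sort (N.volt (σ i) (σ j)) (fun g => ‖N.vec (σ i) (σ j) g‖)

theorem IsTransversal.sum_card_volt [Fintype ι] (hσ : N.IsTransversal σ) (u : N.Vert) :
    ∑ j, (N.volt u (σ j)).card = d := by
  have h := N.degree_eq u
  have hbij : Function.Bijective (fun x : (Σ j : ι, N.volt u (σ j)) =>
      (⟨x.2.1 +ᵥ σ x.1, N.mem_volt.1 x.2.2⟩ : N.graph.neighborSet u)) := by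
    constructor
    · rintro ⟨j, g, hg⟩ ⟨j', g', hg'⟩ e
      obtain ⟨h1, h2⟩ := hσ.vadd_inj (congrArg Subtype.val e)
      dsimp only at h1 h2
      subst h1; subst h2; rfl
    · rintro ⟨v, hv⟩
      obtain ⟨g, j, rfl⟩ := hσ.exists_vadd v
      exact ⟨⟨j, g, N.mem_volt.2 hv⟩, rfl⟩
  have h2 := Nat.card_congr (Equiv.ofBijective _ hbij)
  rw [Nat.card_eq_fintype_card, Fintype.card_sigma] at h2
  have h3 : Nat.card (N.graph.neighborSet u) = d := by
    rw [Nat.card_coe_set_eq, Set.ncard, h]; rfl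
  rw [h3] at h2
  simpa only [Fintype.card_coe] using h2

theorem IsTransversal.two_mul_card_quotEdge [Fintype ι] (hσ : N.IsTransversal σ) :
    2 * Fintype.card N.QuotEdge = Fintype.card ι * d := by
  have h := hσ.sum_dart (fun _ => (1 : ℕ))
  simp only [Finset.sum_const, smul_eq_mul, mul_one, Finset.card_univ, Fintype.card_sigma,
    Fintype.card_coe] at h
  simp only [hσ.sum_card_volt, Finset.sum_const, smul_eq_mul, Finset.card_univ] at h
  exact h.symm

open scoped Classical in
theorem IsTransversal.two_mul_card_ends_eq [Fintype ι] (hσ : N.IsTransversal σ) (z : Sym2 ι) :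
    2 * Fintype.card {e : N.QuotEdge // N.ends e = z.map fun i => Quotient.mk _ (σ i)} =
      ∑ i, ∑ j, if s(i, j) = z then (N.volt (σ i) (σ j)).card else 0 := by
  rw [Fintype.card_subtype, Finset.card_filter, ← hσ.sum_dart, Fintype.sum_sigma]
  refine Finset.sum_congr rfl fun i _ => ?_
  rw [Fintype.sum_sigma]
  refine Finset.sum_congr rfl fun j _ => ?_
  have : ∀ g : N.volt (σ i) (σ j), (N.ends (Dart.edge (⟨i, j, g⟩ : Dart σ)) =
      z.map fun i => Quotient.mk _ (σ i)) ↔ s(i, j) = z := by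
    intro g
    rw [Dart.ends_edge]
    have hinj := Sym2.map.injective hσ.1
    exact ⟨fun h => hinj h, fun h => by rw [← h]; rfl⟩
  simp only [this]
  split_ifs <;> simp

theorem IsTransversal.even_card_volt_self [Fintype ι] (hσ : N.IsTransversal σ) (i : ι) :
    Even (N.volt (σ i) (σ i)).card := by
  classical
  have h := hσ.two_mul_card_ends_eq s(i, i)
  have h2 : ∀ a b : ι, s(a, b) = s(i, i) ↔ a = i ∧ b = i := by
    intro a b; rw [Sym2.eq_iff]; tauto
  rw [even_iff_two_dvd]
  refine ⟨_, Eq.trans ?_ h.symm⟩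
  simp only [h2, ite_and]
  simp

/-- Networks with the same numbers of directed quotient edges have isomorphic quotients. -/
theorem sameQuotient_of_card_volt_eq [Fintype ι] {d' : ℕ} {M : PeriodicNetwork n d'}
    {τ : ι → M.Vert} (hσ : N.IsTransversal σ) (hτ : M.IsTransversal τ)
    (h : ∀ i j, (N.volt (σ i) (σ j)).card = (M.volt (τ i) (τ j)).card) : N.SameQuotient M := by
  classical
  let eσ := Equiv.ofBijective _ hσ
  let eτ := Equiv.ofBijective _ hτ
  let φ : N.QuotVert ≃ M.QuotVert := eσ.symm.trans eτ
  -- Over each unordered pair of end points the two graphs have equally many edges; the edge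
  -- bijection is glued from arbitrary bijections of these fibres.
  have hc : ∀ z : Sym2 N.QuotVert, Nonempty ({e : N.QuotEdge // Sym2.map φ (N.ends e) = z.map φ} ≃
      {e : M.QuotEdge // M.ends e = z.map φ}) := by
    intro z
    refine ⟨Fintype.equivOfCardEq ?_⟩
    have h1 := hσ.two_mul_card_ends_eq (z.map eσ.symm)
    have h2 := hτ.two_mul_card_ends_eq (z.map eσ.symm)
    simp only [h] at h1
    rw [← h2, Sym2.map_map, Sym2.map_map] at h1
    have h3 : z.map ((fun i => (Quotient.mk _ (σ i) : N.QuotVert)) ∘ eσ.symm) = z := by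
      have : ((fun i => (Quotient.mk _ (σ i) : N.QuotVert)) ∘ eσ.symm) = id := by
        ext i; exact eσ.apply_symm_apply i
      rw [this, Sym2.map_id, id]
    rw [h3] at h1
    have h4 : ∀ e, Sym2.map φ (N.ends e) = z.map φ ↔ N.ends e = z := fun e =>
      (Sym2.map.injective φ.injective).eq_iff
    simp only [h4]
    exact Nat.eq_of_mul_eq_mul_left two_pos h1
  have hc' : ∀ w : Sym2 M.QuotVert, {e : N.QuotEdge // Sym2.map φ (N.ends e) = w} ≃
      {e : M.QuotEdge // M.ends e = w} := by
    intro w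
    have := hc (w.map φ.symm)
    rw [Sym2.map_map] at this
    rw [Equiv.self_comp_symm, Sym2.map_id, id] at this
    exact Classical.choice this
  exact ⟨φ, Equiv.ofFiberEquiv hc', fun e => Equiv.ofFiberEquiv_map hc' e⟩

/-- The voltages, corrected by an arbitrary potential, generate the lattice. -/
theorem IsTransversal.lattice_le (hσ : N.IsTransversal σ)
    (K : AddSubgroup (EuclideanSpace ℝ (Fin n))) (c : ι → EuclideanSpace ℝ (Fin n))
    (h : ∀ i j, ∀ g ∈ N.volt (σ i) (σ j), (g : EuclideanSpace ℝ (Fin n)) + c j - c i ∈ K)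
    (g : N.lattice) : (g : EuclideanSpace ℝ (Fin n)) ∈ K := by
  obtain ⟨v₀⟩ := N.connected.nonempty
  obtain ⟨-, i₀, -⟩ := hσ.exists_vadd v₀
  -- Along a path the potential differences telescope, so the corrected total voltage stays in `K`.
  -- On a path from `σ i₀` to its translate by `g` the potential cancels, leaving `g`.
  have key : ∀ v, N.graph.Reachable (σ i₀) v → ∀ (a : N.lattice) (j : ι), a +ᵥ σ j = v →
      (a : EuclideanSpace ℝ (Fin n)) + c j - c i₀ ∈ K := by
    intro v hv
    rw [SimpleGraph.reachable_iff_reflTransGen] at hv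
    induction hv with
    | refl =>
      intro a j ha
      obtain ⟨h1, h2⟩ := hσ.vadd_inj (ha.trans (zero_vadd N.lattice _).symm)
      subst h1; subst h2
      simp
    | @tail u w _ huw ih =>
      intro a j ha
      obtain ⟨b, i, rfl⟩ := hσ.exists_vadd u
      have h1 := ih b i rfl
      subst ha
      have h2 := h i j (a - b) (N.mem_volt.2 ((N.adj_vadd_vadd_iff _ _ _ _).1 huw))
      have := K.add_mem h1 h2
      convert this using 1
      push_cast
      abel
  have := key (g +ᵥ σ i₀) (N.connected.preconnected _ _) g i₀ rfl
  simpa using this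

theorem exists_lattice_apply_ne_zero {f : EuclideanSpace ℝ (Fin n) →ₗ[ℝ] ℝ} (hf : f ≠ 0) :
    ∃ g : N.lattice, f g ≠ 0 := by
  by_contra! h
  apply hf
  have hspan := N.isZLattice.span_top
  refine LinearMap.ext_on hspan ?_
  intro x hx
  exact h ⟨x, hx⟩

end PeriodicNetwork

/-! ### Finding independent voltages. -/

/-- The determinant as a linear functional of its last argument. -/
def det₃Lin (x y : Space) : Space →ₗ[ℝ] ℝ where
  toFun := det₃ x y
  map_add' := det₃_add_right x y
  map_smul' c z := by simp [det₃]; ring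

namespace PeriodicNetwork

variable {d : ℕ} {N : PeriodicNetwork 3 d} {ι : Type} {σ : ι → N.Vert}

/-- Otherwise all corrected voltages, and with them the lattice they generate, would lie in the
plane spanned by `x` and `y`, contradicting full rank. -/
theorem IsTransversal.exists_det₃_ne_zero (hσ : N.IsTransversal σ) (c : ι → Space) {x y : Space}
    (h : ∃ z, det₃ x y z ≠ 0) :
    ∃ i j, ∃ g ∈ N.volt (σ i) (σ j), det₃ x y ((g : Space) + c j - c i) ≠ 0 := by
  by_contra! hc
  obtain ⟨z, hz⟩ := h
  obtain ⟨g, hg⟩ := N.exists_lattice_apply_ne_zero (f := det₃Lin x y)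
    (fun h0 => hz (LinearMap.congr_fun h0 z))
  exact hg (hσ.lattice_le (LinearMap.ker (det₃Lin x y)).toAddSubgroup c hc g)

theorem IsTransversal.exists_exists_det₃_ne_zero (hσ : N.IsTransversal σ) (c : ι → Space)
    {x : Space} (hx : x ≠ 0) :
    ∃ i j, ∃ g ∈ N.volt (σ i) (σ j), ∃ z, det₃ x ((g : Space) + c j - c i) z ≠ 0 := by
  by_contra! hc
  obtain ⟨y, z, hz⟩ := exists_det₃_ne_zero_of_ne_zero hx
  obtain ⟨i, j, g, hg, hne⟩ := hσ.exists_det₃_ne_zero c ⟨z, hz⟩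
  apply hne
  rw [det₃_swap, hc i j g hg y, neg_zero]

end PeriodicNetwork

/-! ### Removing pairs of opposite voltages from the loops at a vertex. -/

theorem ne_neg_of_coe_ne_zero {Λ : Submodule ℤ Space} {g : Λ} (h : (g : Space) ≠ 0) : g ≠ -g := by
  intro e
  apply h
  have : (g : Space) = -g := by simpa using congrArg Subtype.val e
  have h2 : (2 : ℝ) • (g : Space) = 0 := by
    rw [two_smul]
    nth_rewrite 2 [this]
    exact add_neg_cancel _
  simpa using h2

section Symmetric

variable {Λ : Submodule ℤ Space} [DecidableEq Λ] {S : Finset Λ}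

theorem neg_mem_sdiff_pair (hS : ∀ g ∈ S, -g ∈ S) (a : Λ) :
    ∀ g ∈ S \ {a, -a}, -g ∈ S \ {a, -a} := by
  intro g hg
  simp only [Finset.mem_sdiff, Finset.mem_insert, Finset.mem_singleton, not_or] at hg ⊢
  exact ⟨hS g hg.1, fun h => hg.2.2 (by rw [← h, neg_neg]), fun h => hg.2.1 (neg_injective h)⟩

theorem card_sdiff_pair (hS : ∀ g ∈ S, -g ∈ S) {a : Λ} (ha : a ∈ S) (h0 : (a : Space) ≠ 0) :
    (S \ {a, -a}).card + 2 = S.card := by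
  rw [← Finset.card_pair (ne_neg_of_coe_ne_zero h0)]
  apply Finset.card_sdiff_add_card_eq_card
  intro g hg
  simp only [Finset.mem_insert, Finset.mem_singleton] at hg
  rcases hg with rfl | rfl
  · exact ha
  · exact hS _ ha

theorem sum_norm_sdiff_pair (hS : ∀ g ∈ S, -g ∈ S) {a : Λ} (ha : a ∈ S) (h0 : (a : Space) ≠ 0) :
    ∑ g ∈ S, ‖(g : Space)‖ = 2 * ‖(a : Space)‖ + ∑ g ∈ S \ {a, -a}, ‖(g : Space)‖ := by
  rw [← Finset.sum_sdiff (s₁ := {a, -a}) (s₂ := S), Finset.sum_pair (ne_neg_of_coe_ne_zero h0)]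
  · simp only [Submodule.coe_neg, norm_neg]
    ring
  · intro g hg
    simp only [Finset.mem_insert, Finset.mem_singleton] at hg
    rcases hg with rfl | rfl
    · exact ha
    · exact hS _ ha

theorem eq_or_eq_neg_of_card_le_two (hS : ∀ g ∈ S, -g ∈ S) {a : Λ} (ha : a ∈ S)
    (h0 : (a : Space) ≠ 0) (hc : S.card ≤ 2) {g : Λ} (hg : g ∈ S) : g = a ∨ g = -a := by
  have h := card_sdiff_pair hS ha h0
  have h1 : S \ {a, -a} = ∅ := Finset.card_eq_zero.1 (by omega)
  by_contra! h2
  have : g ∈ S \ {a, -a} := by simp [hg, h2.1, h2.2]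
  simp [h1] at this

end Symmetric

/-! ### The lower bound for one vertex. -/

namespace PeriodicNetwork

variable {d : ℕ} {N : PeriodicNetwork 3 d}

theorem neg_mem_volt_self {u : N.Vert} : ∀ g ∈ N.volt u u, -g ∈ N.volt u u :=
  fun _ hg => N.neg_mem_volt.2 hg

/-- A loop leaves its vertex in two opposite directions, so the embedded star forbids a different
loop from being parallel to it with either orientation. -/
theorem exists_det₃_ne_zero_of_loops {u : N.Vert} {a b : N.lattice} (ha : a ∈ N.volt u u)
    (hb : b ∈ N.volt u u) (h1 : b ≠ a) (h2 : b ≠ -a) : ∃ z, det₃ (a : Space) b z ≠ 0 := by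
  apply exists_det₃_ne_zero_of_not_sameRay
  · have := N.not_sameRay_vec ha hb fun h => h1 (N.vadd_right_injective' h).symm
    simpa only [vec_self] using this
  · have := N.not_sameRay_vec ha (neg_mem_volt_self b hb)
      fun h => h2 (by rw [N.vadd_right_injective' h, neg_neg])
    simpa only [vec_self, Submodule.coe_neg] using this

theorem spannedVolume_pos : 0 < N.spannedVolume := ZLattice.covolume_pos _ _

/-- Eight loop voltages are four pairs of opposite vectors. Two of them are automatically
independent, a third completes the rank because the loops generate the lattice, and any further one
is the fourth vector of `covolume_le_of_four`. -/
theorem le_length_cube_of_one_vertex {σ : Fin 1 → N.Vert} (hσ : N.IsTransversal σ) (hd : 8 ≤ d) :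
    54 * N.spannedVolume ≤ N.length ^ 3 := by
  classical
  obtain ⟨u, hu⟩ : ∃ u, u = σ 0 := ⟨_, rfl⟩
  have hcard : (N.volt u u).card = d := by simpa [hu] using hσ.sum_card_volt (σ 0)
  have hL := hσ.two_mul_length
  simp only [Fin.sum_univ_one, ← hu, vec_self] at hL
  have hS := neg_mem_volt_self (N := N) (u := u)
  have h0 := fun g (hg : g ∈ N.volt u u) => N.ne_zero_of_mem_volt_self hg
  obtain ⟨a, ha⟩ : (N.volt u u).Nonempty := Finset.card_pos.1 (by omega)
  have ca := card_sdiff_pair hS ha (h0 a ha)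
  have sa := sum_norm_sdiff_pair hS ha (h0 a ha)
  have hS' := neg_mem_sdiff_pair hS a
  obtain ⟨b, hb⟩ : (N.volt u u \ {a, -a}).Nonempty := Finset.card_pos.1 (by omega)
  have hbm := Finset.mem_sdiff.1 hb
  have cb := card_sdiff_pair hS' hb (h0 b hbm.1)
  have sb := sum_norm_sdiff_pair hS' hb (h0 b hbm.1)
  have hS'' := neg_mem_sdiff_pair hS' b
  have hb2 : b ≠ a ∧ b ≠ -a := by simpa using hbm.2
  obtain ⟨i, j, c, hc, hdet⟩ := hσ.exists_det₃_ne_zero (fun _ => 0)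
    (exists_det₃_ne_zero_of_loops ha hbm.1 hb2.1 hb2.2)
  rw [Subsingleton.elim i 0, Subsingleton.elim j 0, ← hu] at hc
  simp only [add_zero, sub_zero] at hdet
  have hc'' : c ∈ (N.volt u u \ {a, -a}) \ {b, -b} := by
    simp only [Finset.mem_sdiff, Finset.mem_insert, Finset.mem_singleton, not_or]
    refine ⟨⟨hc, ?_, ?_⟩, ?_, ?_⟩ <;> rintro rfl <;>
      simp [det₃_neg_right, det₃_self_left, det₃_self_right] at hdet
  have cc := card_sdiff_pair hS'' hc'' (h0 c hc)
  have sc := sum_norm_sdiff_pair hS'' hc'' (h0 c hc)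
  have hS''' := neg_mem_sdiff_pair hS'' c
  obtain ⟨e, he⟩ : (((N.volt u u \ {a, -a}) \ {b, -b}) \ {c, -c}).Nonempty :=
    Finset.card_pos.1 (by omega)
  have hem : e ∈ N.volt u u := by simp only [Finset.mem_sdiff] at he; exact he.1.1.1
  have se := sum_norm_sdiff_pair hS''' he (h0 e hem)
  refine covolume_le_of_four N.lattice a.2 b.2 c.2 e.2 hdet (h0 e hem) ?_
  have : 0 ≤ ∑ g ∈ (((N.volt u u \ {a, -a}) \ {b, -b}) \ {c, -c}) \ {e, -e}, ‖(g : Space)‖ :=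
    Finset.sum_nonneg fun _ _ => norm_nonneg _
  linarith

/-! ### The lower bound for two vertices. -/

section TwoVertices

variable {σ : Fin 2 → N.Vert}

theorem IsTransversal.length_of_two_vertices (hσ : N.IsTransversal σ) :
    2 * N.length = ∑ g ∈ N.volt (σ 0) (σ 0), ‖(g : Space)‖ + ∑ g ∈ N.volt (σ 1) (σ 1), ‖(g : Space)‖
      + 2 * ∑ g ∈ N.volt (σ 0) (σ 1), ‖N.vec (σ 0) (σ 1) g‖ := by
  have h : ∑ g ∈ N.volt (σ 1) (σ 0), ‖N.vec (σ 1) (σ 0) g‖ =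
      ∑ g ∈ N.volt (σ 0) (σ 1), ‖N.vec (σ 0) (σ 1) g‖ := by
    refine Finset.sum_bij (fun g _ => -g) (fun g hg => N.neg_mem_volt.2 hg)
      (fun _ _ _ _ h => neg_injective h)
      (fun g hg => ⟨-g, N.neg_mem_volt.2 hg, neg_neg g⟩)
      (fun g _ => (N.norm_vec_neg _ _ g).symm)
  rw [hσ.two_mul_length]
  simp only [Fin.sum_univ_two, vec_self, h]
  ring

/-- The potential $(0,-p_0)$ gives voltage zero to the connecting edge `p₀`, so the other connecting
edges contribute differences $g-p_0$. Reversing an edge changes the sign, which `hneg` absorbs. -/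
theorem two_vertices_cases (p₀ : N.lattice)
    {Q : Space → Prop} (hneg : ∀ x, Q (-x) → Q x)
    (h : ∀ c : Fin 2 → Space, ∃ i j, ∃ g ∈ N.volt (σ i) (σ j), Q ((g : Space) + c j - c i)) :
    (∃ g ∈ N.volt (σ 0) (σ 0), Q g) ∨ (∃ g ∈ N.volt (σ 1) (σ 1), Q g) ∨
      ∃ g ∈ N.volt (σ 0) (σ 1), Q ((g : Space) - p₀) := by
  obtain ⟨i, j, g, hg, hQ⟩ := h ![0, -(p₀ : Space)]
  fin_cases i <;> fin_cases j
  · left; exact ⟨g, hg, by simpa using hQ⟩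
  · right; right; exact ⟨g, hg, by simpa [sub_eq_add_neg] using hQ⟩
  · right; right
    refine ⟨-g, N.neg_mem_volt.2 hg, hneg _ ?_⟩
    simpa [add_comm] using hQ
  · right; left; exact ⟨g, hg, by simpa using hQ⟩

theorem IsTransversal.exists_third (hσ : N.IsTransversal σ) (p₀ : N.lattice) {x y : Space}
    (h : ∃ z, det₃ x y z ≠ 0) :
    (∃ g ∈ N.volt (σ 0) (σ 0), det₃ x y g ≠ 0) ∨ (∃ g ∈ N.volt (σ 1) (σ 1), det₃ x y g ≠ 0) ∨
      ∃ g ∈ N.volt (σ 0) (σ 1), det₃ x y ((g : Space) - p₀) ≠ 0 := by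
  refine two_vertices_cases p₀ (Q := fun w => det₃ x y w ≠ 0) ?_
    (fun c => hσ.exists_det₃_ne_zero c h)
  intro w hw h0
  exact hw (by rw [det₃_neg_right, h0, neg_zero])

theorem IsTransversal.exists_second (hσ : N.IsTransversal σ) (p₀ : N.lattice) {x : Space}
    (h : x ≠ 0) :
    (∃ g ∈ N.volt (σ 0) (σ 0), ∃ z, det₃ x g z ≠ 0) ∨
      (∃ g ∈ N.volt (σ 1) (σ 1), ∃ z, det₃ x g z ≠ 0) ∨
      ∃ g ∈ N.volt (σ 0) (σ 1), ∃ z, det₃ x ((g : Space) - p₀) z ≠ 0 := by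
  refine two_vertices_cases p₀ (Q := fun w => ∃ z, det₃ x w z ≠ 0) ?_
    (fun c => hσ.exists_exists_det₃_ne_zero c h)
  rintro w ⟨z, hw⟩
  exact ⟨z, fun h0 => hw (by rw [det₃_swap, det₃_neg_right, det₃_swap, h0, neg_zero, neg_zero, neg_zero])⟩

/-- Two parallel quotient edges close up to a cycle whose translation is the difference of their
voltages; it costs no more than the two edges together. -/
theorem norm_sub_le_vec (u v : N.Vert) (g h : N.lattice) :
    ‖(g : Space) - h‖ ≤ ‖N.vec u v g‖ + ‖N.vec u v h‖ := by
  have : (g : Space) - h = N.vec u v g - N.vec u v h := by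
    rw [vec_eq, vec_eq]; abel
  rw [this]
  exact norm_sub_le _ _

theorem coe_sub_ne_zero {g h : N.lattice} (hne : g ≠ h) : (g : Space) - h ≠ 0 :=
  fun e => hne (Subtype.ext (sub_eq_zero.1 e))

theorem add_le_sum_of_pair {f : N.lattice → ℝ} (hf : ∀ g, 0 ≤ f g) {P : Finset N.lattice}
    {p q : N.lattice} (hp : p ∈ P) (hq : q ∈ P) (hpq : p ≠ q) : f p + f q ≤ ∑ g ∈ P, f g := by
  classical
  rw [← Finset.sum_pair hpq]
  exact Finset.sum_le_sum_of_subset_of_nonneg (by simp [Finset.insert_subset_iff, hp, hq])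
    (fun g _ _ => hf g)

theorem add_le_sum_of_four {f : N.lattice → ℝ} (hf : ∀ g, 0 ≤ f g) {P : Finset N.lattice}
    {p q r s : N.lattice} (hp : p ∈ P) (hq : q ∈ P) (hr : r ∈ P) (hs : s ∈ P) (hpq : p ≠ q)
    (hpr : p ≠ r) (hps : p ≠ s) (hqr : q ≠ r) (hqs : q ≠ s) (hrs : r ≠ s) :
    f p + f q + f r + f s ≤ ∑ g ∈ P, f g := by
  classical
  have : ∑ g ∈ ({p, q, r, s} : Finset N.lattice), f g = f p + f q + f r + f s := by
    rw [Finset.sum_insert, Finset.sum_insert, Finset.sum_pair hrs]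
    · ring
    · simp [hqr, hqs]
    · simp [hpq, hpr, hps]
  rw [← this]
  exact Finset.sum_le_sum_of_subset_of_nonneg (by simp [Finset.insert_subset_iff, hp, hq, hr, hs])
    (fun g _ _ => hf g)

/-- Since voltages of loops come in pairs, there are two loops at each vertex. Those at `σ 0` are
independent; a third direction comes from a loop at either vertex or from a pair of connecting
edges. In every case a loop at `σ 1` remains as the fourth vector. -/
theorem IsTransversal.le_length_cube_of_many_loops (hσ : N.IsTransversal σ)
    (h₀ : 3 ≤ (N.volt (σ 0) (σ 0)).card) (h₁ : 3 ≤ (N.volt (σ 1) (σ 1)).card) :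
    54 * N.spannedVolume ≤ N.length ^ 3 := by
  classical
  have hL := hσ.length_of_two_vertices
  have hS := neg_mem_volt_self (N := N) (u := σ 0)
  have hT := neg_mem_volt_self (N := N) (u := σ 1)
  have z0 := fun g (hg : g ∈ N.volt (σ 0) (σ 0)) => N.ne_zero_of_mem_volt_self hg
  have z1 := fun g (hg : g ∈ N.volt (σ 1) (σ 1)) => N.ne_zero_of_mem_volt_self hg
  obtain ⟨a, ha⟩ : (N.volt (σ 0) (σ 0)).Nonempty := Finset.card_pos.1 (by omega)
  have ca := card_sdiff_pair hS ha (z0 a ha)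
  have sa := sum_norm_sdiff_pair hS ha (z0 a ha)
  have hS' := neg_mem_sdiff_pair hS a
  obtain ⟨b, hb⟩ : (N.volt (σ 0) (σ 0) \ {a, -a}).Nonempty := Finset.card_pos.1 (by omega)
  have hbm := Finset.mem_sdiff.1 hb
  have sb := sum_norm_sdiff_pair hS' hb (z0 b hbm.1)
  have hS'' := neg_mem_sdiff_pair hS' b
  have hb2 : b ≠ a ∧ b ≠ -a := by simpa using hbm.2
  obtain ⟨p₀, hp₀⟩ : ∃ p₀, (N.volt (σ 0) (σ 1)).Nonempty → p₀ ∈ N.volt (σ 0) (σ 1) := by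
    by_cases h : (N.volt (σ 0) (σ 1)).Nonempty
    · exact ⟨h.choose, fun _ => h.choose_spec⟩
    · exact ⟨0, fun h' => absurd h' h⟩
  have nn : ∀ S : Finset N.lattice, 0 ≤ ∑ g ∈ S, ‖(g : Space)‖ :=
    fun S => Finset.sum_nonneg fun _ _ => norm_nonneg _
  have nv : 0 ≤ ∑ g ∈ N.volt (σ 0) (σ 1), ‖N.vec (σ 0) (σ 1) g‖ :=
    Finset.sum_nonneg fun _ _ => norm_nonneg _
  rcases hσ.exists_third p₀ (exists_det₃_ne_zero_of_loops ha hbm.1 hb2.1 hb2.2) with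
    ⟨c, hc, hdet⟩ | ⟨c, hc, hdet⟩ | ⟨p, hp, hdet⟩
  · have hc'' : c ∈ (N.volt (σ 0) (σ 0) \ {a, -a}) \ {b, -b} := by
      simp only [Finset.mem_sdiff, Finset.mem_insert, Finset.mem_singleton, not_or]
      refine ⟨⟨hc, ?_, ?_⟩, ?_, ?_⟩ <;> rintro rfl <;>
        simp [det₃_neg_right, det₃_self_left, det₃_self_right] at hdet
    have sc := sum_norm_sdiff_pair hS'' hc'' (z0 c hc)
    obtain ⟨e, he⟩ : (N.volt (σ 1) (σ 1)).Nonempty := Finset.card_pos.1 (by omega)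
    have se := sum_norm_sdiff_pair hT he (z1 e he)
    refine covolume_le_of_four N.lattice a.2 b.2 c.2 e.2 hdet (z1 e he) ?_
    linarith [nn (((N.volt (σ 0) (σ 0) \ {a, -a}) \ {b, -b}) \ {c, -c}),
      nn (N.volt (σ 1) (σ 1) \ {e, -e})]
  · have cc := card_sdiff_pair hT hc (z1 c hc)
    have sc := sum_norm_sdiff_pair hT hc (z1 c hc)
    obtain ⟨e, he⟩ : (N.volt (σ 1) (σ 1) \ {c, -c}).Nonempty := Finset.card_pos.1 (by omega)
    have hem := Finset.mem_sdiff.1 he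
    have se := sum_norm_sdiff_pair (neg_mem_sdiff_pair hT c) he (z1 e hem.1)
    refine covolume_le_of_four N.lattice a.2 b.2 c.2 e.2 hdet (z1 e hem.1) ?_
    linarith [nn ((N.volt (σ 0) (σ 0) \ {a, -a}) \ {b, -b}),
      nn ((N.volt (σ 1) (σ 1) \ {c, -c}) \ {e, -e})]
  · obtain ⟨e, he⟩ : (N.volt (σ 1) (σ 1)).Nonempty := Finset.card_pos.1 (by omega)
    have se := sum_norm_sdiff_pair hT he (z1 e he)
    have hpp : p ≠ p₀ := by rintro rfl; simp [det₃_zero_right] at hdet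
    have hadd := add_le_sum_of_pair (f := fun g => ‖N.vec (σ 0) (σ 1) g‖)
      (fun _ => norm_nonneg _) hp (hp₀ ⟨p, hp⟩) hpp
    have hn := N.norm_sub_le_vec (σ 0) (σ 1) p p₀
    refine covolume_le_of_four N.lattice a.2 b.2 (sub_mem p.2 p₀.2) e.2 hdet (z1 e he) ?_
    linarith [nn ((N.volt (σ 0) (σ 0) \ {a, -a}) \ {b, -b}), nn (N.volt (σ 1) (σ 1) \ {e, -e})]

/-- The four vectors are the two loops `a`, `c` and two differences formed by pairing four
connecting edges. If `a` and `c` are independent, one difference can be chosen to complete the rank.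
If they are parallel, the two differences must be independent modulo `a`, and `c` is the fourth
vector. -/
theorem IsTransversal.le_length_cube_of_one_loop (hσ : N.IsTransversal σ)
    (h₀ : 1 ≤ (N.volt (σ 0) (σ 0)).card) (h₁ : 1 ≤ (N.volt (σ 1) (σ 1)).card)
    (h₀' : (N.volt (σ 0) (σ 0)).card ≤ 2) (h₁' : (N.volt (σ 1) (σ 1)).card ≤ 2)
    (hP : 4 ≤ (N.volt (σ 0) (σ 1)).card) : 54 * N.spannedVolume ≤ N.length ^ 3 := by
  classical
  have hL := hσ.length_of_two_vertices
  have hS := neg_mem_volt_self (N := N) (u := σ 0)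
  have hT := neg_mem_volt_self (N := N) (u := σ 1)
  obtain ⟨a, ha⟩ : (N.volt (σ 0) (σ 0)).Nonempty := Finset.card_pos.1 (by omega)
  obtain ⟨c, hc⟩ : (N.volt (σ 1) (σ 1)).Nonempty := Finset.card_pos.1 (by omega)
  have za := N.ne_zero_of_mem_volt_self ha
  have zc := N.ne_zero_of_mem_volt_self hc
  have ma := fun g => eq_or_eq_neg_of_card_le_two hS ha za h₀' (g := g)
  have mc := fun g => eq_or_eq_neg_of_card_le_two hT hc zc h₁' (g := g)
  have sa := sum_norm_sdiff_pair hS ha za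
  have sc := sum_norm_sdiff_pair hT hc zc
  have nn : ∀ S : Finset N.lattice, 0 ≤ ∑ g ∈ S, ‖(g : Space)‖ :=
    fun S => Finset.sum_nonneg fun _ _ => norm_nonneg _
  have hlen : ∀ p q r s : N.lattice, p ∈ N.volt (σ 0) (σ 1) → q ∈ N.volt (σ 0) (σ 1) →
      r ∈ N.volt (σ 0) (σ 1) → s ∈ N.volt (σ 0) (σ 1) → p ≠ q → p ≠ r → p ≠ s → q ≠ r → q ≠ s →
      r ≠ s → ‖(a : Space)‖ + ‖(c : Space)‖ + ‖(p : Space) - q‖ + ‖(r : Space) - s‖ ≤ N.length := by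
    intro p q r s hp hq hr hs hpq hpr hps hqr hqs hrs
    have hadd := add_le_sum_of_four (f := fun g => ‖N.vec (σ 0) (σ 1) g‖)
      (fun _ => norm_nonneg _) hp hq hr hs hpq hpr hps hqr hqs hrs
    linarith [N.norm_sub_le_vec (σ 0) (σ 1) p q, N.norm_sub_le_vec (σ 0) (σ 1) r s,
      nn (N.volt (σ 0) (σ 0) \ {a, -a}), nn (N.volt (σ 1) (σ 1) \ {c, -c})]
  obtain ⟨p₁, hp₁⟩ : (N.volt (σ 0) (σ 1)).Nonempty := Finset.card_pos.1 (by omega)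
  by_cases hind : ∃ z, det₃ (a : Space) c z ≠ 0
  · rcases hσ.exists_third p₁ hind with ⟨g, hg, hdet⟩ | ⟨g, hg, hdet⟩ | ⟨p, hp, hdet⟩
    · rcases ma g hg with rfl | rfl <;> simp [det₃_neg_right, det₃_self_left] at hdet
    · rcases mc g hg with rfl | rfl <;> simp [det₃_neg_right, det₃_self_right] at hdet
    · have hpp : p ≠ p₁ := by rintro rfl; simp [det₃_zero_right] at hdet
      have h2 : 1 < (N.volt (σ 0) (σ 1) \ {p, p₁}).card := by
        have := Finset.le_card_sdiff {p, p₁} (N.volt (σ 0) (σ 1))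
        rw [Finset.card_pair hpp] at this
        omega
      obtain ⟨q, hq, r, hr, hqr⟩ := Finset.one_lt_card.1 h2
      simp only [Finset.mem_sdiff, Finset.mem_insert, Finset.mem_singleton, not_or] at hq hr
      refine covolume_le_of_four N.lattice a.2 c.2 (sub_mem p.2 p₁.2) (sub_mem q.2 r.2) hdet
        (N.coe_sub_ne_zero hqr) ?_
      exact hlen p p₁ q r hp hp₁ hq.1 hr.1 hpp (Ne.symm hq.2.1) (Ne.symm hr.2.1)
        (Ne.symm hq.2.2) (Ne.symm hr.2.2) hqr
  · push Not at hind
    obtain ⟨t, ht⟩ := exists_smul_of_det₃_eq_zero za hind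
    obtain ⟨p₂, hp₂, hind₂⟩ : ∃ g ∈ N.volt (σ 0) (σ 1), ∃ z, det₃ (a : Space) (g - p₁) z ≠ 0 := by
      rcases hσ.exists_second p₁ za with ⟨g, hg, z, hz⟩ | ⟨g, hg, z, hz⟩ | h
      · exfalso
        rw [det₃_swap] at hz
        rcases ma g hg with rfl | rfl <;> simp [det₃_neg_right, det₃_self_left] at hz
      · exfalso
        have := hind z
        rw [det₃_swap] at hz this
        rcases mc g hg with rfl | rfl
        · exact hz this
        · simp only [Submodule.coe_neg, det₃_neg_right] at hz
          rw [this] at hz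
          simp at hz
      · exact h
    obtain ⟨p₃, hp₃, hdet⟩ : ∃ g ∈ N.volt (σ 0) (σ 1),
        det₃ (a : Space) (p₂ - p₁) (g - p₁) ≠ 0 := by
      rcases hσ.exists_third p₁ hind₂ with ⟨g, hg, hz⟩ | ⟨g, hg, hz⟩ | h
      · exfalso
        rcases ma g hg with rfl | rfl <;> simp [det₃_neg_right, det₃_self_left] at hz
      · exfalso
        have hc0 : det₃ (a : Space) (p₂ - p₁) c = 0 := by rw [det₃_swap, hind, neg_zero]
        rcases mc g hg with rfl | rfl
        · exact hz hc0
        · simp only [Submodule.coe_neg, det₃_neg_right] at hz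
          rw [hc0] at hz
          simp at hz
      · exact h
    have h12 : p₂ ≠ p₁ := by rintro rfl; simp [det₃_zero_mid] at hdet
    have h13 : p₃ ≠ p₁ := by rintro rfl; simp [det₃_zero_right] at hdet
    have h23 : p₃ ≠ p₂ := by rintro rfl; simp [det₃_self_right] at hdet
    obtain ⟨p₄, hp₄⟩ : (N.volt (σ 0) (σ 1) \ {p₁, p₂, p₃}).Nonempty := by
      have := Finset.le_card_sdiff {p₁, p₂, p₃} (N.volt (σ 0) (σ 1))
      have h3 := Finset.card_le_three (a := p₁) (b := p₂) (c := p₃)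
      exact Finset.card_pos.1 (by omega)
    simp only [Finset.mem_sdiff, Finset.mem_insert, Finset.mem_singleton, not_or] at hp₄
    obtain ⟨hp₄, h14, h24, h34⟩ := hp₄
    -- Four points can be paired in three ways. The signed sum of the three determinants is twice
    -- `det₃ a (p₂ - p₁) (p₃ - p₁)`, so some pairing works.
    have hcases : det₃ (a : Space) (p₂ - p₁) (p₃ - p₄) ≠ 0 ∨
        det₃ (a : Space) (p₃ - p₁) (p₂ - p₄) ≠ 0 ∨ det₃ (a : Space) (p₃ - p₂) (p₁ - p₄) ≠ 0 := by
      by_contra! h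
      obtain ⟨e1, e2, e3⟩ := h
      apply hdet
      simp only [det₃, PiLp.sub_apply] at e1 e2 e3 ⊢
      linear_combination (1 / 2) * e1 - (1 / 2) * e2 + (1 / 2) * e3
    rcases hcases with h | h | h
    · refine covolume_le_of_four N.lattice a.2 (sub_mem p₂.2 p₁.2) (sub_mem p₃.2 p₄.2) c.2 h zc ?_
      have := hlen p₂ p₁ p₃ p₄ hp₂ hp₁ hp₃ hp₄ h12 h23.symm (Ne.symm h24) h13.symm (Ne.symm h14)
        (Ne.symm h34)
      linarith
    · refine covolume_le_of_four N.lattice a.2 (sub_mem p₃.2 p₁.2) (sub_mem p₂.2 p₄.2) c.2 h zc ?_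
      have := hlen p₃ p₁ p₂ p₄ hp₃ hp₁ hp₂ hp₄ h13 h23 (Ne.symm h34) h12.symm (Ne.symm h14)
        (Ne.symm h24)
      linarith
    · refine covolume_le_of_four N.lattice a.2 (sub_mem p₃.2 p₂.2) (sub_mem p₁.2 p₄.2) c.2 h zc ?_
      have := hlen p₃ p₂ p₁ p₄ hp₃ hp₂ hp₁ hp₄ h23 h13 (Ne.symm h34) h12 (Ne.symm h24)
        (Ne.symm h14)
      linarith

/-- Take the two shortest edges and complete them by two more so that the differences have rank
three. Expanding the determinant of differences bounds $V$ by the third elementary symmetric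
function of the four lengths, sharper than a product of norms of differences. -/
theorem IsTransversal.le_length_cube_of_no_loop (hσ : N.IsTransversal σ)
    (h₀ : (N.volt (σ 0) (σ 0)).card = 0) (h₁ : (N.volt (σ 1) (σ 1)).card = 0)
    (hP : 7 ≤ (N.volt (σ 0) (σ 1)).card) : 54 * N.spannedVolume ≤ N.length ^ 3 := by
  classical
  have hL := hσ.length_of_two_vertices
  rw [Finset.card_eq_zero] at h₀ h₁
  rw [h₀, h₁, Finset.sum_empty, zero_add, zero_add] at hL
  obtain ⟨f, hf⟩ : ∃ f : N.lattice → ℝ, f = fun g => ‖N.vec (σ 0) (σ 1) g‖ := ⟨_, rfl⟩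
  have hf0 : ∀ g, 0 ≤ f g := fun g => by rw [hf]; exact norm_nonneg _
  have hL' : N.length = ∑ g ∈ N.volt (σ 0) (σ 1), f g := by rw [hf]; linarith
  obtain ⟨p₁, hp₁, hmin₁⟩ := (N.volt (σ 0) (σ 1)).exists_min_image f
    (Finset.card_pos.1 (by omega))
  have ce := Finset.card_erase_of_mem hp₁
  obtain ⟨p₂, hp₂', hmin₂⟩ := ((N.volt (σ 0) (σ 1)).erase p₁).exists_min_image f
    (Finset.card_pos.1 (by omega))
  obtain ⟨h12, hp₂⟩ := Finset.mem_erase.1 hp₂'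
  obtain ⟨p₃, hp₃, hind⟩ : ∃ g ∈ N.volt (σ 0) (σ 1), ∃ z, det₃ (p₂ - p₁ : Space) (g - p₁) z ≠ 0 := by
    rcases hσ.exists_second p₁ (N.coe_sub_ne_zero h12) with ⟨g, hg, -⟩ | ⟨g, hg, -⟩ | h
    · simp [h₀] at hg
    · simp [h₁] at hg
    · exact h
  obtain ⟨p₄, hp₄, hdet⟩ : ∃ g ∈ N.volt (σ 0) (σ 1),
      det₃ (p₂ - p₁ : Space) (p₃ - p₁) (g - p₁) ≠ 0 := by
    rcases hσ.exists_third p₁ hind with ⟨g, hg, -⟩ | ⟨g, hg, -⟩ | h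
    · simp [h₀] at hg
    · simp [h₁] at hg
    · exact h
  have h13 : p₃ ≠ p₁ := by rintro rfl; simp [det₃_zero_mid] at hdet
  have h14 : p₄ ≠ p₁ := by rintro rfl; simp [det₃_zero_right] at hdet
  have h24 : p₄ ≠ p₂ := by rintro rfl; simp [det₃_self_left] at hdet
  have h34 : p₄ ≠ p₃ := by rintro rfl; simp [det₃_self_right] at hdet
  have h23 : p₃ ≠ p₂ := by
    rintro rfl
    simp [det₃] at hdet
    exact hdet (by ring)
  have hQ : ({p₁, p₂, p₃, p₄} : Finset N.lattice) ⊆ N.volt (σ 0) (σ 1) := by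
    simp [Finset.insert_subset_iff, hp₁, hp₂, hp₃, hp₄]
  have hsum : ∑ g ∈ ({p₁, p₂, p₃, p₄} : Finset N.lattice), f g = f p₁ + f p₂ + f p₃ + f p₄ := by
    rw [Finset.sum_insert, Finset.sum_insert, Finset.sum_pair h34.symm]
    · ring
    · simp [h23.symm, h24.symm]
    · simp [h12.symm, h13.symm, h14.symm]
  -- At least $7-4=3$ edges remain, none shorter than the second shortest one.
  have hrest : 3 * f p₂ ≤ ∑ g ∈ N.volt (σ 0) (σ 1) \ {p₁, p₂, p₃, p₄}, f g := by
    have hcard := Finset.le_card_sdiff {p₁, p₂, p₃, p₄} (N.volt (σ 0) (σ 1))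
    have h4 := Finset.card_le_four (a := p₁) (b := p₂) (c := p₃) (d := p₄)
    have h5 := Finset.card_nsmul_le_sum (N.volt (σ 0) (σ 1) \ {p₁, p₂, p₃, p₄}) f (f p₂) (by
      intro g hg
      simp only [Finset.mem_sdiff, Finset.mem_insert, Finset.mem_singleton, not_or] at hg
      exact hmin₂ g (Finset.mem_erase.2 ⟨hg.2.1, hg.1⟩))
    refine le_trans ?_ h5
    rw [nsmul_eq_mul]
    have : (3 : ℝ) ≤ ((N.volt (σ 0) (σ 1) \ {p₁, p₂, p₃, p₄}).card : ℝ) := by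
      exact_mod_cast (by omega)
    exact mul_le_mul_of_nonneg_right this (hf0 _)
  have hlen : f p₁ + 4 * f p₂ + f p₃ + f p₄ ≤ N.length := by
    rw [hL', ← Finset.sum_sdiff hQ, hsum]
    linarith
  have hvol : N.spannedVolume ≤ f p₁ * f p₂ * f p₃ + f p₁ * f p₂ * f p₄ + f p₁ * f p₃ * f p₄
      + f p₂ * f p₃ * f p₄ := by
    refine (covolume_le_abs_det₃ N.lattice (sub_mem p₂.2 p₁.2) (sub_mem p₃.2 p₁.2)
      (sub_mem p₄.2 p₁.2) hdet).trans ?_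
    have := abs_det₃_sub_le (N.vec (σ 0) (σ 1) p₁) (N.vec (σ 0) (σ 1) p₂) (N.vec (σ 0) (σ 1) p₃)
      (N.vec (σ 0) (σ 1) p₄)
    have hsub : ∀ g h : N.lattice, N.vec (σ 0) (σ 1) g - N.vec (σ 0) (σ 1) h = (g : Space) - h := by
      intro g h
      rw [vec_eq, vec_eq]; abel
    rw [hsub, hsub, hsub] at this
    rw [hf]
    exact this
  have hb := e3_bound (hf0 p₁) (hmin₁ p₂ hp₂) (hmin₂ p₃ (Finset.mem_erase.2 ⟨h13, hp₃⟩))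
    (hmin₂ p₄ (Finset.mem_erase.2 ⟨h14, hp₄⟩))
  have hpos : 0 ≤ f p₁ + 4 * f p₂ + f p₃ + f p₄ := by
    linarith [hf0 p₁, hf0 p₂, hf0 p₃, hf0 p₄]
  have : (f p₁ + 4 * f p₂ + f p₃ + f p₄) ^ 3 ≤ N.length ^ 3 := by gcongr
  linarith

/-- Both vertices have degree `d` and the same number of connecting edges, hence the same number of
loop voltages; the cases are none, at most two, and more. -/
theorem le_length_cube_of_two_vertices (hσ : N.IsTransversal σ) (hd : 7 ≤ d) :
    54 * N.spannedVolume ≤ N.length ^ 3 := by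
  have c0 := hσ.sum_card_volt (σ 0)
  have c1 := hσ.sum_card_volt (σ 1)
  rw [Fin.sum_univ_two] at c0 c1
  have c2 := N.card_volt_comm (σ 0) (σ 1)
  rcases Nat.lt_or_ge (N.volt (σ 0) (σ 0)).card 3 with h | h
  · rcases Nat.eq_zero_or_pos (N.volt (σ 0) (σ 0)).card with h' | h'
    · exact hσ.le_length_cube_of_no_loop h' (by omega) (by omega)
    · exact hσ.le_length_cube_of_one_loop (by omega) (by omega) (by omega) (by omega) (by omega)
  · exact hσ.le_length_cube_of_many_loops h (by omega)

end TwoVertices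

theorem le_length_cube_of_vertexCount_le_two (hd : 7 ≤ d) (h : N.vertexCount ≤ 2) :
    54 * N.spannedVolume ≤ N.length ^ 3 := by
  have hpos : 0 < N.vertexCount := by
    obtain ⟨v⟩ := N.connected.nonempty
    have : Nonempty N.QuotVert := ⟨Quotient.mk _ v⟩
    exact Nat.card_pos
  have e := Finite.equivFin N.QuotVert
  have hcard : Nat.card N.QuotVert = 1 ∨ Nat.card N.QuotVert = 2 := by
    unfold vertexCount at hpos h; omega
  rcases hcard with hc | hc
  · obtain ⟨σ, hσ⟩ := N.exists_isTransversal ((finCongr hc).symm.trans e.symm)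
    -- With a single vertex the degree is twice the number of edges, so $d\ge7$ improves to $d\ge8$.
    have := hσ.two_mul_card_quotEdge
    rw [Fintype.card_fin] at this
    exact le_length_cube_of_one_vertex hσ (by omega)
  · obtain ⟨σ, hσ⟩ := N.exists_isTransversal ((finCongr hc).symm.trans e.symm)
    exact le_length_cube_of_two_vertices hσ hd

end PeriodicNetwork

/-! ### Constructing networks from voltage graphs. -/

theorem linearIndependent_and_span_of_det₃_ne_zero {e : Fin 3 → Space}
    (h : det₃ (e 0) (e 1) (e 2) ≠ 0) :
    LinearIndependent ℝ e ∧ Submodule.span ℝ (Set.range e) = ⊤ := by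
  rw [Module.Basis.is_basis_iff_det (EuclideanSpace.basisFun (Fin 3) ℝ).toBasis]
  have : e = ![e 0, e 1, e 2] := by ext i; fin_cases i <;> rfl
  rw [this, det₃_eq_basis_det]
  exact isUnit_iff_ne_zero.2 h

/-- A finite graph with voltages in `ℤ³`, a basis of `ℝ³`, and positions of the vertices. It
describes a triply periodic network with vertex set `Q × ℤ³`. -/
structure VoltageGraph (Q : Type) where
  /-- the voltages of the directed edges from `i` to `j` -/
  S : Q → Q → Finset (Fin 3 → ℤ)
  neg_mem : ∀ i j g, g ∈ S i j → -g ∈ S j i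
  zero_notMem : ∀ i, 0 ∉ S i i
  /-- the generators of the lattice -/
  e : Fin 3 → Space
  det_ne : det₃ (e 0) (e 1) (e 2) ≠ 0
  /-- the positions of the vertices of a transversal -/
  p : Q → Space

namespace VoltageGraph

variable {Q : Type} (X : VoltageGraph Q)

/-- The derived graph. -/
def graph : SimpleGraph (Q × (Fin 3 → ℤ)) where
  Adj x y := y.2 - x.2 ∈ X.S x.1 y.1
  symm := ⟨fun x y h => by
    have := X.neg_mem _ _ _ h
    rwa [neg_sub] at this⟩
  loopless := ⟨fun x h => X.zero_notMem x.1 (by simpa using h)⟩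

theorem graph_adj {x y : Q × (Fin 3 → ℤ)} : X.graph.Adj x y ↔ y.2 - x.2 ∈ X.S x.1 y.1 := Iff.rfl

/-- The lattice vector with given integer coordinates. -/
def latVec (g : Fin 3 → ℤ) : Space := ∑ m, g m • X.e m

theorem latVec_add (g h : Fin 3 → ℤ) : X.latVec (g + h) = X.latVec g + X.latVec h := by
  simp [latVec, add_smul, Finset.sum_add_distrib]

theorem latVec_sub (g h : Fin 3 → ℤ) : X.latVec (g - h) = X.latVec g - X.latVec h := by
  simp [latVec, sub_smul, Finset.sum_sub_distrib]

theorem latVec_neg (g : Fin 3 → ℤ) : X.latVec (-g) = -X.latVec g := by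
  simp [latVec]

theorem latVec_apply (g : Fin 3 → ℤ) (i : Fin 3) :
    X.latVec g i = g 0 * X.e 0 i + g 1 * X.e 1 i + g 2 * X.e 2 i := by
  simp [latVec, Fin.sum_univ_three, ← Int.cast_smul_eq_zsmul ℝ]

/-- The straight edge vectors of the network. -/
def vec (i j : Q) (g : Fin 3 → ℤ) : Space := X.latVec g + X.p j - X.p i

theorem vec_neg (i j : Q) (g : Fin 3 → ℤ) : X.vec j i (-g) = -X.vec i j g := by
  simp only [vec, latVec_neg]; abel

theorem vec_apply (i j : Q) (g : Fin 3 → ℤ) (m : Fin 3) :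
    X.vec i j g m = g 0 * X.e 0 m + g 1 * X.e 1 m + g 2 * X.e 2 m + X.p j m - X.p i m := by
  simp [vec, latVec_apply]

/-- The basis of `ℝ³` formed by the generators. -/
noncomputable def basis : Module.Basis (Fin 3) ℝ Space :=
  Module.Basis.mk (linearIndependent_and_span_of_det₃_ne_zero X.det_ne).1
    (linearIndependent_and_span_of_det₃_ne_zero X.det_ne).2.ge

theorem basis_apply (m : Fin 3) : X.basis m = X.e m := by simp [basis]

/-- The lattice spanned by the generators. -/
noncomputable abbrev lat : Submodule ℤ Space := Submodule.span ℤ (Set.range X.basis)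

/-- Integer coordinates on the lattice. -/
noncomputable def coord : X.lat ≃ₗ[ℤ] (Fin 3 → ℤ) := (X.basis.restrictScalars ℤ).equivFun

theorem latVec_coord (g : X.lat) : X.latVec (X.coord g) = g := by
  have h := congrArg (Subtype.val) ((X.basis.restrictScalars ℤ).sum_equivFun g)
  rw [← h, Submodule.coe_sum]
  refine Finset.sum_congr rfl fun m _ => ?_
  rw [Submodule.coe_smul, Module.Basis.restrictScalars_apply, basis_apply]
  rfl

theorem latVec_injective : Function.Injective X.latVec := by
  intro g h e
  obtain ⟨a, rfl⟩ := X.coord.surjective g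
  obtain ⟨b, rfl⟩ := X.coord.surjective h
  rw [latVec_coord, latVec_coord] at e
  rw [Subtype.ext e]

/-- The lattice acts on the derived graph. -/
@[reducible] noncomputable def action : AddAction X.lat (Q × (Fin 3 → ℤ)) where
  vadd g x := (x.1, X.coord g + x.2)
  zero_vadd x := by
    change (x.1, X.coord 0 + x.2) = x
    simp
  add_vadd g h x := by
    change (x.1, X.coord (g + h) + x.2) = (x.1, X.coord g + (X.coord h + x.2))
    rw [map_add, add_assoc]

/-- Nondegeneracy of the stars of the network. -/
def StarEmbedded : Prop :=
  ∀ i j k, ∀ g ∈ X.S i j, ∀ h ∈ X.S i k, (j, g) ≠ (k, h) → ¬ SameRay ℝ (X.vec i j g) (X.vec i k h)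

theorem neighborSet_eq [Fintype Q] (x : Q × (Fin 3 → ℤ)) :
    X.graph.neighborSet x =
      (fun y : (Σ _ : Q, (Fin 3 → ℤ)) => (y.1, y.2 + x.2)) '' (Finset.univ.sigma (X.S x.1)) := by
  ext y
  simp only [SimpleGraph.mem_neighborSet, graph_adj, Set.mem_image, Finset.mem_coe,
    Finset.mem_sigma, Finset.mem_univ, true_and, Sigma.exists]
  constructor
  · intro h
    exact ⟨y.1, y.2 - x.2, h, by simp⟩
  · rintro ⟨j, g, h, rfl⟩
    simpa using h

theorem injective_translate (z : Fin 3 → ℤ) :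
    Function.Injective (fun y : (Σ _ : Q, (Fin 3 → ℤ)) => (y.1, y.2 + z)) := by
  rintro ⟨j, g⟩ ⟨k, h⟩ e
  obtain ⟨h1, h2⟩ := Prod.mk.inj e
  dsimp only at h1 h2
  rw [h1, add_right_cancel h2]

variable [Fintype Q] {d : ℕ}

/-- The triply periodic network of a voltage graph. -/
noncomputable def network (hd : 3 ≤ d) (hconn : X.graph.Connected)
    (hdeg : ∀ i, ∑ j, (X.S i j).card = d)
    (hvec : ∀ i j, ∀ g ∈ X.S i j, X.vec i j g ≠ 0) (hstar : X.StarEmbedded) :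
    PeriodicNetwork 3 d where
  two_le := by norm_num
  three_le := hd
  Vert := Q × (Fin 3 → ℤ)
  graph := X.graph
  connected := hconn
  degree_eq x := by
    rw [X.neighborSet_eq, (injective_translate x.2).encard_image, Set.encard_coe_eq_coe_finsetCard,
      Finset.card_sigma, hdeg]
  pos x := X.latVec x.2 + X.p x.1
  pos_ne x y h e := hvec _ _ _ h (by
    rw [vec, latVec_sub, sub_add_eq_add_sub, sub_sub, sub_eq_zero]
    exact e.symm)
  star_embedded := by
    intro x y z hy hz hne
    have hsub : ∀ w : Q × (Fin 3 → ℤ), X.latVec w.2 + X.p w.1 - (X.latVec x.2 + X.p x.1) =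
        X.vec x.1 w.1 (w.2 - x.2) := by
      intro w
      rw [vec, latVec_sub]; abel
    rw [segment_inter_segment_eq_singleton_iff, hsub, hsub]
    · refine hstar _ _ _ _ hy _ hz ?_
      intro h
      obtain ⟨h1, h2⟩ := Prod.mk.inj h
      exact hne (Prod.ext h1 (sub_left_injective h2))
    · rw [← sub_ne_zero, hsub]; exact hvec _ _ _ hy
    · rw [← sub_ne_zero, hsub]; exact hvec _ _ _ hz
  lattice := X.lat
  discrete := inferInstance
  isZLattice := inferInstance
  action := X.action
  vadd_adj g x y h := by
    change (X.coord g + y.2) - (X.coord g + x.2) ∈ X.S x.1 y.1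
    rwa [add_sub_add_left_eq_sub]
  pos_vadd g x := by
    change X.latVec (X.coord g + x.2) + X.p x.1 = _
    rw [latVec_add, latVec_coord, add_assoc]
  finite_quotient := by
    let _ := X.action
    refine Finite.of_surjective (α := Q) (fun q => Quotient.mk _ (q, 0)) ?_
    intro z
    induction z using Quotient.inductionOn with
    | _ x =>
      refine ⟨x.1, Quotient.sound ⟨X.coord.symm (-x.2), ?_⟩⟩
      change (x.1, X.coord (X.coord.symm (-x.2)) + x.2) = (x.1, 0)
      simp

section Network

variable {X} {hd : 3 ≤ d} {hconn : X.graph.Connected} {hdeg : ∀ i, ∑ j, (X.S i j).card = d}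
  {hvec : ∀ i j, ∀ g ∈ X.S i j, X.vec i j g ≠ 0} {hstar : X.StarEmbedded}

variable (X hd hconn hdeg hvec hstar) in
/-- The standard transversal of the network of a voltage graph. -/
def origin (q : Q) : (X.network hd hconn hdeg hvec hstar).Vert := (q, 0)

theorem isTransversal_origin : (X.network hd hconn hdeg hvec hstar).IsTransversal
    (X.origin hd hconn hdeg hvec hstar) := by
  constructor
  · intro i j h
    obtain ⟨g, hg⟩ := (X.network hd hconn hdeg hvec hstar).quot_mk_eq_iff.1 h
    exact (congrArg Prod.fst hg).symm
  · intro z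
    induction z using Quotient.inductionOn with
    | _ x =>
      refine ⟨x.1, Quotient.sound ⟨X.coord.symm (-x.2), ?_⟩⟩
      change (x.1, X.coord (X.coord.symm (-x.2)) + x.2) = (x.1, 0)
      simp

theorem vertexCount_network : (X.network hd hconn hdeg hvec hstar).vertexCount = Fintype.card Q :=
  isTransversal_origin.card_eq

theorem mem_volt_network {i j : Q} {g : (X.network hd hconn hdeg hvec hstar).lattice} :
    g ∈ (X.network hd hconn hdeg hvec hstar).volt (X.origin hd hconn hdeg hvec hstar i)
      (X.origin hd hconn hdeg hvec hstar j) ↔ X.coord g ∈ X.S i j := by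
  rw [PeriodicNetwork.mem_volt]
  change (X.coord g + 0) - 0 ∈ X.S i j ↔ _
  rw [add_zero, sub_zero]

theorem vec_network {i j : Q} {g : (X.network hd hconn hdeg hvec hstar).lattice} :
    (X.network hd hconn hdeg hvec hstar).vec (X.origin hd hconn hdeg hvec hstar i)
      (X.origin hd hconn hdeg hvec hstar j) g = X.vec i j (X.coord g) := by
  have key : ∀ a : X.lat, (a : Space) + (X.latVec 0 + X.p j) - (X.latVec 0 + X.p i) =
      X.vec i j (X.coord a) := by
    intro a
    have : X.latVec 0 = 0 := by simp [latVec]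
    rw [vec, latVec_coord, this, zero_add, zero_add]
  rw [PeriodicNetwork.vec_eq]
  exact key g

theorem sum_volt_network {R : Type*} [AddCommMonoid R] (i j : Q) (f : (Fin 3 → ℤ) → R) :
    ∑ g ∈ (X.network hd hconn hdeg hvec hstar).volt (X.origin hd hconn hdeg hvec hstar i)
      (X.origin hd hconn hdeg hvec hstar j), f (X.coord g) = ∑ g ∈ X.S i j, f g :=
  Finset.sum_bij (fun g _ => X.coord g) (fun _ hg => mem_volt_network.1 hg)
    (fun _ _ _ _ h => X.coord.injective h)
    (fun g hg => ⟨X.coord.symm g, mem_volt_network.2 (by simpa using hg), by simp⟩)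
    (fun _ _ => rfl)

theorem card_volt_network (i j : Q) :
    ((X.network hd hconn hdeg hvec hstar).volt (X.origin hd hconn hdeg hvec hstar i)
      (X.origin hd hconn hdeg hvec hstar j)).card = (X.S i j).card := by
  have := sum_volt_network (hd := hd) (hconn := hconn) (hdeg := hdeg) (hvec := hvec)
    (hstar := hstar) i j (fun _ => 1)
  simpa only [Finset.sum_const, smul_eq_mul, mul_one] using this

theorem two_mul_length_network : 2 * (X.network hd hconn hdeg hvec hstar).length =
    ∑ i, ∑ j, ∑ g ∈ X.S i j, ‖X.vec i j g‖ := by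
  rw [(isTransversal_origin (X := X)).two_mul_length]
  refine Finset.sum_congr rfl fun i _ => Finset.sum_congr rfl fun j _ => ?_
  rw [← sum_volt_network (hd := hd) (hconn := hconn) (hdeg := hdeg) (hvec := hvec)
    (hstar := hstar) i j]
  simp only [vec_network]

theorem spannedVolume_network : (X.network hd hconn hdeg hvec hstar).spannedVolume =
    |det₃ (X.e 0) (X.e 1) (X.e 2)| := by
  change ZLattice.covolume X.lat = _
  rw [covolume_eq_abs_det₃ X.lat (X.basis.restrictScalars ℤ)]
  simp [basis_apply]

theorem isBalanced_network (h : ∀ i, ∑ j, ∑ g ∈ X.S i j, ‖X.vec i j g‖⁻¹ • X.vec i j g = 0) :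
    (X.network hd hconn hdeg hvec hstar).IsBalanced := by
  intro x
  have h1 : (X.network hd hconn hdeg hvec hstar).force x =
      ∑ᶠ y ∈ X.graph.neighborSet x, -(‖X.vec x.1 y.1 (y.2 - x.2)‖⁻¹ • X.vec x.1 y.1 (y.2 - x.2)) := by
    unfold PeriodicNetwork.force
    refine finsum_congr fun y => finsum_congr fun _ => ?_
    have : X.latVec x.2 + X.p x.1 - (X.latVec y.2 + X.p y.1) = -X.vec x.1 y.1 (y.2 - x.2) := by
      rw [vec, latVec_sub]; abel
    change ‖X.latVec x.2 + X.p x.1 - (X.latVec y.2 + X.p y.1)‖⁻¹ •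
      (X.latVec x.2 + X.p x.1 - (X.latVec y.2 + X.p y.1)) = _
    rw [this, norm_neg, smul_neg]
  have h2 : ∀ x : Q × (Fin 3 → ℤ), ∑ᶠ y ∈ X.graph.neighborSet x,
      -(‖X.vec x.1 y.1 (y.2 - x.2)‖⁻¹ • X.vec x.1 y.1 (y.2 - x.2)) = 0 := by
    intro x
    rw [X.neighborSet_eq, finsum_mem_image ((injective_translate x.2).injOn),
      finsum_mem_coe_finset, Finset.sum_sigma]
    simp only [add_sub_cancel_right, Finset.sum_neg_distrib, h x.1, neg_zero]
  exact h1.trans (h2 x)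

end Network

omit [Fintype Q]

theorem reachable_add {x y : Q × (Fin 3 → ℤ)} (z : Fin 3 → ℤ) (h : X.graph.Reachable x y) :
    X.graph.Reachable (x.1, x.2 + z) (y.1, y.2 + z) := by
  let f : X.graph →g X.graph := ⟨fun x => (x.1, x.2 + z), by
    intro a b hab
    simpa [graph_adj] using hab⟩
  exact h.map f

/-- The derived graph has a path from `(i, 0)` to `(j, g)`. -/
def Reaches (i j : Q) (g : Fin 3 → ℤ) : Prop := X.graph.Reachable (i, 0) (j, g)

variable {X}

theorem Reaches.of_mem {i j : Q} {g : Fin 3 → ℤ} (h : g ∈ X.S i j) : X.Reaches i j g :=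
  SimpleGraph.Adj.reachable (by simpa [graph_adj] using h)

theorem Reaches.refl (i : Q) : X.Reaches i i 0 := SimpleGraph.Reachable.refl _

theorem Reaches.trans {i j k : Q} {g h : Fin 3 → ℤ} (h₁ : X.Reaches i j g) (h₂ : X.Reaches j k h) :
    X.Reaches i k (g + h) := by
  have := X.reachable_add g h₂
  simp only [zero_add] at this
  rw [add_comm]
  exact SimpleGraph.Reachable.trans h₁ this

theorem Reaches.symm {i j : Q} {g : Fin 3 → ℤ} (h : X.Reaches i j g) : X.Reaches j i (-g) := by
  have := X.reachable_add (-g) h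
  simp only [zero_add, add_neg_cancel] at this
  exact SimpleGraph.Reachable.symm this

/-- The total voltages of closed walks at `q₀` form a subgroup of $\mathbb Z^3$, so it suffices to
reach the three unit vectors. -/
theorem connected_of_reaches (q₀ : Q) (h : ∀ q, X.Reaches q₀ q 0)
    (h' : ∀ m, X.Reaches q₀ q₀ (Pi.single m 1)) : X.graph.Connected := by
  let K : AddSubgroup (Fin 3 → ℤ) :=
    { carrier := {g | X.Reaches q₀ q₀ g}
      zero_mem' := Reaches.refl q₀
      add_mem' := fun ha hb => Reaches.trans ha hb
      neg_mem' := fun ha => Reaches.symm ha }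
  have hK : ∀ g : Fin 3 → ℤ, X.Reaches q₀ q₀ g := by
    intro g
    have : g = ∑ m, g m • (Pi.single m 1 : Fin 3 → ℤ) := by
      ext i
      fin_cases i <;> simp [Fin.sum_univ_three]
    have hm : g ∈ K := by
      rw [this]
      exact sum_mem fun m _ => K.zsmul_mem (h' m) _
    exact hm
  have h0 : ∀ x : Q × (Fin 3 → ℤ), X.graph.Reachable (q₀, 0) x := by
    intro x
    have := (hK x.2).trans (h x.1)
    rwa [add_zero] at this
  have : Nonempty (Q × (Fin 3 → ℤ)) := ⟨(q₀, 0)⟩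
  exact ⟨fun x y => (h0 x).symm.trans (h0 y)⟩

end VoltageGraph

/-! ### Checking that stars are embedded. -/

/-- A positively homogeneous function takes the value 1 at most once on a ray. Neither continuity
nor convexity is needed, so `f` can be defined piecewise to fit each example. -/
theorem eq_of_sameRay_of_homogeneous {f : Space → ℝ} (hf : ∀ r : ℝ, 0 < r → ∀ x, f (r • x) = r * f x)
    {x y : Space} (h : SameRay ℝ x y) (hx : f x = 1) (hy : f y = 1) : x = y := by
  have h0 : f 0 = 0 := by
    have := hf 2 two_pos 0
    rw [smul_zero] at this
    linarith
  have hx0 : x ≠ 0 := by rintro rfl; linarith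
  have hy0 : y ≠ 0 := by rintro rfl; linarith
  obtain ⟨r, hr, rfl⟩ := h.exists_pos_left hx0 hy0
  rw [hf r hr, hx, mul_one] at hy
  rw [hy, one_smul]

namespace VoltageGraph

variable {Q : Type} {X : VoltageGraph Q}

/-- A star is embedded if its edge vectors are distinct and lie on the unit sphere of some
positively homogeneous function. -/
theorem starEmbedded_of_homogeneous (f : Q → Space → ℝ)
    (hf : ∀ i, ∀ r : ℝ, 0 < r → ∀ x, f i (r • x) = r * f i x)
    (h1 : ∀ i j, ∀ g ∈ X.S i j, f i (X.vec i j g) = 1)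
    (hne : ∀ i j k, ∀ g ∈ X.S i j, ∀ h ∈ X.S i k, j ≠ k → X.vec i j g ≠ X.vec i k h) :
    X.StarEmbedded := by
  intro i j k g hg h hh hjk hs
  have e := eq_of_sameRay_of_homogeneous (hf i) hs (h1 i j g hg) (h1 i k h hh)
  by_cases hj : j = k
  · subst hj
    apply hjk
    have : X.latVec g = X.latVec h := by
      rw [vec, vec, sub_left_inj, add_left_inj] at e
      exact e
    rw [X.latVec_injective this]
  · exact hne i j k g hg h hh hj e

theorem vec_ne_zero_of_homogeneous (f : Q → Space → ℝ)
    (hf : ∀ i, ∀ r : ℝ, 0 < r → ∀ x, f i (r • x) = r * f i x)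
    (h1 : ∀ i j, ∀ g ∈ X.S i j, f i (X.vec i j g) = 1) (i j : Q) (g : Fin 3 → ℤ)
    (hg : g ∈ X.S i j) : X.vec i j g ≠ 0 := by
  intro h
  have h2 := hf i 2 two_pos 0
  have h3 := h1 i j g hg
  rw [h] at h3
  rw [smul_zero] at h2
  linarith

end VoltageGraph

theorem sum_eq_zero_of_odd {T : Finset (Fin 3 → ℤ)} (hT : ∀ g ∈ T, -g ∈ T)
    {F : (Fin 3 → ℤ) → Space} (hF : ∀ g, F (-g) = -F g) : ∑ g ∈ T, F g = 0 := by
  have h : ∑ g ∈ T, F g = ∑ g ∈ T, F (-g) :=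
    Finset.sum_bij (fun g _ => -g) hT (fun _ _ _ _ h => neg_injective h)
      (fun g hg => ⟨-g, hT g hg, neg_neg g⟩) (fun g _ => by rw [neg_neg])
  simp only [hF, Finset.sum_neg_distrib] at h
  have h2 : (2 : ℝ) • ∑ g ∈ T, F g = 0 := by
    rw [two_smul]
    nth_rewrite 1 [h]
    exact neg_add_cancel _
  simpa using h2

/-- A loop pulls at its vertex with two opposite unit vectors, so loops never disturb balance. -/
theorem VoltageGraph.sum_loops_eq_zero {Q : Type} (X : VoltageGraph Q) (i : Q) :
    ∑ g ∈ X.S i i, ‖X.vec i i g‖⁻¹ • X.vec i i g = 0 :=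
  sum_eq_zero_of_odd (X.neg_mem i i) fun g => by rw [X.vec_neg, norm_neg, smul_neg]

/-! ### Balanced one-vertex networks of even degree. -/

/-- The voltages `±(k, 0, 1)` for `k < l`. -/
def loopSet (l : ℕ) : Finset (Fin 3 → ℤ) :=
  (Finset.range l).image (fun k : ℕ => ![(k : ℤ), 0, 1]) ∪
    (Finset.range l).image (fun k : ℕ => ![-(k : ℤ), 0, -1])

theorem mem_loopSet {l : ℕ} {g : Fin 3 → ℤ} :
    g ∈ loopSet l ↔ ∃ k < l, g = ![(k : ℤ), 0, 1] ∨ g = ![-(k : ℤ), 0, -1] := by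
  simp only [loopSet, Finset.mem_union, Finset.mem_image, Finset.mem_range]
  constructor
  · rintro (⟨k, hk, rfl⟩ | ⟨k, hk, rfl⟩)
    · exact ⟨k, hk, Or.inl rfl⟩
    · exact ⟨k, hk, Or.inr rfl⟩
  · rintro ⟨k, hk, rfl | rfl⟩
    · exact Or.inl ⟨k, hk, rfl⟩
    · exact Or.inr ⟨k, hk, rfl⟩

theorem neg_mem_loopSet {l : ℕ} {g : Fin 3 → ℤ} (h : g ∈ loopSet l) : -g ∈ loopSet l := by
  rw [mem_loopSet] at h ⊢
  obtain ⟨k, hk, rfl | rfl⟩ := h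
  · exact ⟨k, hk, Or.inr (by simp)⟩
  · exact ⟨k, hk, Or.inl (by simp)⟩

theorem abs_two_of_mem_loopSet {l : ℕ} {g : Fin 3 → ℤ} (h : g ∈ loopSet l) :
    g 1 = 0 ∧ |(g 2 : ℝ)| = 1 := by
  obtain ⟨k, hk, rfl | rfl⟩ := mem_loopSet.1 h <;> simp

theorem card_loopSet (l : ℕ) : (loopSet l).card = 2 * l := by
  rw [loopSet, Finset.card_union_of_disjoint, Finset.card_image_of_injective,
    Finset.card_image_of_injective, Finset.card_range]
  · ring
  · intro a b h
    have := congrFun h 0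
    simpa using this
  · intro a b h
    have := congrFun h 0
    simpa using this
  · rw [Finset.disjoint_left]
    intro g hg hg'
    obtain ⟨k, -, rfl⟩ := Finset.mem_image.1 hg
    obtain ⟨k', -, h⟩ := Finset.mem_image.1 hg'
    have := congrFun h 2
    simp at this

/-- The voltages `±(1, 0, 0)`, `±(0, 1, 0)`. -/
def crossSet : Finset (Fin 3 → ℤ) := {![1, 0, 0], ![-1, 0, 0], ![0, 1, 0], ![0, -1, 0]}

theorem mem_crossSet {g : Fin 3 → ℤ} : g ∈ crossSet ↔
    g = ![1, 0, 0] ∨ g = ![-1, 0, 0] ∨ g = ![0, 1, 0] ∨ g = ![0, -1, 0] := by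
  simp [crossSet]

/-- The one-vertex network whose loops include those of the primitive cubic network. -/
def bouquet (l : ℕ) : VoltageGraph (Fin 1) where
  S _ _ := crossSet ∪ loopSet l
  neg_mem _ _ g h := by
    rw [Finset.mem_union] at h ⊢
    rcases h with h | h
    · left
      rw [mem_crossSet] at h ⊢
      rcases h with rfl | rfl | rfl | rfl <;> simp
    · exact Or.inr (neg_mem_loopSet h)
  zero_notMem _ h := by
    rw [Finset.mem_union] at h
    rcases h with h | h
    · rw [mem_crossSet] at h
      rcases h with h | h | h | h
      · simpa using congrFun h 0
      · simpa using congrFun h 0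
      · simpa using congrFun h 1
      · simpa using congrFun h 1
    · have := (abs_two_of_mem_loopSet h).2
      simp at this
  e := ![!₂[1, 0, 0], !₂[0, 1, 0], !₂[0, 0, 1]]
  det_ne := by simp [det₃]
  p _ := 0

theorem bouquet_vec_apply (l : ℕ) (i j : Fin 1) (g : Fin 3 → ℤ) (m : Fin 3) :
    (bouquet l).vec i j g m = g m := by
  rw [VoltageGraph.vec_apply]
  fin_cases m <;> simp [bouquet]

theorem exists_isBalanced_of_even {d : ℕ} (hd : 6 ≤ d) (he : Even d) :
    ∃ M : PeriodicNetwork 3 d, M.IsBalanced ∧ M.vertexCount = 1 := by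
  obtain ⟨l, hl, rfl⟩ : ∃ l, 1 ≤ l ∧ d = 4 + 2 * l := by
    obtain ⟨k, hk⟩ := he
    exact ⟨k - 2, by omega, by omega⟩
  -- The cross loops lie on the unit $\ell^1$-circle of the horizontal plane, and the loops
  -- $\pm(k,0,1)$ at height $\pm1$.
  let f : Fin 1 → Space → ℝ := fun _ x => if x 2 = 0 then |x 0| + |x 1| else |x 2|
  have hf : ∀ i, ∀ r : ℝ, 0 < r → ∀ x, f i (r • x) = r * f i x := by
    intro i r hr x
    simp only [f, PiLp.smul_apply, smul_eq_mul, mul_eq_zero, hr.ne', false_or, abs_mul,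
      abs_of_pos hr]
    split_ifs <;> ring
  have h1 : ∀ i j, ∀ g ∈ (bouquet l).S i j, f i ((bouquet l).vec i j g) = 1 := by
    intro i j g hg
    simp only [f, bouquet_vec_apply]
    rcases Finset.mem_union.1 hg with h | h
    · rcases mem_crossSet.1 h with rfl | rfl | rfl | rfl <;> simp
    · have := (abs_two_of_mem_loopSet h).2
      rw [if_neg, this]
      intro h0
      simp [h0] at this
  have hconn : (bouquet l).graph.Connected := by
    refine VoltageGraph.connected_of_reaches 0 (fun q => ?_) (fun m => ?_)
    · rw [Subsingleton.elim q 0]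
      exact VoltageGraph.Reaches.refl _
    · have hm : ∀ g ∈ crossSet ∪ loopSet l, (bouquet l).Reaches 0 0 g :=
        fun g hg => VoltageGraph.Reaches.of_mem hg
      fin_cases m
      · refine hm _ (Finset.mem_union_left _ (mem_crossSet.2 (Or.inl ?_)))
        ext i; fin_cases i <;> simp
      · refine hm _ (Finset.mem_union_left _ (mem_crossSet.2 (Or.inr (Or.inr (Or.inl ?_)))))
        ext i; fin_cases i <;> simp
      · refine hm _ (Finset.mem_union_right _ (mem_loopSet.2 ⟨0, by omega, Or.inl ?_⟩))
        ext i; fin_cases i <;> simp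
  have hdeg : ∀ i, ∑ j, ((bouquet l).S i j).card = 4 + 2 * l := by
    intro i
    rw [Fin.sum_univ_one]
    change (crossSet ∪ loopSet l).card = _
    rw [Finset.card_union_of_disjoint, card_loopSet]
    · rfl
    · rw [Finset.disjoint_left]
      intro g hg hg'
      have := (abs_two_of_mem_loopSet hg').2
      rcases mem_crossSet.1 hg with rfl | rfl | rfl | rfl <;> simp at this
  refine ⟨(bouquet l).network (by omega) hconn hdeg
    (VoltageGraph.vec_ne_zero_of_homogeneous f hf h1)
    (VoltageGraph.starEmbedded_of_homogeneous f hf h1 fun i j k _ _ _ _ hjk =>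
      absurd (Subsingleton.elim j k) hjk), ?_, ?_⟩
  · refine VoltageGraph.isBalanced_network fun i => ?_
    rw [Fin.sum_univ_one, Subsingleton.elim i 0]
    exact VoltageGraph.sum_loops_eq_zero _ _
  · rw [VoltageGraph.vertexCount_network, Fintype.card_fin]

/-! ### Layered two-vertex networks of odd degree. -/

/-- The two-vertex network obtained from hexagonal layers joined by transversal loops. -/
noncomputable def layered (l : ℕ) : VoltageGraph (Fin 2) where
  S := ![![loopSet l, {0, ![1, 0, 0], ![0, 1, 0]}], ![{0, ![-1, 0, 0], ![0, -1, 0]}, loopSet l]]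
  neg_mem i j g h := by
    fin_cases i <;> fin_cases j
    · exact neg_mem_loopSet h
    · simp at h ⊢
      rcases h with rfl | rfl | rfl <;> simp
    · simp at h ⊢
      rcases h with rfl | rfl | rfl <;> simp
    · exact neg_mem_loopSet h
  zero_notMem i h := by
    have h : 0 ∈ loopSet l := by fin_cases i <;> exact h
    have := (abs_two_of_mem_loopSet h).2
    simp at this
  e := ![!₂[-1, 2, -1], !₂[-2, 1, 1], !₂[1 / 2, 1 / 2, 1 / 2]]
  det_ne := by simp [det₃]; norm_num
  p := ![0, !₂[1, -1, 0]]

/-- The hexagonal layers are parallel to the plane where the coordinates sum to zero; only the third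
generator, with coordinate sum $3/2$, leaves it. The coordinate sum thus separates loops from
connecting edges. -/
theorem layered_vec_self (l : ℕ) (i : Fin 2) {g : Fin 3 → ℤ} (hg : g ∈ loopSet l) :
    |(layered l).vec i i g 0 + (layered l).vec i i g 1 + (layered l).vec i i g 2| = 3 / 2 := by
  have : (layered l).vec i i g 0 + (layered l).vec i i g 1 + (layered l).vec i i g 2
      = 3 / 2 * g 2 := by
    simp only [VoltageGraph.vec_apply]
    simp [layered]
    ring
  rw [this, abs_mul, (abs_two_of_mem_loopSet hg).2]
  norm_num

theorem layered_vec_zero_one (l : ℕ) : (layered l).vec 0 1 0 = !₂[1, -1, 0] ∧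
    (layered l).vec 0 1 ![1, 0, 0] = !₂[0, 1, -1] ∧
    (layered l).vec 0 1 ![0, 1, 0] = !₂[-1, 0, 1] := by
  refine ⟨?_, ?_, ?_⟩ <;> ext m <;> rw [VoltageGraph.vec_apply] <;> fin_cases m <;>
    simp [layered] <;> norm_num

theorem layered_vec_one_zero (l : ℕ) : (layered l).vec 1 0 0 = !₂[-1, 1, 0] ∧
    (layered l).vec 1 0 ![-1, 0, 0] = !₂[0, -1, 1] ∧
    (layered l).vec 1 0 ![0, -1, 0] = !₂[1, 0, -1] := by
  refine ⟨?_, ?_, ?_⟩ <;> ext m <;> rw [VoltageGraph.vec_apply] <;> fin_cases m <;>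
    simp [layered] <;> norm_num

theorem layered_vec_of_ne {l : ℕ} {i j : Fin 2} (hij : i ≠ j) {g : Fin 3 → ℤ}
    (hg : g ∈ (layered l).S i j) :
    (layered l).vec i j g 0 + (layered l).vec i j g 1 + (layered l).vec i j g 2 = 0 ∧
    |(layered l).vec i j g 0| + |(layered l).vec i j g 1| + |(layered l).vec i j g 2| = 2 := by
  obtain ⟨a1, a2, a3⟩ := layered_vec_zero_one l
  obtain ⟨b1, b2, b3⟩ := layered_vec_one_zero l
  fin_cases i <;> fin_cases j
  · exact absurd rfl hij
  · simp [layered] at hg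
    rcases hg with rfl | rfl | rfl
    · simp [a1]; norm_num
    · simp [a2]; norm_num
    · simp [a3]; norm_num
  · simp [layered] at hg
    rcases hg with rfl | rfl | rfl
    · simp [b1]; norm_num
    · simp [b2]; norm_num
    · simp [b3]; norm_num
  · exact absurd rfl hij

theorem mem_loopSet_of_mem_layered {l : ℕ} {i : Fin 2} {g : Fin 3 → ℤ}
    (hg : g ∈ (layered l).S i i) : g ∈ loopSet l := by
  fin_cases i <;> exact hg

theorem norm_euclidean_three (a b c : ℝ) : ‖(!₂[a, b, c] : Space)‖ = √(a ^ 2 + b ^ 2 + c ^ 2) := by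
  rw [EuclideanSpace.norm_eq]
  simp [Fin.sum_univ_three]

/-- The three connecting edges have equal length and sum to zero, so every vertex is balanced. The
network serves twice: to bound the vertex count for odd degrees, and, for $l=1$, as a comparison
network of degree 5 with $L=3\sqrt2+\sqrt3<6$ and $V=9/2$. -/
theorem exists_layered_network {d l : ℕ} (hl : 1 ≤ l) (hd : d = 3 + 2 * l) :
    ∃ (M : PeriodicNetwork 3 d) (τ : Fin 2 → M.Vert), M.IsTransversal τ ∧ M.IsBalanced ∧
      (∀ i j, (M.volt (τ i) (τ j)).card = if i = j then 2 * l else 3) ∧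
      (l = 1 → M.length ^ 3 < 54 * M.spannedVolume) := by
  let f : Fin 2 → Space → ℝ := fun _ x =>
    if x 0 + x 1 + x 2 = 0 then (|x 0| + |x 1| + |x 2|) / 2 else |x 0 + x 1 + x 2| / (3 / 2)
  have hf : ∀ i, ∀ r : ℝ, 0 < r → ∀ x, f i (r • x) = r * f i x := by
    intro i r hr x
    simp only [f, PiLp.smul_apply, smul_eq_mul, ← mul_add, mul_eq_zero, hr.ne', false_or, abs_mul,
      abs_of_pos hr]
    split_ifs <;> ring
  have h1 : ∀ i j, ∀ g ∈ (layered l).S i j, f i ((layered l).vec i j g) = 1 := by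
    intro i j g hg
    simp only [f]
    by_cases hij : i = j
    · subst hij
      have := layered_vec_self l i (mem_loopSet_of_mem_layered hg)
      rw [if_neg, this]
      · norm_num
      · intro h0; rw [h0] at this; norm_num at this
    · obtain ⟨h2, h3⟩ := layered_vec_of_ne hij hg
      rw [if_pos h2, h3]; norm_num
  have hne : ∀ i j k, ∀ g ∈ (layered l).S i j, ∀ h ∈ (layered l).S i k, j ≠ k →
      (layered l).vec i j g ≠ (layered l).vec i k h := by
    intro i j k g hg h hh hjk e
    by_cases hij : i = j
    · subst hij
      have h2 := layered_vec_self l i (mem_loopSet_of_mem_layered hg)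
      rw [e, (layered_vec_of_ne hjk hh).1] at h2
      norm_num at h2
    · have hik : i = k := by omega
      subst hik
      have h2 := layered_vec_self l i (mem_loopSet_of_mem_layered hh)
      rw [← e, (layered_vec_of_ne hij hg).1] at h2
      norm_num at h2
  have hconn : (layered l).graph.Connected := by
    have r0 : (layered l).Reaches 0 1 0 := VoltageGraph.Reaches.of_mem (by simp [layered])
    have r1 : (layered l).Reaches 0 1 ![1, 0, 0] :=
      VoltageGraph.Reaches.of_mem (by simp [layered])
    have r2 : (layered l).Reaches 0 1 ![0, 1, 0] :=
      VoltageGraph.Reaches.of_mem (by simp [layered])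
    have r3 : (layered l).Reaches 0 0 ![0, 0, 1] :=
      VoltageGraph.Reaches.of_mem (mem_loopSet.2 ⟨0, by omega, Or.inl (by simp)⟩)
    refine VoltageGraph.connected_of_reaches 0 (fun q => ?_) (fun m => ?_)
    · fin_cases q
      · exact VoltageGraph.Reaches.refl _
      · exact r0
    · fin_cases m
      · convert r1.trans r0.symm using 1
        ext i; fin_cases i <;> simp
      · convert r2.trans r0.symm using 1
        ext i; fin_cases i <;> simp
      · convert r3 using 1
        ext i; fin_cases i <;> simp
  have hcard : ∀ i j, ((layered l).S i j).card = if i = j then 2 * l else 3 := by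
    intro i j
    fin_cases i <;> fin_cases j
    · exact card_loopSet l
    · rfl
    · rfl
    · exact card_loopSet l
  have hdeg : ∀ i, ∑ j, ((layered l).S i j).card = d := by
    intro i
    simp only [hcard, Fin.sum_univ_two]
    fin_cases i <;> simp <;> omega
  obtain ⟨a1, a2, a3⟩ := layered_vec_zero_one l
  obtain ⟨b1, b2, b3⟩ := layered_vec_one_zero l
  have hsum : ∀ {R : Type} [AddCommMonoid R] (F : (Fin 3 → ℤ) → R),
      ∑ g ∈ (layered l).S 0 1, F g = F 0 + (F ![1, 0, 0] + F ![0, 1, 0]) := by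
    intro R _ F
    change ∑ g ∈ {0, ![1, 0, 0], ![0, 1, 0]}, F g = _
    rw [Finset.sum_insert (by decide), Finset.sum_pair (by decide)]
  have hsum' : ∀ {R : Type} [AddCommMonoid R] (F : (Fin 3 → ℤ) → R),
      ∑ g ∈ (layered l).S 1 0, F g = F 0 + (F ![-1, 0, 0] + F ![0, -1, 0]) := by
    intro R _ F
    change ∑ g ∈ {0, ![-1, 0, 0], ![0, -1, 0]}, F g = _
    rw [Finset.sum_insert (by decide), Finset.sum_pair (by decide)]
  refine ⟨(layered l).network (by omega) hconn hdeg
    (VoltageGraph.vec_ne_zero_of_homogeneous f hf h1)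
    (VoltageGraph.starEmbedded_of_homogeneous f hf h1 hne), _,
    VoltageGraph.isTransversal_origin, ?_, ?_, ?_⟩
  · refine VoltageGraph.isBalanced_network (Fin.forall_fin_two.2 ⟨?_, ?_⟩)
    · rw [Fin.sum_univ_two, VoltageGraph.sum_loops_eq_zero, hsum, a1, a2, a3]
      simp only [norm_euclidean_three]
      ext m
      fin_cases m <;> simp
    · rw [Fin.sum_univ_two, VoltageGraph.sum_loops_eq_zero, hsum', b1, b2, b3]
      simp only [norm_euclidean_three]
      ext m
      fin_cases m <;> simp
  · intro i j
    rw [VoltageGraph.card_volt_network, hcard]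
  · rintro rfl
    have hL := VoltageGraph.two_mul_length_network (X := layered 1) (hd := by omega)
      (hconn := hconn) (hdeg := hdeg) (hvec := VoltageGraph.vec_ne_zero_of_homogeneous f hf h1)
      (hstar := VoltageGraph.starEmbedded_of_homogeneous f hf h1 hne)
    rw [VoltageGraph.spannedVolume_network]
    have hloop : ∀ i : Fin 2, ∑ g ∈ (layered 1).S i i, ‖(layered 1).vec i i g‖ = √3 := by
      intro i
      have e1 : (layered 1).S i i = {![0, 0, 1], ![0, 0, -1]} := by
        fin_cases i <;> rfl
      have v1 : (layered 1).vec i i ![0, 0, 1] = !₂[1 / 2, 1 / 2, 1 / 2] := by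
        ext m; rw [VoltageGraph.vec_apply]; fin_cases m <;> simp [layered]
      have v2 : (layered 1).vec i i ![0, 0, -1] = !₂[-1 / 2, -1 / 2, -1 / 2] := by
        ext m; rw [VoltageGraph.vec_apply]; fin_cases m <;> simp [layered] <;> ring
      rw [e1, Finset.sum_pair (by decide), v1, v2, norm_euclidean_three, norm_euclidean_three]
      have : √((1 / 2) ^ 2 + (1 / 2) ^ 2 + (1 / 2) ^ 2 : ℝ) = √3 / 2 := by
        rw [show ((1 / 2) ^ 2 + (1 / 2) ^ 2 + (1 / 2) ^ 2 : ℝ) = 3 / 2 ^ 2 by norm_num,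
          Real.sqrt_div (by norm_num), Real.sqrt_sq (by norm_num)]
      rw [show ((-1 / 2) ^ 2 + (-1 / 2) ^ 2 + (-1 / 2) ^ 2 : ℝ)
        = (1 / 2) ^ 2 + (1 / 2) ^ 2 + (1 / 2) ^ 2 by norm_num, this]
      ring
    simp only [Fin.sum_univ_two, hloop, hsum, hsum', a1, a2, a3, b1, b2, b3,
      norm_euclidean_three] at hL
    norm_num at hL
    have hdet : |det₃ ((layered 1).e 0) ((layered 1).e 1) ((layered 1).e 2)| = 9 / 2 := by
      have : det₃ ((layered 1).e 0) ((layered 1).e 1) ((layered 1).e 2) = 9 / 2 := by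
        simp [layered, det₃]; norm_num
      rw [this]; norm_num
    rw [hdet]
    have s3 : √3 ≤ 1.733 := Real.sqrt_le_iff.2 ⟨by norm_num, by norm_num⟩
    have s2 : √2 ≤ 1.415 := Real.sqrt_le_iff.2 ⟨by norm_num, by norm_num⟩
    generalize ((layered 1).network _ _ _ _ _).length = L at hL ⊢
    have hL0 : 0 ≤ L := by linarith [Real.sqrt_nonneg 3, Real.sqrt_nonneg 2]
    have hL1 : L ≤ 6 := by linarith
    calc L ^ 3 ≤ 6 ^ 3 := by gcongr
      _ < _ := by norm_num

/-! ### A comparison network of degree 5 with five parallel edges. -/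

/-- The two-vertex network of square pyramids: five parallel edges. -/
noncomputable def pyramidal : VoltageGraph (Fin 2) where
  S := ![![∅, {0, ![1, 0, 0], ![0, 1, 0], ![0, 0, 1], ![1, -1, 1]}],
    ![{0, ![-1, 0, 0], ![0, -1, 0], ![0, 0, -1], ![-1, 1, -1]}, ∅]]
  neg_mem i j g h := by
    fin_cases i <;> fin_cases j
    · simp at h
    · simp at h ⊢
      rcases h with rfl | rfl | rfl | rfl | rfl <;> simp
    · simp at h ⊢
      rcases h with rfl | rfl | rfl | rfl | rfl <;> simp
    · simp at h
  zero_notMem i h := by fin_cases i <;> simp at h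
  e := ![!₂[4, 0, -7], !₂[0, 4, -7], !₂[-4, 0, -7]]
  det_ne := by simp [det₃]; norm_num
  p := ![0, !₂[0, 0, 6]]

theorem pyramidal_vec : pyramidal.vec 0 1 0 = !₂[0, 0, 6] ∧
    pyramidal.vec 0 1 ![1, 0, 0] = !₂[4, 0, -1] ∧ pyramidal.vec 0 1 ![0, 1, 0] = !₂[0, 4, -1] ∧
    pyramidal.vec 0 1 ![0, 0, 1] = !₂[-4, 0, -1] ∧
    pyramidal.vec 0 1 ![1, -1, 1] = !₂[0, -4, -1] := by
  refine ⟨?_, ?_, ?_, ?_, ?_⟩ <;> ext m <;> rw [VoltageGraph.vec_apply] <;> fin_cases m <;>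
    simp [pyramidal] <;> norm_num

theorem mem_pyramidal {g : Fin 3 → ℤ} : g ∈ pyramidal.S 0 1 ↔ g = 0 ∨ g = ![1, 0, 0] ∨
    g = ![0, 1, 0] ∨ g = ![0, 0, 1] ∨ g = ![1, -1, 1] := by
  simp [pyramidal]

/-- Integer coordinates give $L=6+4\sqrt{17}<22.5$ and $V=224$. The network is not balanced, since
$4/\sqrt{17}\ne1$, but only its quotient graph and length quotient matter. -/
theorem exists_pyramidal_network :
    ∃ (M : PeriodicNetwork 3 5) (τ : Fin 2 → M.Vert), M.IsTransversal τ ∧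
      (∀ i j, (M.volt (τ i) (τ j)).card = if i = j then 0 else 5) ∧
      M.length ^ 3 < 54 * M.spannedVolume := by
  obtain ⟨a1, a2, a3, a4, a5⟩ := pyramidal_vec
  -- Four edges at the first vertex descend by 1 and the fifth rises by 6; at the second vertex
  -- everything is reversed.
  let f₀ : Space → ℝ := fun x => if x 2 < 0 then -x 2 else x 2 / 6
  let f : Fin 2 → Space → ℝ := ![f₀, fun x => f₀ (-x)]
  have hf₀ : ∀ r : ℝ, 0 < r → ∀ x, f₀ (r • x) = r * f₀ x := by
    intro r hr x
    simp only [f₀, PiLp.smul_apply, smul_eq_mul, mul_neg_iff, hr, hr.not_gt, true_and, false_and,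
      or_false]
    split_ifs <;> ring
  have hf : ∀ i, ∀ r : ℝ, 0 < r → ∀ x, f i (r • x) = r * f i x := by
    intro i r hr x
    fin_cases i
    · exact hf₀ r hr x
    · change f₀ (-(r • x)) = r * f₀ (-x)
      rw [← smul_neg, hf₀ r hr]
  have h01 : ∀ g ∈ pyramidal.S 0 1, f₀ (pyramidal.vec 0 1 g) = 1 := by
    intro g hg
    rcases mem_pyramidal.1 hg with rfl | rfl | rfl | rfl | rfl
    · rw [a1]; simp [f₀]
    · rw [a2]; simp [f₀]
    · rw [a3]; simp [f₀]
    · rw [a4]; simp [f₀]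
    · rw [a5]; simp [f₀]
  have hempty : ∀ i, pyramidal.S i i = ∅ := by intro i; fin_cases i <;> rfl
  have h1 : ∀ i j, ∀ g ∈ pyramidal.S i j, f i (pyramidal.vec i j g) = 1 := by
    refine Fin.forall_fin_two.2 ⟨Fin.forall_fin_two.2 ⟨?_, h01⟩, Fin.forall_fin_two.2 ⟨?_, ?_⟩⟩
    · intro g hg; simp [hempty] at hg
    · intro g hg
      have := h01 (-g) (pyramidal.neg_mem _ _ _ hg)
      rwa [VoltageGraph.vec_neg] at this
    · intro g hg; simp [hempty] at hg
  have hne : ∀ i j k, ∀ g ∈ pyramidal.S i j, ∀ h ∈ pyramidal.S i k, j ≠ k →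
      pyramidal.vec i j g ≠ pyramidal.vec i k h := by
    intro i j k g hg h hh hjk
    by_cases hij : i = j
    · rw [← hij, hempty] at hg; simp at hg
    · have hik : i = k := by omega
      rw [← hik, hempty] at hh; simp at hh
  have hconn : pyramidal.graph.Connected := by
    have r0 : pyramidal.Reaches 0 1 0 := .of_mem (mem_pyramidal.2 (by simp))
    have r1 : pyramidal.Reaches 0 1 ![1, 0, 0] := .of_mem (mem_pyramidal.2 (by simp))
    have r2 : pyramidal.Reaches 0 1 ![0, 1, 0] := .of_mem (mem_pyramidal.2 (by simp))
    have r3 : pyramidal.Reaches 0 1 ![0, 0, 1] := .of_mem (mem_pyramidal.2 (by simp))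
    refine VoltageGraph.connected_of_reaches 0 (fun q => ?_) (fun m => ?_)
    · fin_cases q
      · exact VoltageGraph.Reaches.refl _
      · exact r0
    · fin_cases m
      · convert r1.trans r0.symm using 1
        ext i; fin_cases i <;> simp
      · convert r2.trans r0.symm using 1
        ext i; fin_cases i <;> simp
      · convert r3.trans r0.symm using 1
        ext i; fin_cases i <;> simp
  have hcard : ∀ i j, (pyramidal.S i j).card = if i = j then 0 else 5 := by
    intro i j
    fin_cases i <;> fin_cases j <;> rfl
  have hdeg : ∀ i, ∑ j, (pyramidal.S i j).card = 5 := by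
    intro i
    simp only [hcard, Fin.sum_univ_two]
    fin_cases i <;> simp
  have hsum : ∑ g ∈ pyramidal.S 0 1, ‖pyramidal.vec 0 1 g‖ = 6 + 4 * √17 := by
    change ∑ g ∈ {0, ![1, 0, 0], ![0, 1, 0], ![0, 0, 1], ![1, -1, 1]}, _ = _
    rw [Finset.sum_insert (by decide), Finset.sum_insert (by decide), Finset.sum_insert (by decide),
      Finset.sum_pair (by decide), a1, a2, a3, a4, a5]
    simp only [norm_euclidean_three]
    rw [show (0 ^ 2 + 0 ^ 2 + 6 ^ 2 : ℝ) = 6 ^ 2 by norm_num, Real.sqrt_sq (by norm_num)]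
    norm_num
    ring
  refine ⟨pyramidal.network (by omega) hconn hdeg
    (VoltageGraph.vec_ne_zero_of_homogeneous f hf h1)
    (VoltageGraph.starEmbedded_of_homogeneous f hf h1 hne), _,
    VoltageGraph.isTransversal_origin, ?_, ?_⟩
  · intro i j
    rw [VoltageGraph.card_volt_network, hcard]
  · have hL := (VoltageGraph.isTransversal_origin (X := pyramidal) (hd := by omega)
      (hconn := hconn) (hdeg := hdeg) (hvec := VoltageGraph.vec_ne_zero_of_homogeneous f hf h1)
      (hstar := VoltageGraph.starEmbedded_of_homogeneous f hf h1 hne)).length_of_two_vertices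
    simp only [VoltageGraph.vec_network] at hL
    rw [VoltageGraph.sum_volt_network 0 1 (fun g => ‖pyramidal.vec 0 1 g‖), hsum,
      Finset.card_eq_zero.1 ((VoltageGraph.card_volt_network 0 0).trans (hcard 0 0)),
      Finset.card_eq_zero.1 ((VoltageGraph.card_volt_network 1 1).trans (hcard 1 1))] at hL
    rw [VoltageGraph.spannedVolume_network]
    have hdet : |det₃ (pyramidal.e 0) (pyramidal.e 1) (pyramidal.e 2)| = 224 := by
      have : det₃ (pyramidal.e 0) (pyramidal.e 1) (pyramidal.e 2) = -224 := by
        simp [pyramidal, det₃]; norm_num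
      rw [this]; norm_num
    rw [hdet]
    have s17 : √17 ≤ 4.124 := Real.sqrt_le_iff.2 ⟨by norm_num, by norm_num⟩
    generalize (pyramidal.network _ _ _ _ _).length = L at hL ⊢
    simp only [Finset.sum_empty, zero_add] at hL
    have hL0 : 0 ≤ L := by linarith [Real.sqrt_nonneg 17]
    have hL1 : L ≤ 22.5 := by linarith
    calc L ^ 3 ≤ 22.5 ^ 3 := by gcongr
      _ < _ := by norm_num

/-! ### Balanced networks of degrees 4 and 3, used only for their vertex counts. -/

/-- The two-vertex network of degree four consisting of straight lines in three directions. -/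
noncomputable def linear : VoltageGraph (Fin 2) where
  S := ![![{![0, 1, 0], ![0, -1, 0]}, {0, ![1, 0, 0]}],
    ![{0, ![-1, 0, 0]}, {![0, 0, 1], ![0, 0, -1]}]]
  neg_mem i j g h := by
    fin_cases i <;> fin_cases j <;> simp at h ⊢ <;> rcases h with rfl | rfl <;> simp
  zero_notMem i h := by
    fin_cases i
    · have h : 0 ∈ ({![0, 1, 0], ![0, -1, 0]} : Finset (Fin 3 → ℤ)) := h
      revert h; decide
    · have h : 0 ∈ ({![0, 0, 1], ![0, 0, -1]} : Finset (Fin 3 → ℤ)) := h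
      revert h; decide
  e := ![!₂[2, 0, 0], !₂[0, 1, 0], !₂[0, 0, 1]]
  det_ne := by simp [det₃]
  p := ![0, !₂[-1, 0, 0]]

theorem linear_S : linear.S 0 0 = {![0, 1, 0], ![0, -1, 0]} ∧ linear.S 0 1 = {0, ![1, 0, 0]} ∧
    linear.S 1 0 = {0, ![-1, 0, 0]} ∧ linear.S 1 1 = {![0, 0, 1], ![0, 0, -1]} :=
  ⟨rfl, rfl, rfl, rfl⟩

theorem linear_vec : linear.vec 0 0 ![0, 1, 0] = !₂[0, 1, 0] ∧
    linear.vec 0 0 ![0, -1, 0] = !₂[0, -1, 0] ∧ linear.vec 0 1 0 = !₂[-1, 0, 0] ∧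
    linear.vec 0 1 ![1, 0, 0] = !₂[1, 0, 0] ∧ linear.vec 1 0 0 = !₂[1, 0, 0] ∧
    linear.vec 1 0 ![-1, 0, 0] = !₂[-1, 0, 0] ∧ linear.vec 1 1 ![0, 0, 1] = !₂[0, 0, 1] ∧
    linear.vec 1 1 ![0, 0, -1] = !₂[0, 0, -1] := by
  refine ⟨?_, ?_, ?_, ?_, ?_, ?_, ?_, ?_⟩ <;> ext m <;> rw [VoltageGraph.vec_apply] <;>
    fin_cases m <;> simp [linear] <;> norm_num

theorem exists_isBalanced_four :
    ∃ M : PeriodicNetwork 3 4, M.IsBalanced ∧ M.vertexCount = 2 := by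
  obtain ⟨S1, S2, S3, S4⟩ := linear_S
  obtain ⟨a1, a2, a3, a4, a5, a6, a7, a8⟩ := linear_vec
  let f : Fin 2 → Space → ℝ := fun _ x => |x 0| + |x 1| + |x 2|
  have hf : ∀ i, ∀ r : ℝ, 0 < r → ∀ x, f i (r • x) = r * f i x := by
    intro i r hr x
    simp only [f, PiLp.smul_apply, smul_eq_mul, abs_mul, abs_of_pos hr]
    ring
  have h1 : ∀ i j, ∀ g ∈ linear.S i j, f i (linear.vec i j g) = 1 := by
    refine Fin.forall_fin_two.2 ⟨Fin.forall_fin_two.2 ⟨?_, ?_⟩, Fin.forall_fin_two.2 ⟨?_, ?_⟩⟩ <;>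
      simp [S1, S2, S3, S4, a1, a2, a3, a4, a5, a6, a7, a8, f]
  have hne : ∀ i j k, ∀ g ∈ linear.S i j, ∀ h ∈ linear.S i k, j ≠ k →
      linear.vec i j g ≠ linear.vec i k h := by
    have key : ∀ i j, ∀ g ∈ linear.S i j, (linear.vec i j g 0 = 0 ↔ i = j) := by
      refine Fin.forall_fin_two.2 ⟨Fin.forall_fin_two.2 ⟨?_, ?_⟩, Fin.forall_fin_two.2 ⟨?_, ?_⟩⟩ <;>
        simp [S1, S2, S3, S4, a1, a2, a3, a4, a5, a6, a7, a8]
    intro i j k g hg h hh hjk e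
    have k1 := key i j g hg
    rw [e, key i k h hh] at k1
    omega
  have hconn : linear.graph.Connected := by
    have r0 : linear.Reaches 0 1 0 := .of_mem (by simp [S2])
    have r1 : linear.Reaches 0 1 ![1, 0, 0] := .of_mem (by simp [S2])
    have r2 : linear.Reaches 0 0 ![0, 1, 0] := .of_mem (by simp [S1])
    have r3 : linear.Reaches 1 1 ![0, 0, 1] := .of_mem (by simp [S4])
    refine VoltageGraph.connected_of_reaches 0 (fun q => ?_) (fun m => ?_)
    · fin_cases q
      · exact VoltageGraph.Reaches.refl _
      · exact r0
    · fin_cases m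
      · convert r1.trans r0.symm using 1
        ext i; fin_cases i <;> simp
      · convert r2 using 1
        ext i; fin_cases i <;> simp
      · convert (r0.trans r3).trans r0.symm using 1
        ext i; fin_cases i <;> simp
  have hdeg : ∀ i, ∑ j, (linear.S i j).card = 4 := by
    intro i; fin_cases i <;> rfl
  refine ⟨linear.network (by omega) hconn hdeg
    (VoltageGraph.vec_ne_zero_of_homogeneous f hf h1)
    (VoltageGraph.starEmbedded_of_homogeneous f hf h1 hne), ?_, ?_⟩
  · refine VoltageGraph.isBalanced_network (Fin.forall_fin_two.2 ⟨?_, ?_⟩)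
    · rw [Fin.sum_univ_two, VoltageGraph.sum_loops_eq_zero, S2, Finset.sum_pair (by decide), a3, a4]
      simp only [norm_euclidean_three]
      ext m
      fin_cases m <;> simp
    · rw [Fin.sum_univ_two, VoltageGraph.sum_loops_eq_zero, S3, Finset.sum_pair (by decide), a5, a6]
      simp only [norm_euclidean_three]
      ext m
      fin_cases m <;> simp
  · rw [VoltageGraph.vertexCount_network, Fintype.card_fin]

/-- The voltages of the srs network, whose quotient is the complete graph on four vertices. -/
def srsVoltage : Fin 4 → Fin 4 → Fin 3 → ℤ :=
  ![![0, 0, 0, 0], ![0, 0, ![1, 0, 0], ![0, 1, 0]], ![0, ![-1, 0, 0], 0, ![0, 0, 1]],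
    ![0, ![0, -1, 0], ![0, 0, -1], 0]]

/-- The srs network. -/
noncomputable def srs : VoltageGraph (Fin 4) where
  S i j := if i = j then ∅ else {srsVoltage i j}
  neg_mem i j g h := by
    fin_cases i <;> fin_cases j <;> simp [srsVoltage] at h ⊢ <;> simp [h]
  zero_notMem i h := by simp at h
  e := ![!₂[2, 2, -2], !₂[-2, 2, -2], !₂[-2, 2, 2]]
  det_ne := by simp [det₃]; norm_num
  p := ![0, !₂[0, 1, -1], !₂[-1, 0, 1], !₂[1, -1, 0]]

/-- The edge vectors of the srs network. -/
noncomputable def srsVec : Fin 4 → Fin 4 → Space :=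
  ![![0, !₂[0, 1, -1], !₂[-1, 0, 1], !₂[1, -1, 0]],
    ![!₂[0, -1, 1], 0, !₂[1, 1, 0], !₂[-1, 0, -1]],
    ![!₂[1, 0, -1], !₂[-1, -1, 0], 0, !₂[0, 1, 1]],
    ![!₂[-1, 1, 0], !₂[1, 0, 1], !₂[0, -1, -1], 0]]

theorem srs_vec (i j : Fin 4) : srs.vec i j (srsVoltage i j) = srsVec i j := by
  ext m
  rw [VoltageGraph.vec_apply]
  fin_cases i <;> fin_cases j <;> fin_cases m <;> simp [srs, srsVoltage, srsVec] <;> norm_num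

theorem mem_srs {i j : Fin 4} {g : Fin 3 → ℤ} :
    g ∈ srs.S i j ↔ i ≠ j ∧ g = srsVoltage i j := by
  simp only [srs]
  split_ifs with h <;> simp [h]

theorem exists_isBalanced_three :
    ∃ M : PeriodicNetwork 3 3, M.IsBalanced ∧ M.vertexCount = 4 := by
  let f : Fin 4 → Space → ℝ := fun _ x => (|x 0| + |x 1| + |x 2|) / 2
  have hf : ∀ i, ∀ r : ℝ, 0 < r → ∀ x, f i (r • x) = r * f i x := by
    intro i r hr x
    simp only [f, PiLp.smul_apply, smul_eq_mul, abs_mul, abs_of_pos hr]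
    ring
  have h1 : ∀ i j, ∀ g ∈ srs.S i j, f i (srs.vec i j g) = 1 := by
    intro i j g hg
    obtain ⟨hij, rfl⟩ := mem_srs.1 hg
    rw [srs_vec]
    fin_cases i <;> fin_cases j <;> simp [srsVec, f] at hij ⊢
  have hne : ∀ i j k, ∀ g ∈ srs.S i j, ∀ h ∈ srs.S i k, j ≠ k →
      srs.vec i j g ≠ srs.vec i k h := by
    intro i j k g hg h hh hjk e
    obtain ⟨hij, rfl⟩ := mem_srs.1 hg
    obtain ⟨hik, rfl⟩ := mem_srs.1 hh
    rw [srs_vec, srs_vec] at e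
    have e0 := congrArg (fun x : Space => x 0) e
    have e1 := congrArg (fun x : Space => x 1) e
    clear e hg hh
    fin_cases i <;> fin_cases j <;> fin_cases k <;> simp [srsVec] at hij hik hjk e0 e1
  have hconn : srs.graph.Connected := by
    have r : ∀ i j, i ≠ j → srs.Reaches i j (srsVoltage i j) :=
      fun i j h => .of_mem (mem_srs.2 ⟨h, rfl⟩)
    refine VoltageGraph.connected_of_reaches 0 (fun q => ?_) (fun m => ?_)
    · fin_cases q
      · exact VoltageGraph.Reaches.refl _
      · exact r 0 1 (by decide)
      · exact r 0 2 (by decide)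
      · exact r 0 3 (by decide)
    · fin_cases m
      -- The edges at vertex 0 carry voltage zero and form a spanning tree; each triangle through 0
      -- therefore picks up exactly one generator.
      · convert ((r 0 1 (by decide)).trans (r 1 2 (by decide))).trans (r 2 0 (by decide)) using 1
        ext i; fin_cases i <;> simp [srsVoltage]
      · convert ((r 0 1 (by decide)).trans (r 1 3 (by decide))).trans (r 3 0 (by decide)) using 1
        ext i; fin_cases i <;> simp [srsVoltage]
      · convert ((r 0 2 (by decide)).trans (r 2 3 (by decide))).trans (r 3 0 (by decide)) using 1
        ext i; fin_cases i <;> simp [srsVoltage]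
  have hdeg : ∀ i, ∑ j, (srs.S i j).card = 3 := by
    intro i; fin_cases i <;> rfl
  refine ⟨srs.network le_rfl hconn hdeg
    (VoltageGraph.vec_ne_zero_of_homogeneous f hf h1)
    (VoltageGraph.starEmbedded_of_homogeneous f hf h1 hne), ?_, ?_⟩
  · refine VoltageGraph.isBalanced_network fun i => ?_
    have hterm : ∀ j, ∑ g ∈ srs.S i j, ‖srs.vec i j g‖⁻¹ • srs.vec i j g =
        (√2)⁻¹ • srsVec i j := by
      intro j
      by_cases hij : i = j
      · have h0 : srs.S i j = ∅ := by simp [srs, hij]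
        rw [h0, Finset.sum_empty, hij]
        fin_cases j <;> simp [srsVec]
      · have h0 : srs.S i j = {srsVoltage i j} := by simp [srs, hij]
        rw [h0, Finset.sum_singleton, srs_vec]
        congr 2
        fin_cases i <;> fin_cases j <;> simp [srsVec, norm_euclidean_three] at hij ⊢ <;> norm_num
    simp only [hterm]
    rw [← Finset.smul_sum, Fin.sum_univ_four]
    have : srsVec i 0 + srsVec i 1 + srsVec i 2 + srsVec i 3 = 0 := by
      ext m
      fin_cases i <;> fin_cases m <;> simp [srsVec]
    rw [this, smul_zero]
  · rw [VoltageGraph.vertexCount_network, Fintype.card_fin]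

/-! ### Spanning trees and lattice bases. -/

namespace PeriodicNetwork

variable {d : ℕ} {N : PeriodicNetwork 3 d}

/-- Partial transversals forming a tree can be extended until they meet every orbit. -/
theorem exists_partial_tree (N : PeriodicNetwork 3 d) (m : ℕ) (hm : m < N.vertexCount) :
    ∃ σ : ℕ → N.Vert,
      (∀ i ≤ m, ∀ j ≤ m, (Quotient.mk _ (σ i) : N.QuotVert) = Quotient.mk _ (σ j) → i = j) ∧
      ∀ i ≤ m, 0 < i → ∃ j < i, N.graph.Adj (σ j) (σ i) := by
  induction m with
  | zero =>
    obtain ⟨v⟩ := N.connected.nonempty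
    exact ⟨fun _ => v, fun i hi j hj _ => by omega, fun i hi h => by omega⟩
  | succ m ih =>
    obtain ⟨σ, h1, h2⟩ := ih (by omega)
    let R : Set N.Vert := {v | ∃ i ≤ m, (Quotient.mk _ (σ i) : N.QuotVert) = Quotient.mk _ v}
    obtain ⟨v, hv⟩ : ∃ v, v ∉ R := by
      by_contra! h
      have hs : Function.Surjective
          (fun i : Fin (m + 1) => (Quotient.mk _ (σ i) : N.QuotVert)) := by
        intro z
        induction z using Quotient.inductionOn with
        | _ v =>
          obtain ⟨i, hi, e⟩ := h v
          exact ⟨⟨i, by omega⟩, e⟩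
      have := Nat.card_le_card_of_surjective _ hs
      rw [Nat.card_fin] at this
      have h' : N.vertexCount ≤ m + 1 := this
      omega
    obtain ⟨p⟩ := N.connected.preconnected (σ 0) v
    -- A path to an unvisited orbit contains an edge leaving the visited ones; translated to start
    -- at the tree, it provides the next vertex.
    obtain ⟨x, -, ⟨i, hi, e⟩, hx⟩ := p.exists_boundary_dart R ⟨0, by omega, rfl⟩ hv
    obtain ⟨g, hg⟩ := N.quot_mk_eq_iff.1 e
    have hadj : N.graph.Adj (σ i) (g +ᵥ x.snd) := by
      rw [← hg]
      exact N.vadd_adj g _ _ x.adj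
    have hnew : ∀ j ≤ m, (Quotient.mk _ (σ j) : N.QuotVert) ≠ Quotient.mk _ (g +ᵥ x.snd) := by
      intro j hj e'
      rw [quot_mk_vadd] at e'
      exact hx ⟨j, hj, e'⟩
    have hold : ∀ j ≤ m, Function.update σ (m + 1) (g +ᵥ x.snd) j = σ j :=
      fun j hj => Function.update_of_ne (by omega) _ _
    have hlast : Function.update σ (m + 1) (g +ᵥ x.snd) (m + 1) = g +ᵥ x.snd :=
      Function.update_self _ _ _
    refine ⟨Function.update σ (m + 1) (g +ᵥ x.snd), ?_, ?_⟩
    · intro a ha b hb e'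
      rcases Nat.lt_or_ge m a with ha' | ha' <;> rcases Nat.lt_or_ge m b with hb' | hb'
      · omega
      · obtain rfl : a = m + 1 := by omega
        rw [hlast, hold b hb'] at e'
        exact absurd e'.symm (hnew b hb')
      · obtain rfl : b = m + 1 := by omega
        rw [hlast, hold a ha'] at e'
        exact absurd e' (hnew a ha')
      · rw [hold a ha', hold b hb'] at e'
        exact h1 a ha' b hb' e'
    · intro a ha h0
      rcases Nat.lt_or_ge m a with ha' | ha'
      · obtain rfl : a = m + 1 := by omega
        exact ⟨i, by omega, by rw [hlast, hold i hi]; exact hadj⟩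
      · obtain ⟨j, hj, h⟩ := h2 a ha' h0
        exact ⟨j, hj, by rw [hold a ha', hold j (by omega)]; exact h⟩

theorem vertexCount_pos (N : PeriodicNetwork 3 d) : 0 < N.vertexCount := by
  obtain ⟨v⟩ := N.connected.nonempty
  have : Nonempty N.QuotVert := ⟨Quotient.mk _ v⟩
  exact Nat.card_pos

/-- There is a transversal which spans a subtree of the network. -/
theorem exists_tree_transversal (N : PeriodicNetwork 3 d) :
    ∃ (σ : Fin N.vertexCount → N.Vert) (par : Fin N.vertexCount → Fin N.vertexCount),
      N.IsTransversal σ ∧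
      ∀ i : Fin N.vertexCount, 0 < i.1 → par i < i ∧ N.graph.Adj (σ (par i)) (σ i) := by
  have hpos := N.vertexCount_pos
  obtain ⟨σ, h1, h2⟩ := N.exists_partial_tree (N.vertexCount - 1) (by omega)
  have h3 : ∀ i : Fin N.vertexCount, ∃ j : Fin N.vertexCount,
      0 < i.1 → j < i ∧ N.graph.Adj (σ j) (σ i) := by
    intro i
    by_cases hi : 0 < i.1
    · obtain ⟨j, hj, h⟩ := h2 i (by omega) hi
      exact ⟨⟨j, by omega⟩, fun _ => ⟨hj, h⟩⟩
    · exact ⟨i, fun h => absurd h hi⟩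
  choose par hpar using h3
  refine ⟨fun i => σ i, par, ?_, hpar⟩
  have hinj : Function.Injective
      (fun i : Fin N.vertexCount => (Quotient.mk _ (σ i) : N.QuotVert)) :=
    fun i j e => Fin.ext (h1 i (by omega) j (by omega) e)
  exact hinj.bijective_of_nat_card_le (by rw [Nat.card_fin]; exact le_rfl)

/-- The voltages off a spanning tree generate the lattice. If there are only three of them, they
form a basis. -/
theorem exists_tree_basis (N : PeriodicNetwork 3 d) :
    ∃ (σ : Fin N.vertexCount → N.Vert), N.IsTransversal σ ∧
      N.vertexCount + 2 ≤ Fintype.card N.QuotEdge ∧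
      (Fintype.card N.QuotEdge = N.vertexCount + 2 → ∃ b : Module.Basis (Fin 3) ℤ N.lattice,
        (∀ i j, ∀ g ∈ N.volt (σ i) (σ j), g = 0 ∨ ∃ m, g = b m ∨ g = -b m) ∧
        ∀ m i j i' j', b m ∈ N.volt (σ i) (σ j) → b m ∈ N.volt (σ i') (σ j') →
          i = i' ∧ j = j') := by
  classical
  obtain ⟨σ, par, hσ, hpar⟩ := N.exists_tree_transversal
  have hpos := N.vertexCount_pos
  refine ⟨σ, hσ, ?_⟩
  have hzero : ∀ i : Fin N.vertexCount, 0 < i.1 → (0 : N.lattice) ∈ N.volt (σ (par i)) (σ i) :=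
    fun i hi => N.mem_volt.2 (by rw [zero_vadd]; exact (hpar i hi).2)
  let I := {i : Fin N.vertexCount // 0 < i.1}
  let t : I → N.QuotEdge := fun i => Dart.edge (⟨par i.1, i.1, 0, hzero i.1 i.2⟩ : Dart σ)
  -- Two tree edges agreeing with opposite orientation would make each end point the parent of the
  -- other, although parents have smaller indices.
  have ht : Function.Injective t := by
    intro i j e
    rcases (hσ.edge_eq_iff _ _).1 e with h | h
    · exact Subtype.ext (Dart.ext_iff'.1 h).2.1
    · exfalso
      obtain ⟨h3, h4, -⟩ := Dart.ext_iff'.1 h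
      simp only [Dart.rev] at h3 h4
      have h5 := (hpar i.1 i.2).1
      have h6 := (hpar j.1 j.2).1
      rw [h3] at h5
      rw [← h4] at h6
      exact lt_asymm h5 h6
  have hI : Fintype.card I + 1 = N.vertexCount := by
    have : Fintype.card I = N.vertexCount - 1 := by
      obtain ⟨k, hk⟩ : ∃ k, N.vertexCount = k + 1 := ⟨N.vertexCount - 1, by omega⟩
      rw [Fintype.card_subtype]
      have h2 : (Finset.univ.filter fun i : Fin N.vertexCount => 0 < i.1) =
          Finset.univ.erase ⟨0, hpos⟩ := by
        ext i
        simp [Fin.ext_iff, Nat.pos_iff_ne_zero]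
      rw [h2, Finset.card_erase_of_mem (Finset.mem_univ _), Finset.card_fin]
    omega
  let B := {e : N.QuotEdge // e ∉ Set.range t}
  -- The set `B` of edges off the tree has as many elements as the first Betti number.
  have hB : Fintype.card B + N.vertexCount = Fintype.card N.QuotEdge + 1 := by
    have h1 : Fintype.card B = Fintype.card N.QuotEdge - Fintype.card I := by
      rw [← Set.card_range_of_injective ht]
      exact Fintype.card_subtype_compl _
    have h2 := Fintype.card_le_of_injective t ht
    omega
  choose x hx using hσ.edge_surjective
  let v : B → N.lattice := fun e => (x e.1).2.2.1
  have hvolt : ∀ y : Dart σ, y.2.2.1 = 0 ∨ ∃ e : B, y.edge = e.1 ∧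
      (y = x e.1 ∨ y = (x e.1).rev) := by
    intro y
    by_cases hy : y.edge ∈ Set.range t
    · left
      obtain ⟨i, hi⟩ := hy
      rcases (hσ.edge_eq_iff _ _).1 hi.symm with h | h
      · rw [h]
      · rw [h]; simp [Dart.rev]
    · right
      refine ⟨⟨y.edge, hy⟩, rfl, (hσ.edge_eq_iff _ _).1 ?_⟩
      rw [hx]
  have hvolt' : ∀ y : Dart σ, y.2.2.1 = 0 ∨ ∃ e : B, y.2.2.1 = v e ∨ y.2.2.1 = -v e := by
    intro y
    rcases hvolt y with h | ⟨e, -, h | h⟩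
    · exact Or.inl h
    · exact Or.inr ⟨e, Or.inl (by rw [h])⟩
    · exact Or.inr ⟨e, Or.inr (by rw [h]; rfl)⟩
  have hspan : ⊤ ≤ Submodule.span ℤ (Set.range v) := by
    intro g _
    have := hσ.lattice_le ((Submodule.span ℤ (Set.range v)).map N.lattice.subtype).toAddSubgroup
      (fun _ => 0) (by
        intro i j g hg
        rw [add_zero, sub_zero]
        refine ⟨g, ?_, rfl⟩
        rcases hvolt' ⟨i, j, g, hg⟩ with h | ⟨e, h | h⟩
        · simp only at h
          rw [h]; exact zero_mem _
        · simp only at h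
          rw [h]; exact Submodule.subset_span ⟨e, rfl⟩
        · simp only at h
          rw [h]; exact neg_mem (Submodule.subset_span ⟨e, rfl⟩)) g
    obtain ⟨g', hg', e⟩ := this
    rwa [← Subtype.ext e]
  have hspanR : ⊤ ≤ Submodule.span ℝ (Set.range fun e => (v e : Space)) := by
    rw [← N.isZLattice.span_top, Submodule.span_le]
    intro g hg
    have h1 : (⟨g, hg⟩ : N.lattice) ∈ Submodule.span ℤ (Set.range v) := hspan trivial
    have h2 := Submodule.mem_map_of_mem (f := N.lattice.subtype) h1
    rw [Submodule.map_span, ← Set.range_comp] at h2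
    exact Submodule.span_le_restrictScalars ℤ ℝ _ h2
  have hrank : 3 ≤ Fintype.card B := by
    have h1 := finrank_range_le_card (R := ℝ) (fun e => (v e : Space))
    rw [Set.finrank, top_le_iff.1 hspanR, finrank_top] at h1
    simpa using h1
  refine ⟨by omega, fun hcard => ?_⟩
  have hB3 : Fintype.card B = 3 := by omega
  -- Three voltages spanning $\mathbb R^3$ are independent; as they also generate the lattice over
  -- $\mathbb Z$, they form a basis.
  have hli : LinearIndependent ℝ fun e => (v e : Space) :=
    linearIndependent_of_top_le_span_of_card_eq_finrank hspanR (by rw [hB3]; simp)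
  have hliZ : LinearIndependent ℤ v :=
    LinearIndependent.of_comp N.lattice.subtype (hli.restrict_scalars' ℤ)
  let ε : Fin 3 ≃ B := (Fintype.equivFinOfCardEq hB3).symm
  let b : Module.Basis (Fin 3) ℤ N.lattice := (Module.Basis.mk hliZ hspan).reindex ε.symm
  have hb : ∀ m, b m = v (ε m) := by intro m; simp [b]
  refine ⟨b, ?_, ?_⟩
  · intro i j g hg
    rcases hvolt' ⟨i, j, g, hg⟩ with h | ⟨e, h | h⟩
    · exact Or.inl h
    · exact Or.inr ⟨ε.symm e, Or.inl (by rw [hb, Equiv.apply_symm_apply]; exact h)⟩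
    · exact Or.inr ⟨ε.symm e, Or.inr (by rw [hb, Equiv.apply_symm_apply]; exact h)⟩
  -- A basis vector is neither zero, nor another basis vector, nor minus a basis vector, so it is
  -- the voltage of a single dart.
  · have key : ∀ m, ∀ y : Dart σ, y.2.2.1 = b m → y = x (ε m).1 := by
      intro m y hy
      rw [hb] at hy
      have hv0 : v (ε m) ≠ 0 := hliZ.ne_zero _
      rcases hvolt y with h | ⟨e, -, h | h⟩
      · exact absurd (hy.symm.trans h) hv0
      · have : v e = v (ε m) := by rw [← hy, h]
        rw [h, hliZ.injective this]
      · exfalso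
        have h1 : -v e = v (ε m) := by rw [← hy, h]; rfl
        have h2 := congrArg (fun g => b.repr g m) h1
        rw [← hb, ← ε.apply_symm_apply e, ← hb] at h2
        by_cases he : ε.symm e = m <;> simp [he] at h2
    intro m i j i' j' h h'
    have e := (key m ⟨i, j, b m, h⟩ rfl).trans (key m ⟨i', j', b m, h'⟩ rfl).symm
    obtain ⟨h1, h2, -⟩ := Dart.ext_iff'.1 e
    exact ⟨h1, h2⟩

end PeriodicNetwork

/-! ### Contracting a spanning tree. -/

-- Being on a common ray is a closed condition, so its failure survives small perturbations.
open Filter Topology in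
theorem eventually_not_sameRay {u v : Space} (a b : Space) (h : ¬ SameRay ℝ u v) :
    ∀ᶠ t in 𝓝[>] (0 : ℝ), ¬ SameRay ℝ (u + t • a) (v + t • b) := by
  simp only [sameRay_iff_norm_smul_eq] at h ⊢
  have hc : Continuous fun t : ℝ => ‖u + t • a‖ • (v + t • b) - ‖v + t • b‖ • (u + t • a) := by
    fun_prop
  have h0 := hc.tendsto 0
  simp only [zero_smul, add_zero] at h0
  have h1 := h0.eventually_ne (sub_ne_zero.2 h)
  exact (h1.filter_mono nhdsWithin_le_nhds).mono fun t ht => sub_ne_zero.1 ht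

theorem mul_eq_mul_of_sameRay {x y : Space} (h : SameRay ℝ x y) (i j : Fin 3) :
    x i * y j = x j * y i := by
  rcases h with rfl | rfl | ⟨r, s, hr, hs, e⟩
  · simp
  · simp
  · have h1 := congrArg (fun v : Space => v i) e
    have h2 := congrArg (fun v : Space => v j) e
    simp only [PiLp.smul_apply, smul_eq_mul] at h1 h2
    have : r * (x i * y j) = r * (x j * y i) := by
      linear_combination y j * h1 - y i * h2
    exact mul_left_cancel₀ hr.ne' this

theorem sameRay_of_smul_left {r : ℝ} (hr : 0 < r) {x y : Space} (h : SameRay ℝ (r • x) y) :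
    SameRay ℝ x y := by
  have := h.pos_smul_left (inv_pos.2 hr)
  rwa [inv_smul_smul₀ hr.ne'] at this

/-- An integer vector as a vector of `ℝ³`. -/
noncomputable def intVec (z : Fin 3 → ℤ) : Space := !₂[(z 0 : ℝ), z 1, z 2]

/-- Integer vectors of length one. -/
def IsAxis (z : Fin 3 → ℤ) : Prop := ∃ m, z = Pi.single m 1 ∨ z = -Pi.single m 1

theorem IsAxis.norm_intVec {z : Fin 3 → ℤ} (h : IsAxis z) : ‖intVec z‖ = 1 := by
  obtain ⟨m, rfl | rfl⟩ := h <;> fin_cases m <;> simp [intVec, norm_euclidean_three]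

theorem IsAxis.not_sameRay {z w : Fin 3 → ℤ} (hz : IsAxis z) (hw : IsAxis w) (h : z ≠ w) :
    ¬ SameRay ℝ (intVec z) (intVec w) := by
  intro hs
  apply h
  rw [sameRay_iff_norm_smul_eq, hz.norm_intVec, hw.norm_intVec, one_smul, one_smul] at hs
  ext m
  have := congrArg (fun v : Space => v m) hs
  fin_cases m <;> simpa [intVec] using this.symm

theorem IsAxis.not_sameRay_of_ne_zero {z : Fin 3 → ℤ} (hz : IsAxis z) {a : Space} (h0 : a 0 ≠ 0)
    (h1 : a 1 ≠ 0) : ¬ SameRay ℝ a (intVec z) := by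
  intro hs
  have e01 := mul_eq_mul_of_sameRay hs 0 1
  have e02 := mul_eq_mul_of_sameRay hs 0 2
  obtain ⟨m, rfl | rfl⟩ := hz <;> fin_cases m <;> simp [intVec] at e01 e02 <;> simp_all

/-- Points of the plane on a parabola. -/
noncomputable def parabola (i : ℕ) : Space := !₂[(i : ℝ), (i : ℝ) ^ 2, 0]

theorem parabola_sub_ne_zero {i j : ℕ} (h : i ≠ j) :
    (parabola j - parabola i) 0 ≠ 0 ∧ (parabola j - parabola i) 1 ≠ 0 := by
  have h1 : (j : ℝ) - i ≠ 0 := sub_ne_zero.2 fun e => h (by exact_mod_cast e.symm)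
  have h2 : (j : ℝ) + i ≠ 0 := by
    have : j + i ≠ 0 := by omega
    exact_mod_cast this
  refine ⟨by simpa [parabola] using h1, ?_⟩
  have : (parabola j - parabola i) 1 = ((j : ℝ) - i) * (j + i) := by simp [parabola]; ring
  rw [this]
  exact mul_ne_zero h1 h2

/-- No three points of a parabola are collinear: the determinant is the Vandermonde product of the
three differences. Tree edges thus stay in distinct directions while they shrink. -/
theorem parabola_not_sameRay {i j k : ℕ} (hj : i ≠ j) (hk : i ≠ k) (hjk : j ≠ k) :
    ¬ SameRay ℝ (parabola j - parabola i) (parabola k - parabola i) := by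
  intro hs
  have e := mul_eq_mul_of_sameRay hs 0 1
  simp [parabola] at e
  have h1 : (j : ℝ) - i ≠ 0 := sub_ne_zero.2 fun e => hj (by exact_mod_cast e.symm)
  have h2 : (k : ℝ) - i ≠ 0 := sub_ne_zero.2 fun e => hk (by exact_mod_cast e.symm)
  have h3 : (k : ℝ) - j ≠ 0 := sub_ne_zero.2 fun e => hjk (by exact_mod_cast e.symm)
  have : ((j : ℝ) - i) * (k - i) * (k - j) = 0 := by linear_combination e
  simp [h1, h2, h3] at this

namespace PeriodicNetwork

variable {d : ℕ} {N : PeriodicNetwork 3 d} {ι : Type} {σ : ι → N.Vert}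

/-- The voltage graph of a network, with new generators and positions. -/
noncomputable def voltageGraph (σ : ι → N.Vert) (b : Module.Basis (Fin 3) ℤ N.lattice)
    (e : Fin 3 → Space) (he : det₃ (e 0) (e 1) (e 2) ≠ 0) (p : ι → Space) : VoltageGraph ι where
  S i j := (N.volt (σ i) (σ j)).map b.equivFun.toEquiv.toEmbedding
  neg_mem i j g h := by
    obtain ⟨a, ha, rfl⟩ := Finset.mem_map.1 h
    exact Finset.mem_map.2 ⟨-a, N.neg_mem_volt.2 ha, map_neg b.equivFun a⟩
  zero_notMem i h := by
    obtain ⟨a, ha, h0⟩ := Finset.mem_map.1 h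
    have : a = 0 := b.equivFun.map_eq_zero_iff.1 h0
    subst this
    exact N.ne_zero_of_mem_volt_self ha rfl
  e := e
  det_ne := he
  p := p

variable {b : Module.Basis (Fin 3) ℤ N.lattice} {e : Fin 3 → Space}
  {he : det₃ (e 0) (e 1) (e 2) ≠ 0} {p : ι → Space}

theorem mem_voltageGraph {i j : ι} {z : Fin 3 → ℤ} :
    z ∈ (N.voltageGraph σ b e he p).S i j ↔ ∃ g ∈ N.volt (σ i) (σ j), b.equivFun g = z :=
  Finset.mem_map

theorem card_voltageGraph (i j : ι) :
    ((N.voltageGraph σ b e he p).S i j).card = (N.volt (σ i) (σ j)).card :=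
  Finset.card_map _

theorem IsTransversal.connected_voltageGraph (hσ : N.IsTransversal σ) :
    (N.voltageGraph σ b e he p).graph.Connected := by
  let ψ : ι × (Fin 3 → ℤ) → N.Vert := fun x => b.equivFun.symm x.2 +ᵥ σ x.1
  have hψ : Function.Bijective ψ := by
    constructor
    · intro x y h
      obtain ⟨h1, h2⟩ := hσ.vadd_inj h
      exact Prod.ext h1 (b.equivFun.symm.injective h2)
    · intro v
      obtain ⟨g, i, rfl⟩ := hσ.exists_vadd v
      exact ⟨(i, b.equivFun g), by simp only [ψ, LinearEquiv.symm_apply_apply]⟩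
  let φ : (N.voltageGraph σ b e he p).graph ≃g N.graph :=
    { toEquiv := Equiv.ofBijective ψ hψ
      map_rel_iff' := by
        intro x y
        change N.graph.Adj (ψ x) (ψ y) ↔ _
        rw [adj_vadd_vadd_iff, ← map_sub, VoltageGraph.graph_adj, mem_voltageGraph]
        constructor
        · intro h
          exact ⟨_, N.mem_volt.2 h, LinearEquiv.apply_symm_apply _ _⟩
        · rintro ⟨g, hg, h⟩
          rw [← h, LinearEquiv.symm_apply_apply]
          exact N.mem_volt.1 hg }
  exact φ.connected_iff.2 N.connected

theorem vertexCount_eq_of_sameQuotient {d' : ℕ} {M : PeriodicNetwork 3 d'}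
    (h : N.SameQuotient M) : M.vertexCount = N.vertexCount := by
  obtain ⟨φ, -⟩ := h
  exact (Nat.card_congr φ).symm

open Filter Topology in
/-- Contracting a spanning tree: a network whose quotient graph has first Betti number three can
be deformed to one whose length quotient is close to that of the primitive cubic network. -/
theorem exists_sameQuotient_of_card_quotEdge (N : PeriodicNetwork 3 d)
    (hE : Fintype.card N.QuotEdge = N.vertexCount + 2) :
    ∃ M : PeriodicNetwork 3 d, N.SameQuotient M ∧ M.length ^ 3 < 54 * M.spannedVolume := by
  classical
  obtain ⟨σ, hσ, -, hb⟩ := N.exists_tree_basis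
  obtain ⟨b, hb1, hb2⟩ := hb hE
  let e : Fin 3 → Space := ![!₂[1, 0, 0], !₂[0, 1, 0], !₂[0, 0, 1]]
  have he : det₃ (e 0) (e 1) (e 2) = 1 := by simp [e, det₃]
  -- As `t` tends to 0 from the right, all vertices of the transversal shrink to the origin along a
  -- fixed shape: tree edges have length of order `t`, the three others tend to unit coordinate
  -- vectors.
  let X : ℝ → VoltageGraph (Fin N.vertexCount) := fun t =>
    N.voltageGraph σ b e (by rw [he]; exact one_ne_zero) (fun i => t • parabola i)
  have hvec : ∀ t i j z, (X t).vec i j z = intVec z + t • (parabola j - parabola i) := by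
    intro t i j z
    ext m
    rw [VoltageGraph.vec_apply]
    fin_cases m <;> simp [X, voltageGraph, e, intVec, parabola] <;> ring
  let S : Fin N.vertexCount → Fin N.vertexCount → Finset (Fin 3 → ℤ) := (X 0).S
  have hS : ∀ t, (X t).S = S := fun t => rfl
  have hsingle : ∀ m, b.equivFun (b m) = Pi.single m 1 := by
    intro m; ext k; simp [Pi.single_apply, eq_comm]
  have haxis : ∀ i j, ∀ z ∈ S i j, z = 0 ∨ IsAxis z := by
    intro i j z hz
    obtain ⟨g, hg, rfl⟩ := mem_voltageGraph.1 hz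
    rcases hb1 i j g hg with rfl | ⟨m, rfl | rfl⟩
    · left; exact map_zero _
    · right; exact ⟨m, Or.inl (hsingle m)⟩
    · right; exact ⟨m, Or.inr (by rw [map_neg, hsingle])⟩
  have hpos1 : ∀ m i j i' j', Pi.single m 1 ∈ S i j → Pi.single m 1 ∈ S i' j' →
      i = i' ∧ j = j' := by
    intro m i j i' j' h h'
    obtain ⟨g, hg, h1⟩ := mem_voltageGraph.1 h
    obtain ⟨g', hg', h1'⟩ := mem_voltageGraph.1 h'
    rw [← hsingle] at h1 h1'
    rw [b.equivFun.injective h1] at hg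
    rw [b.equivFun.injective h1'] at hg'
    exact hb2 m i j i' j' hg hg'
  have huniq : ∀ z, IsAxis z → ∀ i j i' j', z ∈ S i j → z ∈ S i' j' → i = i' ∧ j = j' := by
    rintro z ⟨m, rfl | rfl⟩ i j i' j' h h'
    · exact hpos1 m i j i' j' h h'
    · have h1 := (X 0).neg_mem _ _ _ h
      have h1' := (X 0).neg_mem _ _ _ h'
      rw [neg_neg] at h1 h1'
      exact (hpos1 m j i j' i' h1 h1').symm
  have hzero : ∀ i j, (0 : Fin 3 → ℤ) ∈ S i j → i.1 ≠ j.1 := by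
    intro i j h hij
    rw [Fin.ext hij] at h
    exact (X 0).zero_notMem j h
  -- Two tree edges are separated by the parabola, a tree edge and an axis edge since differences of
  -- parabola points have two nonzero coordinates, and two axis edges since no two darts share an
  -- axis voltage.
  have hray : ∀ i j k, ∀ z ∈ S i j, ∀ w ∈ S i k, (j, z) ≠ (k, w) →
      ∀ᶠ t in 𝓝[>] (0 : ℝ), ¬ SameRay ℝ ((X t).vec i j z) ((X t).vec i k w) := by
    intro i j k z hz w hw hne
    simp only [hvec]
    have hmixed : ∀ j k z w, (0 : Fin 3 → ℤ) ∈ S i j → z = 0 → IsAxis w → ∀ᶠ t in 𝓝[>] (0 : ℝ),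
        ¬ SameRay ℝ (intVec z + t • (parabola j - parabola i))
          (intVec w + t • (parabola k - parabola i)) := by
      intro j k z w h0 hz hw
      obtain ⟨h1, h2⟩ := parabola_sub_ne_zero (hzero i j h0)
      have h3 := eventually_not_sameRay 0 (parabola k - parabola i)
        (hw.not_sameRay_of_ne_zero h1 h2)
      filter_upwards [h3, self_mem_nhdsWithin] with t ht htpos hs
      apply ht
      have h5 : intVec z = 0 := by rw [hz]; ext m; fin_cases m <;> simp [intVec]
      rw [h5, zero_add] at hs
      rw [smul_zero, add_zero]
      exact sameRay_of_smul_left htpos hs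
    rcases haxis i j z hz with hz0 | hz1 <;> rcases haxis i k w hw with hw0 | hw1
    · have hjk : j ≠ k := by
        rintro rfl
        exact hne (by rw [hz0, hw0])
      subst hz0 hw0
      have h5 : intVec 0 = 0 := by ext m; fin_cases m <;> simp [intVec]
      rw [h5]
      filter_upwards [self_mem_nhdsWithin] with t htpos hs
      rw [zero_add, zero_add] at hs
      exact parabola_not_sameRay (hzero i j hz) (hzero i k hw) (fun h => hjk (Fin.ext h))
        (sameRay_of_smul_left htpos (sameRay_of_smul_left htpos hs).symm).symm
    · exact hmixed j k z w (hz0 ▸ hz) hz0 hw1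
    · refine (hmixed k j w z (hw0 ▸ hw) hw0 hz1).mono fun t ht hs => ht hs.symm
    · refine eventually_not_sameRay _ _ (hz1.not_sameRay hw1 ?_)
      rintro rfl
      exact hne (by rw [(huniq z hz1 i j i k hz hw).2])
  have hstar : ∀ᶠ t in 𝓝[>] (0 : ℝ), (X t).StarEmbedded := by
    unfold VoltageGraph.StarEmbedded
    simp only [hS]
    simp only [eventually_all, eventually_all_finset]
    intro i j k z hz w hw hne
    exact hray i j k z hz w hw hne
  have hnz : ∀ᶠ t in 𝓝[>] (0 : ℝ), ∀ i j, ∀ z ∈ (X t).S i j, (X t).vec i j z ≠ 0 := by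
    simp only [hS]
    simp only [eventually_all, eventually_all_finset]
    intro i j z hz
    simp only [hvec]
    rcases haxis i j z hz with hz0 | hz1
    · subst hz0
      filter_upwards [self_mem_nhdsWithin] with t htpos h
      have h5 : intVec 0 = 0 := by ext m; fin_cases m <;> simp [intVec]
      rw [h5, zero_add] at h
      have h6 := congrArg (fun v : Space => v 0) h
      have h7 := (parabola_sub_ne_zero (hzero i j hz)).1
      simp only [PiLp.smul_apply, smul_eq_mul, PiLp.zero_apply, mul_eq_zero] at h6
      exact h6.elim (fun h => (ne_of_gt htpos) h) h7
    · have hc : Continuous fun t : ℝ => intVec z + t • (parabola j - parabola i) := by fun_prop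
      have h0 := hc.tendsto 0
      simp only [zero_smul, add_zero] at h0
      have hne : intVec z ≠ 0 := by
        intro h
        have := hz1.norm_intVec
        rw [h, norm_zero] at this
        exact zero_ne_one this
      exact (h0.eventually_ne hne).filter_mono nhdsWithin_le_nhds
  -- This sum is twice the length. In the limit it is at most 6, as each of the six axis voltages
  -- occurs on at most one dart; hence $L\le3.5$ nearby, and $3.5^3<54$ with volume 1.
  have hlen : ∀ᶠ t in 𝓝[>] (0 : ℝ), ∑ i, ∑ j, ∑ z ∈ (X t).S i j, ‖(X t).vec i j z‖ < 7 := by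
    simp only [hS, hvec]
    have hc : Continuous fun t : ℝ =>
        ∑ i, ∑ j, ∑ z ∈ S i j, ‖intVec z + t • (parabola j - parabola i)‖ := by
      fun_prop
    have h0 := hc.tendsto 0
    simp only [zero_smul, add_zero] at h0
    refine (h0.eventually_lt_const ?_).filter_mono nhdsWithin_le_nhds
    let A : Finset (Fin 3 → ℤ) := Finset.univ.image (fun m => Pi.single m 1) ∪
      Finset.univ.image (fun m => -Pi.single m 1)
    have hA : ∀ z, IsAxis z → z ∈ A := by
      rintro z ⟨m, rfl | rfl⟩
      · exact Finset.mem_union_left _ (Finset.mem_image_of_mem _ (Finset.mem_univ m))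
      · exact Finset.mem_union_right _
          (Finset.mem_image_of_mem (fun m => -Pi.single m 1) (Finset.mem_univ m))
    have hAcard : A.card ≤ 6 :=
      (Finset.card_union_le _ _).trans (add_le_add Finset.card_image_le Finset.card_image_le)
    have h1 : ∀ i j, ∑ z ∈ S i j, ‖intVec z‖ = ∑ z ∈ A, if z ∈ S i j ∧ IsAxis z then (1 : ℝ) else 0 := by
      intro i j
      rw [← Finset.sum_filter, ← Finset.sum_filter_add_sum_filter_not (S i j) IsAxis]
      have h2 : ∑ z ∈ S i j with ¬ IsAxis z, ‖intVec z‖ = 0 := by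
        refine Finset.sum_eq_zero fun z hz => ?_
        obtain ⟨hz, hz'⟩ := Finset.mem_filter.1 hz
        rw [(haxis i j z hz).resolve_right hz', norm_eq_zero]
        ext m; fin_cases m <;> simp [intVec]
      rw [h2, add_zero]
      have h3 : (S i j).filter IsAxis = A.filter fun z => z ∈ S i j ∧ IsAxis z := by
        ext z
        simp only [Finset.mem_filter]
        exact ⟨fun h => ⟨hA z h.2, h⟩, fun h => h.2⟩
      rw [h3]
      exact Finset.sum_congr rfl fun z hz => (Finset.mem_filter.1 hz).2.2.norm_intVec
    simp only [h1]
    have h2 : ∀ z ∈ A, ∑ i, ∑ j, (if z ∈ S i j ∧ IsAxis z then (1 : ℝ) else 0) ≤ 1 := by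
      intro z _
      rw [← Fintype.sum_prod_type' (fun i j => if z ∈ S i j ∧ IsAxis z then (1 : ℝ) else 0),
        Finset.sum_boole]
      have : (Finset.univ.filter fun x : Fin N.vertexCount × Fin N.vertexCount =>
          z ∈ S x.1 x.2 ∧ IsAxis z).card ≤ 1 := by
        rw [Finset.card_le_one]
        intro x hx y hy
        obtain ⟨-, hx1, hx2⟩ := Finset.mem_filter.1 hx
        obtain ⟨-, hy1, -⟩ := Finset.mem_filter.1 hy
        obtain ⟨h3, h4⟩ := huniq z hx2 _ _ _ _ hx1 hy1
        exact Prod.ext h3 h4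
      exact_mod_cast this
    have h3 : ∑ i, ∑ j, ∑ z ∈ A, (if z ∈ S i j ∧ IsAxis z then (1 : ℝ) else 0) =
        ∑ z ∈ A, ∑ i, ∑ j, (if z ∈ S i j ∧ IsAxis z then (1 : ℝ) else 0) := by
      rw [Finset.sum_comm (s := A)]
      exact Finset.sum_congr rfl fun i _ => Finset.sum_comm
    rw [h3]
    calc _ ≤ ∑ z ∈ A, (1 : ℝ) := Finset.sum_le_sum h2
      _ = A.card := by simp
      _ ≤ 6 := by exact_mod_cast hAcard
      _ < 7 := by norm_num
  obtain ⟨t, ht1, ht2, ht3⟩ := (hstar.and (hnz.and hlen)).exists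
  have hdeg : ∀ i, ∑ j, ((X t).S i j).card = d := by
    intro i
    simp only [X, card_voltageGraph]
    exact hσ.sum_card_volt _
  refine ⟨(X t).network N.three_le hσ.connected_voltageGraph hdeg ht2 ht1, ?_, ?_⟩
  · refine sameQuotient_of_card_volt_eq hσ VoltageGraph.isTransversal_origin fun i j => ?_
    rw [VoltageGraph.card_volt_network, card_voltageGraph]
  · have hL := VoltageGraph.two_mul_length_network (X := X t) (hd := N.three_le)
      (hconn := hσ.connected_voltageGraph) (hdeg := hdeg) (hvec := ht2) (hstar := ht1)
    rw [VoltageGraph.spannedVolume_network]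
    have hdet : |det₃ ((X t).e 0) ((X t).e 1) ((X t).e 2)| = 1 := by
      change |det₃ (e 0) (e 1) (e 2)| = 1
      rw [he, abs_one]
    rw [hdet]
    rw [← hL] at ht3
    have hL0 : 0 ≤ ((X t).network N.three_le hσ.connected_voltageGraph hdeg ht2 ht1).length := by
      have : 0 ≤ ∑ i, ∑ j, ∑ g ∈ (X t).S i j, ‖(X t).vec i j g‖ := by positivity
      linarith
    generalize ((X t).network N.three_le hσ.connected_voltageGraph hdeg ht2 ht1).length = L
      at ht3 hL0
    have hL1 : L ≤ 3.5 := by linarith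
    calc L ^ 3 ≤ 3.5 ^ 3 := by gcongr
      _ < _ := by norm_num

end PeriodicNetwork

/-! ### Shortening a bridge. -/

namespace PeriodicNetwork

variable {n d : ℕ}

/-- The same graph and lattice, with other positions of the vertices. -/
def reposition (N : PeriodicNetwork n d) (p : N.Vert → EuclideanSpace ℝ (Fin n))
    (hne : ∀ u v, N.graph.Adj u v → p u ≠ p v)
    (hstar : ∀ v u w, N.graph.Adj v u → N.graph.Adj v w → u ≠ w →
      segment ℝ (p v) (p u) ∩ segment ℝ (p v) (p w) = {p v})
    (hvadd : ∀ (g : N.lattice) (v : N.Vert), p (g +ᵥ v) = (g : EuclideanSpace ℝ (Fin n)) + p v) :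
    PeriodicNetwork n d :=
  { N with pos := p, pos_ne := hne, star_embedded := hstar, pos_vadd := hvadd }

section reposition

variable (N : PeriodicNetwork n d) (p : N.Vert → EuclideanSpace ℝ (Fin n))
  (hne : ∀ u v, N.graph.Adj u v → p u ≠ p v)
  (hstar : ∀ v u w, N.graph.Adj v u → N.graph.Adj v w → u ≠ w →
    segment ℝ (p v) (p u) ∩ segment ℝ (p v) (p w) = {p v})
  (hvadd : ∀ (g : N.lattice) (v : N.Vert), p (g +ᵥ v) = (g : EuclideanSpace ℝ (Fin n)) + p v)

theorem spannedVolume_reposition :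
    (N.reposition p hne hstar hvadd).spannedVolume = N.spannedVolume := rfl

theorem sameQuotient_reposition : N.SameQuotient (N.reposition p hne hstar hvadd) := by
  refine ⟨Equiv.refl N.QuotVert, Equiv.refl N.QuotEdge, fun e => ?_⟩
  exact (congrFun Sym2.map_id (N.ends e)).symm

end reposition

theorem length_reposition (N : PeriodicNetwork 3 d) {σ : Fin 2 → N.Vert} (hσ : N.IsTransversal σ)
    (p : N.Vert → Space) (hne : ∀ u v, N.graph.Adj u v → p u ≠ p v)
    (hstar : ∀ v u w, N.graph.Adj v u → N.graph.Adj v w → u ≠ w →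
      segment ℝ (p v) (p u) ∩ segment ℝ (p v) (p w) = {p v})
    (hvadd : ∀ (g : N.lattice) (v : N.Vert), p (g +ᵥ v) = (g : Space) + p v) :
    2 * (N.reposition p hne hstar hvadd).length =
      ∑ g ∈ N.volt (σ 0) (σ 0), ‖(g : Space)‖ + ∑ g ∈ N.volt (σ 1) (σ 1), ‖(g : Space)‖ +
        2 * ∑ g ∈ N.volt (σ 0) (σ 1), ‖p (g +ᵥ σ 1) - p (σ 0)‖ := by
  have hM : (N.reposition p hne hstar hvadd).IsTransversal σ := hσ
  exact hM.length_of_two_vertices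

/-- A bridge of a quotient graph with two vertices can be shortened. -/
theorem exists_length_lt_of_bridge (N : PeriodicNetwork 3 d) {σ : Fin 2 → N.Vert}
    (hσ : N.IsTransversal σ) (h1 : (N.volt (σ 0) (σ 1)).card = 1) :
    ∃ M : PeriodicNetwork 3 d, N.SameQuotient M ∧ 0 ≤ M.length ∧ M.length < N.length ∧
      M.spannedVolume = N.spannedVolume := by
  classical
  obtain ⟨h, hh⟩ := Finset.card_eq_one.1 h1
  obtain ⟨y, hy⟩ : ∃ y, y = N.vec (σ 0) (σ 1) h := ⟨_, rfl⟩
  have hmem : h ∈ N.volt (σ 0) (σ 1) := by rw [hh]; exact Finset.mem_singleton_self h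
  have hy0 : y ≠ 0 := hy ▸ N.vec_ne_zero hmem
  -- Moving the whole orbit of `σ 1` halfway back along the bridge halves the bridge and leaves the
  -- loops unchanged.
  obtain ⟨pos', hpos'⟩ : ∃ f : N.Vert → Space, ∀ v, f v =
      if (Quotient.mk _ v : N.QuotVert) = Quotient.mk _ (σ 1) then N.pos v - (1 / 2 : ℝ) • y
      else N.pos v := ⟨_, fun _ => rfl⟩
  have hpos0 : ∀ g : N.lattice, pos' (g +ᵥ σ 0) = N.pos (g +ᵥ σ 0) := by
    intro g
    refine (hpos' _).trans (if_neg ?_)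
    rw [quot_mk_vadd]
    intro e
    exact zero_ne_one (hσ.1 e)
  have hpos1 : ∀ g : N.lattice, pos' (g +ᵥ σ 1) = N.pos (g +ᵥ σ 1) - (1 / 2 : ℝ) • y := by
    intro g
    exact (hpos' _).trans (if_pos (N.quot_mk_vadd _ _))
  have hbridge : ∀ g g' : N.lattice, N.graph.Adj (g +ᵥ σ 0) (g' +ᵥ σ 1) →
      N.pos (g' +ᵥ σ 1) - N.pos (g +ᵥ σ 0) = y := by
    intro g g' hadj
    have h2 := N.mem_volt.2 ((N.adj_vadd_vadd_iff _ _ _ _).1 hadj)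
    rw [hh, Finset.mem_singleton] at h2
    rw [hy, vec_eq, ← h2, N.pos_vadd, N.pos_vadd]
    push_cast
    abel
  -- Every edge vector is only rescaled by 1 or 1/2, so directions, and with them the embedded
  -- stars, are preserved.
  have hscale : ∀ u v, N.graph.Adj u v → ∃ c : ℝ, 0 < c ∧
      pos' v - pos' u = c • (N.pos v - N.pos u) := by
    intro u v hadj
    obtain ⟨g, i, rfl⟩ := hσ.exists_vadd u
    obtain ⟨g', j, rfl⟩ := hσ.exists_vadd v
    fin_cases i <;> fin_cases j
    · exact ⟨1, one_pos, by simp [hpos0]⟩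
    · refine ⟨1 / 2, by norm_num, ?_⟩
      have := hbridge g g' hadj
      simp only [Fin.zero_eta, Fin.mk_one, hpos0, hpos1]
      rw [this, sub_right_comm, this]
      module
    · refine ⟨1 / 2, by norm_num, ?_⟩
      have := hbridge g' g hadj.symm
      simp only [Fin.zero_eta, Fin.mk_one, hpos0, hpos1]
      rw [← neg_sub (N.pos _) (N.pos (g' +ᵥ σ 0)), this, sub_sub_eq_add_sub, add_sub_right_comm,
        ← neg_sub (N.pos _) (N.pos (g' +ᵥ σ 0)), this]
      module
    · exact ⟨1, one_pos, by simp [hpos1]⟩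
  have hne : ∀ u v, N.graph.Adj u v → pos' v ≠ pos' u := by
    intro u v hadj e
    obtain ⟨c, hc, h2⟩ := hscale u v hadj
    rw [sub_eq_zero.2 e] at h2
    rcases smul_eq_zero.1 h2.symm with h3 | h3
    · exact hc.ne' h3
    · exact N.pos_ne u v hadj (sub_eq_zero.1 h3).symm
  have hstar : ∀ v u w, N.graph.Adj v u → N.graph.Adj v w → u ≠ w →
      segment ℝ (pos' v) (pos' u) ∩ segment ℝ (pos' v) (pos' w) = {pos' v} := by
    intro v u w hu hw huw
    rw [segment_inter_segment_eq_singleton_iff (hne v u hu) (hne v w hw)]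
    obtain ⟨c, hc, h2⟩ := hscale v u hu
    obtain ⟨c', hc', h3⟩ := hscale v w hw
    rw [h2, h3]
    intro hs
    refine (segment_inter_segment_eq_singleton_iff (N.pos_ne v u hu).symm
      (N.pos_ne v w hw).symm).1 (N.star_embedded v u w hu hw huw) ?_
    exact (sameRay_of_smul_left hc' (sameRay_of_smul_left hc hs).symm).symm
  have hvadd : ∀ (g : N.lattice) (v : N.Vert), pos' (g +ᵥ v) = (g : Space) + pos' v := by
    intro g v
    obtain ⟨a, i, rfl⟩ := hσ.exists_vadd v
    rw [vadd_vadd]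
    fin_cases i
    · simp only [Fin.zero_eta, hpos0, N.pos_vadd]
      push_cast
      abel
    · simp only [Fin.mk_one, hpos1, N.pos_vadd]
      push_cast
      abel
  have hvec : pos' (h +ᵥ σ 1) - pos' (σ 0) = (1 / 2 : ℝ) • y := by
    have h2 := hpos0 0
    rw [zero_vadd] at h2
    rw [hpos1, h2, sub_right_comm]
    have h3 := hbridge 0 h (by rw [zero_vadd]; exact N.mem_volt.1 hmem)
    rw [zero_vadd] at h3
    rw [h3]
    module
  have hLM := N.length_reposition hσ pos' (fun u v hadj => (hne u v hadj).symm) hstar hvadd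
  have hLN := hσ.length_of_two_vertices
  rw [hh, Finset.sum_singleton, hvec, norm_smul, Real.norm_of_nonneg (by norm_num)] at hLM
  rw [hh, Finset.sum_singleton, ← hy] at hLN
  have hy1 : 0 < ‖y‖ := norm_pos_iff.2 hy0
  have h4 : 0 ≤ ∑ g ∈ N.volt (σ 0) (σ 0), ‖(g : Space)‖ :=
    Finset.sum_nonneg fun _ _ => norm_nonneg _
  have h5 : 0 ≤ ∑ g ∈ N.volt (σ 1) (σ 1), ‖(g : Space)‖ :=
    Finset.sum_nonneg fun _ _ => norm_nonneg _
  exact ⟨_, N.sameQuotient_reposition _ _ _ _, by linarith, by linarith,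
    N.spannedVolume_reposition _ _ _ _⟩

/-! ### Minimizers of small degree and the conclusion. -/

theorem IsIrreducible.vertexCount_le {N M : PeriodicNetwork 3 d} (hN : N.IsIrreducible)
    (hM : M.IsBalanced) : N.vertexCount ≤ M.vertexCount :=
  hN.2 ⟨M, hM, rfl⟩

/-- Irreducibility refers only to the vertex count, not to balance, so every network on the quotient
graph of a minimizer competes with it. -/
theorem IsIrreducible.of_sameQuotient {N M : PeriodicNetwork 3 d} (hN : N.IsIrreducible)
    (h : N.SameQuotient M) : M.IsIrreducible := by
  unfold IsIrreducible
  rw [vertexCount_eq_of_sameQuotient h]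
  exact hN

theorem vertexCount_le_two_of_isIrreducible {N : PeriodicNetwork 3 d} (hd : 5 ≤ d)
    (hN : N.IsIrreducible) : N.vertexCount ≤ 2 := by
  rcases Nat.even_or_odd d with he | ⟨k, hk⟩
  · obtain ⟨M, hM, hc⟩ := exists_isBalanced_of_even (by obtain ⟨k, hk⟩ := he; omega) he
    have := hN.vertexCount_le hM
    omega
  · obtain ⟨M, τ, hτ, hM, -⟩ :=
      exists_layered_network (d := d) (l := k - 1) (by omega) (by omega)
    have := hN.vertexCount_le hM
    rwa [hτ.card_eq, Fintype.card_fin] at this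

theorem lengthQuotient_lt_of_lt {N : PeriodicNetwork 3 d}
    (h : N.length ^ 3 < 54 * N.spannedVolume) : N.lengthQuotient < 54 :=
  (div_lt_iff₀ spannedVolume_pos).2 h

theorem IsMinimizer.lengthQuotient_lt_of_sameQuotient {N M : PeriodicNetwork 3 d}
    (hN : N.IsMinimizer) (h : N.SameQuotient M) (hM : M.length ^ 3 < 54 * M.spannedVolume) :
    N.lengthQuotient < 54 :=
  (hN.2 M (hN.1.of_sameQuotient h) h).trans_lt (lengthQuotient_lt_of_lt hM)

theorem IsMinimizer.lengthQuotient_lt_of_degree_five {N : PeriodicNetwork 3 5}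
    (hN : N.IsMinimizer) : N.lengthQuotient < 54 := by
  have hk := vertexCount_le_two_of_isIrreducible le_rfl hN.1
  obtain ⟨σ', hσ', -, -⟩ := N.exists_tree_basis
  have hE := hσ'.two_mul_card_quotEdge
  have hpos := N.vertexCount_pos
  rw [Fintype.card_fin] at hE
  have hc : Nat.card N.QuotVert = 2 := by
    change N.vertexCount = 2
    omega
  obtain ⟨σ, hσ⟩ := N.exists_isTransversal
    ((finCongr hc).symm.trans (Finite.equivFin N.QuotVert).symm)
  have c0 := hσ.sum_card_volt (σ 0)
  have c1 := hσ.sum_card_volt (σ 1)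
  rw [Fin.sum_univ_two] at c0 c1
  have c2 := N.card_volt_comm (σ 0) (σ 1)
  obtain ⟨l, hl⟩ := hσ.even_card_volt_self 0
  have hcases : l = 0 ∨ l = 1 ∨ l = 2 := by omega
  rcases hcases with rfl | rfl | rfl
  · obtain ⟨M, τ, hτ, hcard, hM⟩ := exists_pyramidal_network
    refine hN.lengthQuotient_lt_of_sameQuotient (sameQuotient_of_card_volt_eq hσ hτ ?_) hM
    refine Fin.forall_fin_two.2 ⟨Fin.forall_fin_two.2 ⟨?_, ?_⟩, Fin.forall_fin_two.2 ⟨?_, ?_⟩⟩ <;>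
      rw [hcard]
    · exact hl
    · exact (by omega : (N.volt (σ 0) (σ 1)).card = 5)
    · exact (by omega : (N.volt (σ 1) (σ 0)).card = 5)
    · exact (by omega : (N.volt (σ 1) (σ 1)).card = 0)
  · obtain ⟨M, τ, hτ, -, hcard, hM⟩ := exists_layered_network (d := 5) le_rfl (by norm_num)
    refine hN.lengthQuotient_lt_of_sameQuotient (sameQuotient_of_card_volt_eq hσ hτ ?_) (hM rfl)
    refine Fin.forall_fin_two.2 ⟨Fin.forall_fin_two.2 ⟨?_, ?_⟩, Fin.forall_fin_two.2 ⟨?_, ?_⟩⟩ <;>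
      rw [hcard] <;> simp <;> omega
  -- Halving the bridge keeps the quotient graph and the volume but lowers the length, contradicting
  -- minimality.
  · exfalso
    obtain ⟨M, hNM, hL0, hL, hV⟩ := N.exists_length_lt_of_bridge hσ (by omega)
    have h1 := hN.2 M (hN.1.of_sameQuotient hNM) hNM
    unfold lengthQuotient at h1
    rw [hV, div_le_div_iff_of_pos_right spannedVolume_pos] at h1
    exact absurd (pow_lt_pow_left₀ hL hL0 three_ne_zero) h1.not_gt

/-- With $k$ vertices and $kd/2$ edges, the rank bound $k+2\le kd/2$ and the explicit balanced
networks leave only $k=4,2,1$ for $d=3,4,6$. In each case equality holds in the rank bound, so the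
spanning tree can be contracted. -/
theorem IsMinimizer.lengthQuotient_lt {N : PeriodicNetwork 3 d} (hd : d ≤ 6)
    (hN : N.IsMinimizer) : N.lengthQuotient < 54 := by
  obtain ⟨σ, hσ, hle, -⟩ := N.exists_tree_basis
  have hE := hσ.two_mul_card_quotEdge
  rw [Fintype.card_fin] at hE
  have hd3 := N.three_le
  have hcontract : Fintype.card N.QuotEdge = N.vertexCount + 2 → N.lengthQuotient < 54 := by
    intro h
    obtain ⟨M, hNM, hM⟩ := N.exists_sameQuotient_of_card_quotEdge h
    exact hN.lengthQuotient_lt_of_sameQuotient hNM hM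
  have hcases : d = 3 ∨ d = 4 ∨ d = 5 ∨ d = 6 := by omega
  rcases hcases with rfl | rfl | rfl | rfl
  · obtain ⟨M, hM, hc⟩ := exists_isBalanced_three
    have := hN.1.vertexCount_le hM
    exact hcontract (by omega)
  · obtain ⟨M, hM, hc⟩ := exists_isBalanced_four
    have := hN.1.vertexCount_le hM
    exact hcontract (by omega)
  · exact hN.lengthQuotient_lt_of_degree_five
  · obtain ⟨M, hM, hc⟩ := exists_isBalanced_of_even le_rfl (by decide : Even 6)
    have := hN.1.vertexCount_le hM
    exact hcontract (by omega)

end PeriodicNetwork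

theorem corollary7p3 (d : ℕ) (hd : 7 ≤ d) (N : PeriodicNetwork 3 d) (hN : N.IsIrreducible) :
    405 / 8 < N.length ^ 3 / N.spannedVolume ∧
    ∀ d' : ℕ, 3 ≤ d' → d' ≤ 6 → ∀ M : PeriodicNetwork 3 d', M.IsMinimizer →
      M.lengthQuotient < N.length ^ 3 / N.spannedVolume := by
  have h54 : 54 ≤ N.length ^ 3 / N.spannedVolume := by
    rw [le_div_iff₀ PeriodicNetwork.spannedVolume_pos]
    exact PeriodicNetwork.le_length_cube_of_vertexCount_le_two hd
      (PeriodicNetwork.vertexCount_le_two_of_isIrreducible (by omega) hN)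
  refine ⟨lt_of_lt_of_le (by norm_num) h54, fun d' _ hd' M hM => ?_⟩
  exact (hM.lengthQuotient_lt hd').trans_le h54
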